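/- Let $k$ be a field, $H$ a Hopf algebra over $k$ with bijective antipode $S$, let $L$ and $R$ be unital associative $k$-algebras and let $\phi\colon L\to R$ be an antiisomorphism of $k$-algebras. Sweedler notation is used throughout. *Conventions.* A left-right Yetter-Drinfeld $H$-module algebra $(L,\triangleright,\rho)$ is an algebra $L$ with a left $H$-action and a right $H$-coaction $\rho(x)=x_{[0]}\otimes x_{[1]}$ such that $f\triangleright(xy)=(f_{(1)}\triangleright x)(f_{(2)}\triangleright y)$, $f\triangleright 1=\epsilon(f)1$, $\rho(xy)=x_{[0]}y_{[0]}\otimes y_{[1]}x_{[1]}$, $\rho(1)=1\otimes1$ and $(f_{(1)}\triangleright x_{[0]})\otimes f_{(2)}x_{[1]}=(f_{(2)}\triangleright x)_{[0]}\otimes(f_{(2)}\triangleright x)_{[1]}f_{(1)}$; it is braided commutative if $x_{[0]}(x_{[1]}\triangleright a)=ax$. A right-left Yetter-Drinfeld $H$-module algebra $(R,\triangleleft,\lambda)$ is an algebra $R$ with a right $H$-action and a left $H$-coaction $\lambda(y)=y_{[-1]}\otimes y_{[0]}$ such that $(ab)\triangleleft f=(a\triangleleft f_{(1)})(b\triangleleft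 f_{(2)})$, $1\triangleleft f=\epsilon(f)1$, $\lambda(ab)=b_{[-1]}a_{[-1]}\otimes a_{[0]}b_{[0]}$, $\lambda(1)=1\otimes 1$ and $y_{[-1]}f_{(1)}\otimes(y_{[0]}\triangleleft f_{(2)})=f_{(2)}(y\triangleleft f_{(1)})_{[-1]}\otimes(y\triangleleft f_{(1)})_{[0]}$; it is braided commutative if $(a\triangleleft y_{[-1]})y_{[0]}=ya$. The smash products $L\sharp H=L\otimes H$ and $H\sharp R=H\otimes R$ are the algebras with products $(x\sharp f)(x'\sharp f')=x(f_{(1)}\triangleright x')\sharp f_{(2)}f'$ and $(f\sharp y)(f'\sharp y')=ff'_{(1)}\sharp(y\triangleleft f'_{(2)})y'$. A symmetric Hopf algebroid (in the sense of Böhm and Szlachányi) consists of an algebra $K$, a left bialgebroid $(K,\alpha_L,\beta_L,\Delta_L,\epsilon_L)$ over $L$ (bimodule structure $a.k.b=\alpha_L(a)\beta_L(b)k$), a right bialgebroid $(K,\alpha_R,\beta_R,\Delta_R,\epsilon_R)$ over $R$ (bimodule structure $b.k.a=k\alpha_R(a)\beta_R(b)$) and an antihomomorphism of algebras $\tau\colon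 K\to K$ with $\alpha_L\epsilon_L\beta_R=\beta_R$, $\beta_L\epsilon_L\alpha_R=\alpha_R$, $\alpha_R\epsilon_R\beta_L=\beta_L$, $\beta_R\epsilon_R\alpha_L=\alpha_L$, $(\Delta_R\otimes_L\mathrm{id})\Delta_L=(\mathrm{id}\otimes_R\Delta_L)\Delta_R$, $(\Delta_L\otimes_R\mathrm{id})\Delta_R=(\mathrm{id}\otimes_L\Delta_R)\Delta_L$, $\tau\beta_L=\alpha_L$, $\tau\beta_R=\alpha_R$, $\mu(\tau\otimes\mathrm{id})\Delta_L=\alpha_R\epsilon_R$ and $\mu(\mathrm{id}\otimes\tau)\Delta_R=\alpha_L\epsilon_L$. **(1)** Let $(L,\triangleright,\rho)$ be a braided commutative left-right Yetter-Drinfeld $H$-module algebra. Then $L\sharp H$ is a symmetric Hopf algebroid with the structure maps $$\alpha_L(x)=x\sharp1,\quad \beta_L(x)=x_{[0]}\sharp x_{[1]},\quad \Delta_L(x\sharp f)=x\sharp f_{(1)}\otimes_L1\sharp f_{(2)},\quad \epsilon_L(x\sharp f)=\epsilon(f)x,$$ $$\alpha_R(y)=S^2(\phi^{-1}(y)_{[1]})\cdot\phi^{-1}(y)_{[0]},\quad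 \beta_R(y)=\phi^{-1}(y)\sharp1,\quad \Delta_R(x\sharp f)=x\sharp f_{(1)}\otimes_R1\sharp f_{(2)},\quad \epsilon_R(x\sharp f)=\phi(S^{-1}f\triangleright x),$$ $$\tau(x\sharp f)=Sf\,S^2(x_{[1]})\cdot x_{[0]}.$$ **(2)** Let $(R,\triangleleft,\lambda)$ be a braided commutative right-left Yetter-Drinfeld $H$-module algebra. Then $H\sharp R$ is a symmetric Hopf algebroid with the structure maps $$\alpha_L'(x)=\phi(x)_{[-1]}\sharp\phi(x)_{[0]},\quad \beta_L'(x)=1\sharp\bigl(\phi(x)_{[0]}\triangleleft S^{-1}(\phi(x)_{[-1]})\bigr),\quad \Delta_L'(f\sharp y)=f_{(1)}\sharp1\otimes_Lf_{(2)}\sharp y,\quad \epsilon_L'(f\sharp y)=\phi^{-1}\bigl(y_{[0]}\triangleleft S^2(y_{[-1]})Sf\bigr),$$ $$\alpha_R'(y)=1\sharp y,\quad \beta_R'(y)=y_{[-1]}\sharp y_{[0]},\quad \Delta_R'(f\sharp y)=f_{(1)}\sharp1\otimes_Rf_{(2)}\sharp y,\quad \epsilon_R'(f\sharp y)=\epsilon(f)y,$$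 $$\tau'(f\sharp y)=y_{[0]}\cdot S^2(y_{[-1]})Sf.$$ **(3)** If $(L,\triangleright,\rho)$ is as in (1), then the formulas $y\triangleleft f=\phi(S^{-1}f\triangleright\phi^{-1}(y))$ and $y_{[-1]}\otimes y_{[0]}=S(\phi^{-1}(y)_{[1]})\otimes\phi(\phi^{-1}(y)_{[0]})$ define a braided commutative right-left Yetter-Drinfeld $H$-module algebra $(R,\triangleleft,\lambda)$. If $(R,\triangleleft,\lambda)$ is as in (2), then the formulas $f\triangleright x=\phi^{-1}(\phi(x)\triangleleft Sf)$ and $x_{[0]}\otimes x_{[1]}=\phi^{-1}(\phi(x)_{[0]})\otimes S^{-1}(\phi(x)_{[-1]})$ define a braided commutative left-right Yetter-Drinfeld $H$-module algebra $(L,\triangleright,\rho)$. In both cases $L\sharp H$ from (1) and $H\sharp R$ from (2) are presentations of the same symmetric Hopf algebroid: the map $$\Psi\colon L\sharp H\to H\sharp R,\qquad \Psi(x\sharp f)=\bigl(\phi(x)_{[-1]}\sharp\phi(x)_{[0]}\bigr)\cdot f,$$ is an isomorphism of algebras that carries all structure maps of $L\sharp H$ (sources, targets, comultiplications and counits of both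 bialgebroids, and the antipode) to those of $H\sharp R$. -/

import Mathlib

open scoped TensorProduct

namespace ScalarExt

/-! ### Module algebras and Yetter-Drinfeld module algebras -/

section ModuleAlgebras

variable (k H L R : Type*) [Field k] [Ring H] [Bialgebra k H] [Ring L] [Algebra k L]
  [Ring R] [Algebra k R]

/-- A left module algebra over the bialgebra `H`: a left `H`-action `act f x = f ▷ x` on the
`k`-algebra `L` with `f ▷ (x y) = (f₁ ▷ x) (f₂ ▷ y)` and `f ▷ 1 = ε(f) 1`. -/
@[ext]
structure LeftModuleAlgebra where
  act : H →ₗ[k] L →ₗ[k] L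
  one_act : ∀ x, act 1 x = x
  mul_act : ∀ f g x, act (f * g) x = act f (act g x)
  act_mul : ∀ f x y, act f (x * y) =
    LinearMap.mul' k L (TensorProduct.map (act.flip x) (act.flip y) (Coalgebra.comul (R := k) f))
  act_one : ∀ f, act f 1 = Coalgebra.counit (R := k) f • (1 : L)

/-- A right module algebra over the bialgebra `H`: a right `H`-action `act y f = y ◁ f` on the
`k`-algebra `R` with `(x y) ◁ f = (x ◁ f₁) (y ◁ f₂)` and `1 ◁ f = ε(f) 1`. -/
@[ext]
structure RightModuleAlgebra where
  act : R →ₗ[k] H →ₗ[k] R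
  act_one_right : ∀ y, act y 1 = y
  act_mul_right : ∀ y f g, act y (f * g) = act (act y f) g
  mul_act : ∀ x y f, act (x * y) f =
    LinearMap.mul' k R (TensorProduct.map (act x) (act y) (Coalgebra.comul (R := k) f))
  one_act : ∀ f, act 1 f = Coalgebra.counit (R := k) f • (1 : R)

/-- A left-right Yetter-Drinfeld module algebra `(L, ▷, ρ)` over `H`; here `coact = ρ`,
`ρ(x) = x₀ ⊗ x₁`. -/
@[ext]
structure LeftRightYD extends LeftModuleAlgebra k H L where
  coact : L →ₗ[k] L ⊗[k] H
  /-- `(ρ ⊗ id) ρ = (id ⊗ Δ) ρ` -/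
  coact_coassoc : ∀ x, TensorProduct.assoc k L H H (coact.rTensor H (coact x)) =
    (Coalgebra.comul (R := k) (A := H)).lTensor L (coact x)
  /-- `x₀ ε(x₁) = x` -/
  coact_counit : ∀ x,
    TensorProduct.rid k L ((Coalgebra.counit (R := k) (A := H)).lTensor L (coact x)) = x
  /-- `(f₁ ▷ x₀) ⊗ (f₂ x₁) = (f₂ ▷ x)₀ ⊗ (f₂ ▷ x)₁ f₁` -/
  yetterDrinfeld : ∀ f x,
    TensorProduct.map₂ act (LinearMap.mul k H) (Coalgebra.comul (R := k) f) (coact x) =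
      TensorProduct.lift
        ((LinearMap.lTensorHom L ∘ₗ (LinearMap.mul k H).flip).compl₂ (coact ∘ₗ act.flip x))
        (Coalgebra.comul (R := k) f)
  /-- `(x y)₀ ⊗ (x y)₁ = x₀ y₀ ⊗ y₁ x₁` -/
  coact_mul : ∀ x y, coact (x * y) =
    TensorProduct.map₂ (LinearMap.mul k L) (LinearMap.mul k H).flip (coact x) (coact y)
  coact_one : coact 1 = 1 ⊗ₜ 1

/-- A right-left Yetter-Drinfeld module algebra `(R, ◁, λ)` over `H`; here `coact = λ`,
`λ(y) = y₋₁ ⊗ y₀`. -/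
@[ext]
structure RightLeftYD extends RightModuleAlgebra k H R where
  coact : R →ₗ[k] H ⊗[k] R
  /-- `(Δ ⊗ id) λ = (id ⊗ λ) λ` -/
  coact_coassoc : ∀ y,
    TensorProduct.assoc k H H R ((Coalgebra.comul (R := k) (A := H)).rTensor R (coact y)) =
      coact.lTensor H (coact y)
  /-- `ε(y₋₁) y₀ = y` -/
  coact_counit : ∀ y,
    TensorProduct.lid k R ((Coalgebra.counit (R := k) (A := H)).rTensor R (coact y)) = y
  /-- `y₋₁ f₁ ⊗ (y₀ ◁ f₂) = f₂ (y ◁ f₁)₋₁ ⊗ (y ◁ f₁)₀` -/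
  yetterDrinfeld : ∀ y f,
    TensorProduct.map₂ (LinearMap.mul k H) act (coact y) (Coalgebra.comul (R := k) f) =
      TensorProduct.lift
        ((LinearMap.rTensorHom R ∘ₗ LinearMap.mul k H).compl₂ (coact ∘ₗ act y)).flip
        (Coalgebra.comul (R := k) f)
  /-- `(x y)₋₁ ⊗ (x y)₀ = y₋₁ x₋₁ ⊗ x₀ y₀` -/
  coact_mul : ∀ x y, coact (x * y) =
    TensorProduct.map₂ (LinearMap.mul k H).flip (LinearMap.mul k R) (coact x) (coact y)
  coact_one : coact 1 = 1 ⊗ₜ 1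

variable {k H L R}

/-- Braided commutativity `x₀ (x₁ ▷ a) = a x`. -/
def LeftRightYD.BraidedCommutative (Y : LeftRightYD k H L) : Prop :=
  ∀ a x, LinearMap.mul' k L ((Y.act.flip a).lTensor L (Y.coact x)) = a * x

/-- Braided commutativity `(a ◁ y₋₁) y₀ = y a`. -/
def RightLeftYD.BraidedCommutative (Y : RightLeftYD k H R) : Prop :=
  ∀ a y, LinearMap.mul' k R ((Y.act a).rTensor R (Y.coact y)) = y * a

end ModuleAlgebras

/-! ### Smash product algebras -/

section SmashLeft

variable {k H L : Type*} [Field k] [Ring H] [Bialgebra k H] [Ring L] [Algebra k L]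

namespace LeftModuleAlgebra

variable (A : LeftModuleAlgebra k H L)

/-- `h ↦ (a' ⊗ h' ↦ (h₁ ▷ a') ⊗ h₂ h')` -/
noncomputable def hMul : H →ₗ[k] Module.End k (L ⊗[k] H) :=
  TensorProduct.map₂ A.act (LinearMap.mul k H) ∘ₗ Coalgebra.comul (R := k)

/-- `(a ⊗ h) ↦ (a' ⊗ h' ↦ a (h₁ ▷ a') ⊗ h₂ h')` -/
noncomputable def smashMul : L ⊗[k] H →ₗ[k] Module.End k (L ⊗[k] H) :=
  TensorProduct.lift ((LinearMap.mul k (Module.End k (L ⊗[k] H))).compl₁₂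
    (LinearMap.rTensorHom H ∘ₗ LinearMap.mul k L) A.hMul)

/-- The smash product algebra `L ♯ H`: the vector space `L ⊗ H` with the product
`(a ⊗ h) (a' ⊗ h') = a (h₁ ▷ a') ⊗ h₂ h'` and unit `1 ⊗ 1`. -/
def Smash (_A : LeftModuleAlgebra k H L) : Type _ := L ⊗[k] H

noncomputable instance : AddCommGroup A.Smash := inferInstanceAs (AddCommGroup (L ⊗[k] H))
noncomputable instance : Module k A.Smash := inferInstanceAs (Module k (L ⊗[k] H))

/-- The identification of `L ⊗ H` with the underlying vector space of `L ♯ H`. -/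
noncomputable def of : L ⊗[k] H ≃ₗ[k] A.Smash := LinearEquiv.refl k _

lemma smashMul_tmul (a : L) (h : H) (x : L ⊗[k] H) :
    A.smashMul (a ⊗ₜ h) x = (LinearMap.mulLeft k a).rTensor H (A.hMul h x) := rfl

lemma smashMul_rTensor (a : L) (x : L ⊗[k] H) :
    A.smashMul ((LinearMap.mulLeft k a).rTensor H x) =
      (LinearMap.mulLeft k a).rTensor H ∘ₗ A.smashMul x := by
  induction x with
  | zero => simp
  | add x y hx hy => simp only [map_add, hx, hy, LinearMap.comp_add]
  | tmul b h =>
    refine LinearMap.ext fun z => ?_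
    rw [LinearMap.rTensor_tmul, smashMul_tmul, LinearMap.comp_apply, smashMul_tmul,
      LinearMap.mulLeft_apply, LinearMap.mulLeft_mul, LinearMap.rTensor_comp, LinearMap.comp_apply]

lemma map₂_mul (s t : H ⊗[k] H) (x : L ⊗[k] H) :
    TensorProduct.map₂ A.act (LinearMap.mul k H) (s * t) x =
      TensorProduct.map₂ A.act (LinearMap.mul k H) s
        (TensorProduct.map₂ A.act (LinearMap.mul k H) t x) := by
  induction s with
  | zero => simp
  | add s s' h h' => simp only [add_mul, map_add, LinearMap.add_apply, h, h']
  | tmul f g =>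
    induction t with
    | zero => simp
    | add t t' h h' => simp only [mul_add, map_add, LinearMap.add_apply, h, h']
    | tmul f' g' =>
      induction x with
      | zero => simp
      | add x x' h h' => simp only [map_add, h, h']
      | tmul a p => simp [A.mul_act, mul_assoc]

lemma hMul_mul (f g : H) (x : L ⊗[k] H) : A.hMul (f * g) x = A.hMul f (A.hMul g x) := by
  simp only [hMul, LinearMap.comp_apply, Bialgebra.comul_mul]
  exact A.map₂_mul _ _ _

/-- `p ⊗ (q ⊗ r) ↦ (p ▷ b) (q ▷ c) ⊗ r g` -/
noncomputable def assocAux (b c : L) (g : H) : H ⊗[k] (H ⊗[k] H) →ₗ[k] L ⊗[k] H :=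
  TensorProduct.map (LinearMap.mul' k L) LinearMap.id ∘ₗ
    (TensorProduct.assoc k L L H).symm.toLinearMap ∘ₗ
      TensorProduct.map (A.act.flip b)
        (TensorProduct.map (A.act.flip c) (LinearMap.mulRight k g))

lemma hMul_rTensor (f : H) (b : L) (x : L ⊗[k] H) :
    A.hMul f ((LinearMap.mulLeft k b).rTensor H x) =
      A.smashMul ((A.act.flip b).rTensor H (Coalgebra.comul (R := k) f)) x := by
  induction x with
  | zero => simp
  | add x y hx hy => simp only [map_add, hx, hy]
  | tmul c g =>
    have h1 : ∀ s : H ⊗[k] H, TensorProduct.map₂ A.act (LinearMap.mul k H) s ((b * c) ⊗ₜ g) =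
        A.assocAux b c g (TensorProduct.assoc k H H H
          ((Coalgebra.comul (R := k) (A := H)).rTensor H s)) := by
      intro s
      induction s with
      | zero => simp
      | add s t hs ht => simp only [map_add, LinearMap.add_apply, hs, ht]
      | tmul p q =>
        rw [TensorProduct.map₂_apply_tmul, TensorProduct.map_tmul, A.act_mul, LinearMap.rTensor_tmul]
        generalize Coalgebra.comul (R := k) p = t
        induction t with
        | zero => simp
        | add t t' ht ht' => simp only [map_add, TensorProduct.add_tmul, ht, ht']
        | tmul u v => simp [assocAux]
    have h2 : ∀ s : H ⊗[k] H, A.smashMul ((A.act.flip b).rTensor H s) (c ⊗ₜ g) =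
        A.assocAux b c g ((Coalgebra.comul (R := k) (A := H)).lTensor H s) := by
      intro s
      induction s with
      | zero => simp
      | add s t hs ht => simp only [map_add, LinearMap.add_apply, hs, ht]
      | tmul p q =>
        rw [LinearMap.rTensor_tmul, smashMul_tmul, hMul, LinearMap.comp_apply,
          LinearMap.lTensor_tmul]
        generalize Coalgebra.comul (R := k) q = t
        induction t with
        | zero => simp
        | add t t' ht ht' => simp only [map_add, TensorProduct.tmul_add, LinearMap.add_apply, ht, ht']
        | tmul u v => simp [assocAux]
    rw [LinearMap.rTensor_tmul, LinearMap.mulLeft_apply, h2, hMul, LinearMap.comp_apply, h1,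
      Coalgebra.coassoc_apply]

lemma smashMul_hMul (f : H) (x : L ⊗[k] H) :
    A.smashMul (A.hMul f x) = A.hMul f ∘ₗ A.smashMul x := by
  induction x with
  | zero => simp
  | add x y hx hy => simp only [map_add, hx, hy, LinearMap.comp_add]
  | tmul b g =>
    refine LinearMap.ext fun z => ?_
    rw [LinearMap.comp_apply, smashMul_tmul, hMul_rTensor,
      show A.hMul f = TensorProduct.map₂ A.act (LinearMap.mul k H)
        (Coalgebra.comul (R := k) f) from rfl]
    generalize Coalgebra.comul (R := k) f = t
    induction t with
    | zero => simp
    | add t t' ht ht' => simp only [map_add, LinearMap.add_apply, ht, ht']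
    | tmul u v =>
      rw [TensorProduct.map₂_apply_tmul, TensorProduct.map_tmul, LinearMap.mul_apply', LinearMap.rTensor_tmul,
        smashMul_tmul, smashMul_tmul, hMul_mul, LinearMap.flip_apply]

lemma smashMul_assoc (x y z : L ⊗[k] H) :
    A.smashMul (A.smashMul x y) z = A.smashMul x (A.smashMul y z) := by
  induction x with
  | zero => simp
  | add x x' hx hx' => simp only [map_add, LinearMap.add_apply, hx, hx']
  | tmul a f =>
    rw [smashMul_tmul, smashMul_rTensor, smashMul_hMul, smashMul_tmul]
    rfl

lemma one_smashMul (x : L ⊗[k] H) : A.smashMul (1 ⊗ₜ 1) x = x := by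
  induction x with
  | zero => simp
  | add x y hx hy => simp only [map_add, hx, hy]
  | tmul a f =>
    simp [smashMul_tmul, hMul, Algebra.TensorProduct.one_def, A.one_act]

lemma smashMul_one (x : L ⊗[k] H) : A.smashMul x (1 ⊗ₜ 1) = x := by
  induction x with
  | zero => simp
  | add x y hx hy => simp only [map_add, LinearMap.add_apply, hx, hy]
  | tmul a f =>
    have h : ∀ s : H ⊗[k] H,
        TensorProduct.map₂ A.act (LinearMap.mul k H) s ((1 : L) ⊗ₜ[k] (1 : H)) =
          TensorProduct.map (LinearMap.toSpanSingleton k L 1) LinearMap.id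
            ((Coalgebra.counit (R := k) (A := H)).rTensor H s) := by
      intro s
      induction s with
      | zero => simp
      | add s t hs ht => simp only [map_add, LinearMap.add_apply, hs, ht]
      | tmul p q => simp [A.act_one]
    rw [smashMul_tmul, hMul, LinearMap.comp_apply, h, Coalgebra.rTensor_counit_comul]
    simp

noncomputable instance : Mul A.Smash := ⟨fun x y => A.of (A.smashMul (A.of.symm x) (A.of.symm y))⟩

noncomputable instance : One A.Smash := ⟨A.of (1 ⊗ₜ 1)⟩

lemma mul_def (x y : A.Smash) : x * y = A.of (A.smashMul (A.of.symm x) (A.of.symm y)) := rfl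

lemma one_def : (1 : A.Smash) = A.of (1 ⊗ₜ 1) := rfl

noncomputable instance : Ring A.Smash :=
  { (inferInstance : AddCommGroup A.Smash), (inferInstance : Mul A.Smash),
    (inferInstance : One A.Smash) with
    mul_assoc := fun x y z => by
      simp only [mul_def, LinearEquiv.symm_apply_apply, smashMul_assoc]
    one_mul := fun x => by
      simp only [mul_def, one_def, LinearEquiv.symm_apply_apply, one_smashMul,
        LinearEquiv.apply_symm_apply]
    mul_one := fun x => by
      simp only [mul_def, one_def, LinearEquiv.symm_apply_apply, smashMul_one,
        LinearEquiv.apply_symm_apply]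
    left_distrib := fun x y z => by simp only [mul_def, map_add]
    right_distrib := fun x y z => by simp only [mul_def, map_add, LinearMap.add_apply]
    zero_mul := fun x => by simp only [mul_def, map_zero, LinearMap.zero_apply]
    mul_zero := fun x => by simp only [mul_def, map_zero] }

noncomputable instance : Algebra k A.Smash :=
  Algebra.ofModule
    (fun r x y => by simp only [mul_def, map_smul, LinearMap.smul_apply])
    (fun r x y => by simp only [mul_def, map_smul])

/-- `x ↦ x ♯ 1` -/
noncomputable def inBase : L →ₗ[k] A.Smash :=
  A.of.toLinearMap ∘ₗ (TensorProduct.mk k L H).flip 1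

/-- `f ↦ 1 ♯ f` -/
noncomputable def inHopf : H →ₗ[k] A.Smash :=
  A.of.toLinearMap ∘ₗ TensorProduct.mk k L H 1

end LeftModuleAlgebra

end SmashLeft

section SmashRight

variable {k H R : Type*} [Field k] [Ring H] [Bialgebra k H] [Ring R] [Algebra k R]

namespace RightModuleAlgebra

variable (A : RightModuleAlgebra k H R)

/-- `h' ↦ (h ⊗ a ↦ h h'₁ ⊗ (a ◁ h'₂))` -/
noncomputable def hMul : H →ₗ[k] Module.End k (H ⊗[k] R) :=
  TensorProduct.map₂ (LinearMap.mul k H).flip A.act.flip ∘ₗ Coalgebra.comul (R := k)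

/-- `(h' ⊗ a') ↦ (h ⊗ a ↦ h h'₁ ⊗ (a ◁ h'₂) a')` -/
noncomputable def smashMulFlip : H ⊗[k] R →ₗ[k] Module.End k (H ⊗[k] R) :=
  TensorProduct.lift ((LinearMap.mul k (Module.End k (H ⊗[k] R))).flip.compl₁₂
    A.hMul (LinearMap.lTensorHom H ∘ₗ (LinearMap.mul k R).flip))

/-- The smash product algebra `H ♯ R`: the vector space `H ⊗ R` with the product
`(h ⊗ a) (h' ⊗ a') = h h'₁ ⊗ (a ◁ h'₂) a'` and unit `1 ⊗ 1`. -/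
def Smash (_A : RightModuleAlgebra k H R) : Type _ := H ⊗[k] R

noncomputable instance : AddCommGroup A.Smash := inferInstanceAs (AddCommGroup (H ⊗[k] R))
noncomputable instance : Module k A.Smash := inferInstanceAs (Module k (H ⊗[k] R))

/-- The identification of `H ⊗ R` with the underlying vector space of `H ♯ R`. -/
noncomputable def of : H ⊗[k] R ≃ₗ[k] A.Smash := LinearEquiv.refl k _

lemma smashMulFlip_tmul (h : H) (a : R) (x : H ⊗[k] R) :
    A.smashMulFlip (h ⊗ₜ a) x = (LinearMap.mulRight k a).lTensor H (A.hMul h x) := rfl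

lemma smashMulFlip_lTensor (a : R) (x z : H ⊗[k] R) :
    A.smashMulFlip ((LinearMap.mulRight k a).lTensor H x) z =
      (LinearMap.mulRight k a).lTensor H (A.smashMulFlip x z) := by
  induction x with
  | zero => simp
  | add x y hx hy => simp only [map_add, hx, hy, LinearMap.add_apply]
  | tmul h b =>
    rw [LinearMap.lTensor_tmul, smashMulFlip_tmul, smashMulFlip_tmul,
      LinearMap.mulRight_apply, LinearMap.mulRight_mul, LinearMap.lTensor_comp,
      LinearMap.comp_apply]

lemma map₂_mul (s t : H ⊗[k] H) (x : H ⊗[k] R) :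
    TensorProduct.map₂ (LinearMap.mul k H).flip A.act.flip (s * t) x =
      TensorProduct.map₂ (LinearMap.mul k H).flip A.act.flip t
        (TensorProduct.map₂ (LinearMap.mul k H).flip A.act.flip s x) := by
  induction s with
  | zero => simp
  | add s s' h h' => simp only [add_mul, map_add, LinearMap.add_apply, h, h']
  | tmul f g =>
    induction t with
    | zero => simp
    | add t t' h h' => simp only [mul_add, map_add, LinearMap.add_apply, h, h']
    | tmul f' g' =>
      induction x with
      | zero => simp
      | add x x' h h' => simp only [map_add, h, h']
      | tmul p a => simp [A.act_mul_right, mul_assoc]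

lemma hMul_mul (f g : H) (x : H ⊗[k] R) : A.hMul (f * g) x = A.hMul g (A.hMul f x) := by
  simp only [hMul, LinearMap.comp_apply, Bialgebra.comul_mul]
  exact A.map₂_mul _ _ _

/-- `p ⊗ (q ⊗ r) ↦ g p ⊗ (b ◁ q) (c ◁ r)` -/
noncomputable def assocAux (g : H) (b c : R) : H ⊗[k] (H ⊗[k] H) →ₗ[k] H ⊗[k] R :=
  TensorProduct.map (LinearMap.mulLeft k g)
    (LinearMap.mul' k R ∘ₗ TensorProduct.map (A.act b) (A.act c))

lemma hMul_lTensor (f : H) (c : R) (x : H ⊗[k] R) :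
    A.hMul f ((LinearMap.mulRight k c).lTensor H x) =
      A.smashMulFlip ((A.act c).lTensor H (Coalgebra.comul (R := k) f)) x := by
  induction x with
  | zero => simp
  | add x y hx hy => simp only [map_add, hx, hy]
  | tmul g b =>
    have h1 : ∀ s : H ⊗[k] H,
        TensorProduct.map₂ (LinearMap.mul k H).flip A.act.flip s (g ⊗ₜ (b * c)) =
          A.assocAux g b c ((Coalgebra.comul (R := k) (A := H)).lTensor H s) := by
      intro s
      induction s with
      | zero => simp
      | add s t hs ht => simp only [map_add, LinearMap.add_apply, hs, ht]
      | tmul p q =>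
        rw [TensorProduct.map₂_apply_tmul, TensorProduct.map_tmul, LinearMap.flip_apply,
          LinearMap.flip_apply, A.mul_act, LinearMap.lTensor_tmul]
        rfl
    have h2 : ∀ s : H ⊗[k] H, A.smashMulFlip ((A.act c).lTensor H s) (g ⊗ₜ b) =
        A.assocAux g b c (TensorProduct.assoc k H H H
          ((Coalgebra.comul (R := k) (A := H)).rTensor H s)) := by
      intro s
      induction s with
      | zero => simp
      | add s t hs ht => simp only [map_add, LinearMap.add_apply, hs, ht]
      | tmul p q =>
        rw [LinearMap.lTensor_tmul, smashMulFlip_tmul, hMul, LinearMap.comp_apply,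
          LinearMap.rTensor_tmul]
        generalize Coalgebra.comul (R := k) p = t
        induction t with
        | zero => simp
        | add t t' ht ht' => simp only [map_add, TensorProduct.add_tmul, LinearMap.add_apply, ht, ht']
        | tmul u v => simp [assocAux]
    rw [LinearMap.lTensor_tmul, LinearMap.mulRight_apply, h2, hMul, LinearMap.comp_apply, h1,
      Coalgebra.coassoc_apply]

lemma smashMulFlip_hMul (f : H) (x z : H ⊗[k] R) :
    A.smashMulFlip (A.hMul f x) z = A.hMul f (A.smashMulFlip x z) := by
  induction x with
  | zero => simp
  | add x y hx hy => simp only [map_add, hx, hy, LinearMap.add_apply]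
  | tmul g b =>
    rw [smashMulFlip_tmul, hMul_lTensor,
      show A.hMul f = TensorProduct.map₂ (LinearMap.mul k H).flip A.act.flip
        (Coalgebra.comul (R := k) f) from rfl]
    generalize Coalgebra.comul (R := k) f = t
    induction t with
    | zero => simp
    | add t t' ht ht' => simp only [map_add, LinearMap.add_apply, ht, ht']
    | tmul u v =>
      rw [TensorProduct.map₂_apply_tmul, TensorProduct.map_tmul, LinearMap.flip_apply,
        LinearMap.mul_apply', LinearMap.lTensor_tmul, smashMulFlip_tmul, smashMulFlip_tmul,
        hMul_mul, LinearMap.flip_apply]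

lemma smashMulFlip_assoc (x y z : H ⊗[k] R) :
    A.smashMulFlip z (A.smashMulFlip y x) = A.smashMulFlip (A.smashMulFlip z y) x := by
  induction z with
  | zero => simp
  | add x x' hx hx' => simp only [map_add, LinearMap.add_apply, hx, hx']
  | tmul f c =>
    rw [smashMulFlip_tmul, smashMulFlip_tmul, smashMulFlip_lTensor, smashMulFlip_hMul]

lemma smashMulFlip_one (x : H ⊗[k] R) : A.smashMulFlip (1 ⊗ₜ 1) x = x := by
  induction x with
  | zero => simp
  | add x y hx hy => simp only [map_add, hx, hy]
  | tmul f a =>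
    simp [smashMulFlip_tmul, hMul, Algebra.TensorProduct.one_def, A.act_one_right]

lemma one_smashMulFlip (x : H ⊗[k] R) : A.smashMulFlip x (1 ⊗ₜ 1) = x := by
  induction x with
  | zero => simp
  | add x y hx hy => simp only [map_add, LinearMap.add_apply, hx, hy]
  | tmul f a =>
    have h : ∀ s : H ⊗[k] H,
        TensorProduct.map₂ (LinearMap.mul k H).flip A.act.flip s ((1 : H) ⊗ₜ[k] (1 : R)) =
          TensorProduct.map LinearMap.id (LinearMap.toSpanSingleton k R 1)
            ((Coalgebra.counit (R := k) (A := H)).lTensor H s) := by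
      intro s
      induction s with
      | zero => simp
      | add s t hs ht => simp only [map_add, LinearMap.add_apply, hs, ht]
      | tmul p q => simp [A.one_act]
    rw [smashMulFlip_tmul, hMul, LinearMap.comp_apply, h, Coalgebra.lTensor_counit_comul]
    simp

noncomputable instance : Mul A.Smash :=
  ⟨fun x y => A.of (A.smashMulFlip (A.of.symm y) (A.of.symm x))⟩

noncomputable instance : One A.Smash := ⟨A.of (1 ⊗ₜ 1)⟩

lemma mul_def (x y : A.Smash) : x * y = A.of (A.smashMulFlip (A.of.symm y) (A.of.symm x)) := rfl

lemma one_def : (1 : A.Smash) = A.of (1 ⊗ₜ 1) := rfl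

noncomputable instance : Ring A.Smash :=
  { (inferInstance : AddCommGroup A.Smash), (inferInstance : Mul A.Smash),
    (inferInstance : One A.Smash) with
    mul_assoc := fun x y z => by
      simp only [mul_def, LinearEquiv.symm_apply_apply, smashMulFlip_assoc]
    one_mul := fun x => by
      simp only [mul_def, one_def, LinearEquiv.symm_apply_apply, one_smashMulFlip,
        LinearEquiv.apply_symm_apply]
    mul_one := fun x => by
      simp only [mul_def, one_def, LinearEquiv.symm_apply_apply, smashMulFlip_one,
        LinearEquiv.apply_symm_apply]
    left_distrib := fun x y z => by simp only [mul_def, map_add, LinearMap.add_apply]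
    right_distrib := fun x y z => by simp only [mul_def, map_add]
    zero_mul := fun x => by simp only [mul_def, map_zero]
    mul_zero := fun x => by simp only [mul_def, map_zero, LinearMap.zero_apply] }

noncomputable instance : Algebra k A.Smash :=
  Algebra.ofModule
    (fun r x y => by simp only [mul_def, map_smul])
    (fun r x y => by simp only [mul_def, map_smul, LinearMap.smul_apply])

/-- `f ↦ f ♯ 1` -/
noncomputable def inHopf : H →ₗ[k] A.Smash :=
  A.of.toLinearMap ∘ₗ (TensorProduct.mk k H R).flip 1

/-- `y ↦ 1 ♯ y` -/
noncomputable def inBase : R →ₗ[k] A.Smash :=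
  A.of.toLinearMap ∘ₗ TensorProduct.mk k H R 1

end RightModuleAlgebra

end SmashRight

/-! ### Balanced tensor products -/

section Balanced

variable {k K A B : Type*} [Field k] [Ring K] [Algebra k K] [AddCommGroup A] [Module k A]
  [AddCommGroup B] [Module k B]

/-- The relations `r a g ⊗ h = g ⊗ l a h`, where `r a` is the right action of `a` on the first
factor and `l a` is the left action of `a` on the second factor. -/
def balRel (r l : A →ₗ[k] Module.End k K) : Submodule k (K ⊗[k] K) :=
  Submodule.span k {t | ∃ a g h, t = r a g ⊗ₜ[k] h - g ⊗ₜ[k] l a h}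

/-- The tensor product `K ⊗_A K`, for the right action `r` and the left action `l` of `A`. -/
abbrev BalTensor (r l : A →ₗ[k] Module.End k K) : Type _ := (K ⊗[k] K) ⧸ balRel r l

/-- The relations of `K ⊗_A K ⊗_B K`, with `⊗_A` formed from `r, l` and `⊗_B` formed from
`r', l'`. -/
def balRel₃ (r l : A →ₗ[k] Module.End k K) (r' l' : B →ₗ[k] Module.End k K) :
    Submodule k (K ⊗[k] (K ⊗[k] K)) :=
  Submodule.span k
    ({t | ∃ a x y z, t = r a x ⊗ₜ[k] (y ⊗ₜ[k] z) - x ⊗ₜ[k] (l a y ⊗ₜ[k] z)} ∪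
      {t | ∃ b x y z, t = x ⊗ₜ[k] (r' b y ⊗ₜ[k] z) - x ⊗ₜ[k] (y ⊗ₜ[k] l' b z)})

/-- The threefold tensor product `K ⊗_A K ⊗_B K`. -/
abbrev BalTensor₃ (r l : A →ₗ[k] Module.End k K) (r' l' : B →ₗ[k] Module.End k K) : Type _ :=
  (K ⊗[k] (K ⊗[k] K)) ⧸ balRel₃ r l r' l'

variable (r l : A →ₗ[k] Module.End k K) (r' l' : B →ₗ[k] Module.End k K)

/-- The map `(K ⊗_A K) × K → K ⊗_A K ⊗_B K`, `([x ⊗ y], z) ↦ [x ⊗ y ⊗ z]`. -/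
noncomputable def appendRight : BalTensor r l →ₗ[k] K →ₗ[k] BalTensor₃ r l r' l' :=
  (balRel r l).liftQ
    (TensorProduct.curry ((balRel₃ r l r' l').mkQ ∘ₗ (TensorProduct.assoc k K K K).toLinearMap)) <|
    Submodule.span_le.2 <| by
      rintro _ ⟨a, g, h, rfl⟩
      refine LinearMap.mem_ker.2 (LinearMap.ext fun z => ?_)
      rw [TensorProduct.curry_apply, TensorProduct.sub_tmul, LinearMap.comp_apply, map_sub,
        LinearMap.zero_apply, Submodule.mkQ_apply, Submodule.Quotient.mk_eq_zero]
      exact Submodule.subset_span (Or.inl ⟨a, g, h, z, rfl⟩)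

/-- The map `(K ⊗_B K) × K → K ⊗_A K ⊗_B K`, `([y ⊗ z], x) ↦ [x ⊗ y ⊗ z]`. -/
noncomputable def appendLeft : BalTensor r' l' →ₗ[k] K →ₗ[k] BalTensor₃ r l r' l' :=
  (balRel r' l').liftQ (TensorProduct.curry (balRel₃ r l r' l').mkQ).flip <|
    Submodule.span_le.2 <| by
      rintro _ ⟨b, y, z, rfl⟩
      refine LinearMap.mem_ker.2 (LinearMap.ext fun x => ?_)
      rw [LinearMap.flip_apply, TensorProduct.curry_apply, TensorProduct.tmul_sub,
        LinearMap.zero_apply, Submodule.mkQ_apply, Submodule.Quotient.mk_eq_zero]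
      exact Submodule.subset_span (Or.inr ⟨b, x, y, z, rfl⟩)

variable {r l r' l'}

/-- For `D : K → K ⊗_A K`, the map `K ⊗ K → K ⊗_A K ⊗_B K`, `x ⊗ z ↦ D(x) ⊗ z`. -/
noncomputable def tensorId (D : K →ₗ[k] BalTensor r l) (r' l' : B →ₗ[k] Module.End k K) :
    K ⊗[k] K →ₗ[k] BalTensor₃ r l r' l' :=
  TensorProduct.lift (appendRight r l r' l' ∘ₗ D)

/-- For `D : K → K ⊗_B K`, the map `K ⊗ K → K ⊗_A K ⊗_B K`, `x ⊗ z ↦ x ⊗ D(z)`. -/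
noncomputable def idTensor (r l : A →ₗ[k] Module.End k K) (D : K →ₗ[k] BalTensor r' l') :
    K ⊗[k] K →ₗ[k] BalTensor₃ r l r' l' :=
  TensorProduct.lift (appendLeft r l r' l' ∘ₗ D).flip

end Balanced

/-! ### Bialgebroids -/

section Bialgebroids

variable {k A K : Type*} [Field k] [Ring A] [Algebra k A] [Ring K] [Algebra k K]

/-- The map `a ↦ (x ↦ γ(a) x)`. -/
noncomputable def leftMulBy (γ : A →ₗ[k] K) : A →ₗ[k] Module.End k K := LinearMap.mul k K ∘ₗ γ

/-- The map `a ↦ (x ↦ x γ(a))`. -/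
noncomputable def rightMulBy (γ : A →ₗ[k] K) : A →ₗ[k] Module.End k K :=
  (LinearMap.mul k K).flip ∘ₗ γ

/-- The relations `β(a) g ⊗ h = g ⊗ α(a) h` of the tensor square of `K` over `A`, for the
bimodule structure `a.k.b = α(a) β(b) k`. -/
noncomputable abbrev leftRel (α β : A →ₗ[k] K) : Submodule k (K ⊗[k] K) :=
  balRel (leftMulBy β) (leftMulBy α)

/-- `K ⊗_A K` for the bimodule structure `a.k.b = α(a) β(b) k`. -/
noncomputable abbrev LeftTensor (α β : A →ₗ[k] K) : Type _ := BalTensor (leftMulBy β) (leftMulBy α)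

/-- The relations `g α(a) ⊗ h = g ⊗ h β(a)` of the tensor square of `K` over `A`, for the
bimodule structure `b.k.a = k α(a) β(b)`. -/
noncomputable abbrev rightRel (α β : A →ₗ[k] K) : Submodule k (K ⊗[k] K) :=
  balRel (rightMulBy α) (rightMulBy β)

/-- `K ⊗_A K` for the bimodule structure `b.k.a = k α(a) β(b)`. -/
noncomputable abbrev RightTensor (α β : A →ₗ[k] K) : Type _ := BalTensor (rightMulBy α) (rightMulBy β)

variable (k A K) in
/-- The structure maps (without axioms) of a left bialgebroid over `A` with total algebra `K`. -/
structure LeftBialgebroidData where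
  source : A →ₗ[k] K
  target : A →ₗ[k] K
  comul : K →ₗ[k] LeftTensor source target
  counit : K →ₗ[k] A

variable (k A K) in
/-- The structure maps (without axioms) of a right bialgebroid over `A` with total algebra `K`. -/
structure RightBialgebroidData where
  source : A →ₗ[k] K
  target : A →ₗ[k] K
  comul : K →ₗ[k] RightTensor source target
  counit : K →ₗ[k] A

/-- Right multiplication on `K ⊗_A K` (left bialgebroid convention):
`([x ⊗ y], g ⊗ h) ↦ [x g ⊗ y h]`. -/
noncomputable def leftTensorMul (α β : A →ₗ[k] K) :
    LeftTensor α β →ₗ[k] K ⊗[k] K →ₗ[k] LeftTensor α β :=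
  (leftRel α β).liftQ ((LinearMap.mul k (K ⊗[k] K)).compr₂ (leftRel α β).mkQ) <|
    Submodule.span_le.2 <| by
      rintro _ ⟨a, x, y, rfl⟩
      refine LinearMap.mem_ker.2 (TensorProduct.ext' fun g h => ?_)
      rw [LinearMap.zero_apply, LinearMap.compr₂_apply, LinearMap.mul_apply', sub_mul,
        Algebra.TensorProduct.tmul_mul_tmul, Algebra.TensorProduct.tmul_mul_tmul,
        Submodule.mkQ_apply, Submodule.Quotient.mk_eq_zero]
      refine Submodule.subset_span ⟨a, x * g, y * h, ?_⟩
      simp [leftMulBy, mul_assoc]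

/-- Left multiplication on `K ⊗_A K` (right bialgebroid convention):
`([x ⊗ y], g ⊗ h) ↦ [g x ⊗ h y]`. -/
noncomputable def rightTensorMul (α β : A →ₗ[k] K) :
    RightTensor α β →ₗ[k] K ⊗[k] K →ₗ[k] RightTensor α β :=
  (rightRel α β).liftQ ((LinearMap.mul k (K ⊗[k] K)).flip.compr₂ (rightRel α β).mkQ) <|
    Submodule.span_le.2 <| by
      rintro _ ⟨a, x, y, rfl⟩
      refine LinearMap.mem_ker.2 (TensorProduct.ext' fun g h => ?_)
      rw [LinearMap.zero_apply, LinearMap.compr₂_apply, LinearMap.flip_apply,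
        LinearMap.mul_apply', mul_sub,
        Algebra.TensorProduct.tmul_mul_tmul, Algebra.TensorProduct.tmul_mul_tmul,
        Submodule.mkQ_apply, Submodule.Quotient.mk_eq_zero]
      refine Submodule.subset_span ⟨a, g * x, h * y, ?_⟩
      simp [rightMulBy, mul_assoc]

namespace LeftBialgebroidData

variable (D : LeftBialgebroidData k A K)

/-- The relations of `K ⊗_A K`. -/
noncomputable abbrev rel : Submodule k (K ⊗[k] K) := leftRel D.source D.target

/-- `g ⊗ h ↦ Δ(x) (g ⊗ h)`, as a map `K ⊗ K → K ⊗_A K`. -/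
noncomputable def comulMul (x : K) : K ⊗[k] K →ₗ[k] LeftTensor D.source D.target :=
  leftTensorMul D.source D.target (D.comul x)

/-- `(Δ ⊗_A id)` before passing to the quotient: `x ⊗ y ↦ Δ(x) ⊗ y`. -/
noncomputable abbrev comulTensorId : K ⊗[k] K →ₗ[k]
    BalTensor₃ (leftMulBy D.target) (leftMulBy D.source) (leftMulBy D.target)
      (leftMulBy D.source) :=
  tensorId D.comul _ _

/-- `(id ⊗_A Δ)` before passing to the quotient: `x ⊗ y ↦ x ⊗ Δ(y)`. -/
noncomputable abbrev idTensorComul : K ⊗[k] K →ₗ[k]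
    BalTensor₃ (leftMulBy D.target) (leftMulBy D.source) (leftMulBy D.target)
      (leftMulBy D.source) :=
  idTensor _ _ D.comul

/-- `g ⊗ h ↦ ε(g).h = α(ε(g)) h` -/
noncomputable def counitTensorId : K ⊗[k] K →ₗ[k] K :=
  TensorProduct.lift (LinearMap.mul k K ∘ₗ D.source ∘ₗ D.counit)

/-- `g ⊗ h ↦ g.ε(h) = β(ε(h)) g` -/
noncomputable def idTensorCounit : K ⊗[k] K →ₗ[k] K :=
  TensorProduct.lift (LinearMap.mul k K ∘ₗ D.target ∘ₗ D.counit).flip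

/-- The axioms of a left bialgebroid `(K, μ, α, β, Δ, ε)` over `A`. Every field named `*_wd` says
that a map is well defined on `K ⊗_A K`; the field after it uses the resulting map. -/
structure IsLeftBialgebroid : Prop where
  /-- the source is a homomorphism -/
  source_one : D.source 1 = 1
  source_mul : ∀ a b, D.source (a * b) = D.source a * D.source b
  /-- the target is an antihomomorphism -/
  target_one : D.target 1 = 1
  target_mul : ∀ a b, D.target (a * b) = D.target b * D.target a
  /-- the images of the source and of the target commute -/
  source_target_comm : ∀ a b, D.source a * D.target b = D.target b * D.source a
  /-- the comultiplication is a bimodule map: `Δ(α(a) β(b) x) = α(a) x₁ ⊗ β(b) x₂` -/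
  comul_bimodule_wd : ∀ a b, D.rel ≤ D.rel.comap
    (TensorProduct.map (LinearMap.mulLeft k (D.source a)) (LinearMap.mulLeft k (D.target b)))
  comul_bimodule : ∀ a b x, D.comul (D.source a * D.target b * x) =
    Submodule.mapQ D.rel D.rel _ (comul_bimodule_wd a b) (D.comul x)
  /-- the counit is a bimodule map: `ε(α(a) β(b) x) = a ε(x) b` -/
  counit_bimodule : ∀ a b x, D.counit (D.source a * D.target b * x) = a * D.counit x * b
  /-- coassociativity: `(Δ ⊗_A id) Δ = (id ⊗_A Δ) Δ` -/
  comul_id_wd : D.rel ≤ LinearMap.ker D.comulTensorId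
  id_comul_wd : D.rel ≤ LinearMap.ker D.idTensorComul
  coassoc : ∀ x, D.rel.liftQ D.comulTensorId comul_id_wd (D.comul x) =
    D.rel.liftQ D.idTensorComul id_comul_wd (D.comul x)
  /-- counitality: `ε(x₁).x₂ = x = x₁.ε(x₂)` -/
  counit_id_wd : D.rel ≤ LinearMap.ker D.counitTensorId
  counit_id : ∀ x, D.rel.liftQ D.counitTensorId counit_id_wd (D.comul x) = x
  id_counit_wd : D.rel ≤ LinearMap.ker D.idTensorCounit
  id_counit : ∀ x, D.rel.liftQ D.idTensorCounit id_counit_wd (D.comul x) = x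
  /-- `x ⊗ (g ⊗ h) ↦ Δ(x) (g ⊗ h)` factors through `K ⊗ (K ⊗_A K)` and defines a left unital
  action of `K` on `K ⊗_A K` -/
  comulMul_wd : ∀ x, D.rel ≤ LinearMap.ker (D.comulMul x)
  comulMul_one : ∀ t, D.rel.liftQ (D.comulMul 1) (comulMul_wd 1) t = t
  comulMul_mul : ∀ x y t, D.rel.liftQ (D.comulMul (x * y)) (comulMul_wd (x * y)) t =
    D.rel.liftQ (D.comulMul x) (comulMul_wd x) (D.rel.liftQ (D.comulMul y) (comulMul_wd y) t)
  /-- `x ⊗ a ↦ ε(x α(a))` is a left unital action of `K` on `A` -/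
  counit_action_one : ∀ a, D.counit (1 * D.source a) = a
  counit_action_mul : ∀ x y a, D.counit (x * y * D.source a) =
    D.counit (x * D.source (D.counit (y * D.source a)))

end LeftBialgebroidData

namespace RightBialgebroidData

variable (D : RightBialgebroidData k A K)

/-- The relations of `K ⊗_A K`. -/
noncomputable abbrev rel : Submodule k (K ⊗[k] K) := rightRel D.source D.target

/-- `g ⊗ h ↦ (g ⊗ h) Δ(x)`, as a map `K ⊗ K → K ⊗_A K`. -/
noncomputable def mulComul (x : K) : K ⊗[k] K →ₗ[k] RightTensor D.source D.target :=
  rightTensorMul D.source D.target (D.comul x)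

/-- `(Δ ⊗_A id)` before passing to the quotient: `x ⊗ y ↦ Δ(x) ⊗ y`. -/
noncomputable abbrev comulTensorId : K ⊗[k] K →ₗ[k]
    BalTensor₃ (rightMulBy D.source) (rightMulBy D.target) (rightMulBy D.source)
      (rightMulBy D.target) :=
  tensorId D.comul _ _

/-- `(id ⊗_A Δ)` before passing to the quotient: `x ⊗ y ↦ x ⊗ Δ(y)`. -/
noncomputable abbrev idTensorComul : K ⊗[k] K →ₗ[k]
    BalTensor₃ (rightMulBy D.source) (rightMulBy D.target) (rightMulBy D.source)
      (rightMulBy D.target) :=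
  idTensor _ _ D.comul

/-- `g ⊗ h ↦ ε(g).h = h β(ε(g))` -/
noncomputable def counitTensorId : K ⊗[k] K →ₗ[k] K :=
  TensorProduct.lift ((LinearMap.mul k K).flip ∘ₗ D.target ∘ₗ D.counit)

/-- `g ⊗ h ↦ g.ε(h) = g α(ε(h))` -/
noncomputable def idTensorCounit : K ⊗[k] K →ₗ[k] K :=
  TensorProduct.lift ((LinearMap.mul k K).flip ∘ₗ D.source ∘ₗ D.counit).flip

/-- The axioms of a right bialgebroid `(K, μ, α, β, Δ, ε)` over `A`. Every field named `*_wd` says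
that a map is well defined on `K ⊗_A K`; the field after it uses the resulting map. -/
structure IsRightBialgebroid : Prop where
  /-- the source is a homomorphism -/
  source_one : D.source 1 = 1
  source_mul : ∀ a b, D.source (a * b) = D.source a * D.source b
  /-- the target is an antihomomorphism -/
  target_one : D.target 1 = 1
  target_mul : ∀ a b, D.target (a * b) = D.target b * D.target a
  /-- the images of the source and of the target commute -/
  source_target_comm : ∀ a b, D.source a * D.target b = D.target b * D.source a
  /-- the comultiplication is a bimodule map: `Δ(x α(a) β(b)) = x₁ β(b) ⊗ x₂ α(a)` -/
  comul_bimodule_wd : ∀ a b, D.rel ≤ D.rel.comap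
    (TensorProduct.map (LinearMap.mulRight k (D.target b)) (LinearMap.mulRight k (D.source a)))
  comul_bimodule : ∀ a b x, D.comul (x * D.source a * D.target b) =
    Submodule.mapQ D.rel D.rel _ (comul_bimodule_wd a b) (D.comul x)
  /-- the counit is a bimodule map: `ε(x α(a) β(b)) = b ε(x) a` -/
  counit_bimodule : ∀ a b x, D.counit (x * D.source a * D.target b) = b * D.counit x * a
  /-- coassociativity: `(Δ ⊗_A id) Δ = (id ⊗_A Δ) Δ` -/
  comul_id_wd : D.rel ≤ LinearMap.ker D.comulTensorId
  id_comul_wd : D.rel ≤ LinearMap.ker D.idTensorComul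
  coassoc : ∀ x, D.rel.liftQ D.comulTensorId comul_id_wd (D.comul x) =
    D.rel.liftQ D.idTensorComul id_comul_wd (D.comul x)
  /-- counitality: `ε(x₁).x₂ = x = x₁.ε(x₂)` -/
  counit_id_wd : D.rel ≤ LinearMap.ker D.counitTensorId
  counit_id : ∀ x, D.rel.liftQ D.counitTensorId counit_id_wd (D.comul x) = x
  id_counit_wd : D.rel ≤ LinearMap.ker D.idTensorCounit
  id_counit : ∀ x, D.rel.liftQ D.idTensorCounit id_counit_wd (D.comul x) = x
  /-- `(g ⊗ h) ⊗ x ↦ (g ⊗ h) Δ(x)` factors through `(K ⊗_A K) ⊗ K` and defines a right unital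
  action of `K` on `K ⊗_A K` -/
  mulComul_wd : ∀ x, D.rel ≤ LinearMap.ker (D.mulComul x)
  mulComul_one : ∀ t, D.rel.liftQ (D.mulComul 1) (mulComul_wd 1) t = t
  mulComul_mul : ∀ x y t, D.rel.liftQ (D.mulComul (x * y)) (mulComul_wd (x * y)) t =
    D.rel.liftQ (D.mulComul y) (mulComul_wd y) (D.rel.liftQ (D.mulComul x) (mulComul_wd x) t)
  /-- `a ⊗ x ↦ ε(α(a) x)` is a right unital action of `K` on `A` -/
  counit_action_one : ∀ a, D.counit (D.source a * 1) = a
  counit_action_mul : ∀ a x y, D.counit (D.source a * (x * y)) =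
    D.counit (D.source (D.counit (D.source a * x)) * y)

end RightBialgebroidData

end Bialgebroids

/-! ### Symmetric Hopf algebroids -/

section HopfAlgebroids

variable {k K L R : Type*} [Field k] [Ring K] [Algebra k K] [Ring L] [Algebra k L]
  [Ring R] [Algebra k R]

/-- `g ⊗ h ↦ τ(g) h` -/
noncomputable def antipodeMul (τ : K →ₗ[k] K) : K ⊗[k] K →ₗ[k] K :=
  TensorProduct.lift (LinearMap.mul k K ∘ₗ τ)

/-- `g ⊗ h ↦ g τ(h)` -/
noncomputable def mulAntipode (τ : K →ₗ[k] K) : K ⊗[k] K →ₗ[k] K :=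
  TensorProduct.lift ((LinearMap.mul k K).compl₂ τ)

/-- The axioms of a symmetric Hopf algebroid with total algebra `K`: a left bialgebroid `DL` over
`L`, a right bialgebroid `DR` over `R` (where `R` is antiisomorphic to `L`) and an antipode `τ`.
Every field named `*_wd` says that a map is well defined on `K ⊗_L K` or on `K ⊗_R K`; the field
after it uses the resulting map. -/
structure IsSymmetricHopfAlgebroid (DL : LeftBialgebroidData k L K)
    (DR : RightBialgebroidData k R K) (τ : K →ₗ[k] K) : Prop where
  base_antiiso : Nonempty (L ≃ₐ[k] Rᵐᵒᵖ)
  left : DL.IsLeftBialgebroid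
  right : DR.IsRightBialgebroid
  /-- the antipode is an antihomomorphism of algebras -/
  antipode_one : τ 1 = 1
  antipode_mul : ∀ x y, τ (x * y) = τ y * τ x
  /-- `α_L ε_L β_R = β_R`, `β_L ε_L α_R = α_R`, `α_R ε_R β_L = β_L`, `β_R ε_R α_L = α_L` -/
  sourceL_targetR : ∀ y, DL.source (DL.counit (DR.target y)) = DR.target y
  targetL_sourceR : ∀ y, DL.target (DL.counit (DR.source y)) = DR.source y
  sourceR_targetL : ∀ x, DR.source (DR.counit (DL.target x)) = DL.target x
  targetR_sourceL : ∀ x, DR.target (DR.counit (DL.source x)) = DL.source x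
  /-- `(Δ_R ⊗_L id) Δ_L = (id ⊗_R Δ_L) Δ_R`, as maps `K → K ⊗_R K ⊗_L K` -/
  comulR_id_wd : DL.rel ≤ LinearMap.ker
    (tensorId DR.comul (leftMulBy DL.target) (leftMulBy DL.source))
  id_comulL_wd : DR.rel ≤ LinearMap.ker
    (idTensor (rightMulBy DR.source) (rightMulBy DR.target) DL.comul)
  mixed_coassoc_RL : ∀ x, DL.rel.liftQ _ comulR_id_wd (DL.comul x) =
    DR.rel.liftQ _ id_comulL_wd (DR.comul x)
  /-- `(Δ_L ⊗_R id) Δ_R = (id ⊗_L Δ_R) Δ_L`, as maps `K → K ⊗_L K ⊗_R K` -/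
  comulL_id_wd : DR.rel ≤ LinearMap.ker
    (tensorId DL.comul (rightMulBy DR.source) (rightMulBy DR.target))
  id_comulR_wd : DL.rel ≤ LinearMap.ker
    (idTensor (leftMulBy DL.target) (leftMulBy DL.source) DR.comul)
  mixed_coassoc_LR : ∀ x, DR.rel.liftQ _ comulL_id_wd (DR.comul x) =
    DL.rel.liftQ _ id_comulR_wd (DL.comul x)
  /-- `τ β_L = α_L` and `τ β_R = α_R` -/
  antipode_targetL : ∀ x, τ (DL.target x) = DL.source x
  antipode_targetR : ∀ y, τ (DR.target y) = DR.source y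
  /-- `μ (τ ⊗ id) Δ_L = α_R ε_R` -/
  antipode_id_wd : DL.rel ≤ LinearMap.ker (antipodeMul τ)
  antipode_id : ∀ x, DL.rel.liftQ (antipodeMul τ) antipode_id_wd (DL.comul x) =
    DR.source (DR.counit x)
  /-- `μ (id ⊗ τ) Δ_R = α_L ε_L` -/
  id_antipode_wd : DR.rel ≤ LinearMap.ker (mulAntipode τ)
  id_antipode : ∀ x, DR.rel.liftQ (mulAntipode τ) id_antipode_wd (DR.comul x) =
    DL.source (DL.counit x)

variable {K' : Type*} [Ring K'] [Algebra k K']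

/-- `Ψ : K → K'` is an isomorphism of algebras which is the identity on the base algebras `L`, `R`
and which carries all structure maps of the first symmetric Hopf algebroid to those of the
second. -/
structure IsHopfAlgebroidIso (DL : LeftBialgebroidData k L K) (DR : RightBialgebroidData k R K)
    (τ : K →ₗ[k] K) (DL' : LeftBialgebroidData k L K') (DR' : RightBialgebroidData k R K')
    (τ' : K' →ₗ[k] K') (Ψ : K →ₗ[k] K') : Prop where
  bijective : Function.Bijective Ψ
  map_one : Ψ 1 = 1
  map_mul : ∀ x y, Ψ (x * y) = Ψ x * Ψ y
  sourceL : ∀ x, Ψ (DL.source x) = DL'.source x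
  targetL : ∀ x, Ψ (DL.target x) = DL'.target x
  counitL : ∀ x, DL'.counit (Ψ x) = DL.counit x
  /-- `(Ψ ⊗_L Ψ) Δ_L = Δ'_L Ψ` -/
  mapL_wd : DL.rel ≤ DL'.rel.comap (TensorProduct.map Ψ Ψ)
  comulL : ∀ x, Submodule.mapQ DL.rel DL'.rel _ mapL_wd (DL.comul x) = DL'.comul (Ψ x)
  sourceR : ∀ y, Ψ (DR.source y) = DR'.source y
  targetR : ∀ y, Ψ (DR.target y) = DR'.target y
  counitR : ∀ x, DR'.counit (Ψ x) = DR.counit x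
  /-- `(Ψ ⊗_R Ψ) Δ_R = Δ'_R Ψ` -/
  mapR_wd : DR.rel ≤ DR'.rel.comap (TensorProduct.map Ψ Ψ)
  comulR : ∀ x, Submodule.mapQ DR.rel DR'.rel _ mapR_wd (DR.comul x) = DR'.comul (Ψ x)
  antipode : ∀ x, Ψ (τ x) = τ' (Ψ x)

end HopfAlgebroids

/-! ### Scalar extensions -/

section ScalarExtensions

variable {k H L R : Type*} [Field k] [Ring H] [HopfAlgebra k H] [Ring L] [Algebra k L]
  [Ring R] [Algebra k R]

variable (k H) in
/-- The antipode `S` of `H`. -/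
noncomputable abbrev S : H →ₗ[k] H := HopfAlgebra.antipode k

/-- The inverse `S⁻¹` of a bijective antipode. -/
noncomputable def SInv (hS : Function.Bijective (S k H)) : H →ₗ[k] H :=
  (LinearEquiv.ofBijective (S k H) hS).symm.toLinearMap

/-- The linear bijection underlying an antiisomorphism of algebras `φ : L → R`. -/
noncomputable def anti (φ : L ≃ₐ[k] Rᵐᵒᵖ) : L ≃ₗ[k] R :=
  φ.toLinearEquiv.trans (MulOpposite.opLinearEquiv k).symm

namespace LeftRightYD

variable (Y : LeftRightYD k H L)

/-- The smash product algebra `L ♯ H`. -/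
abbrev Smash : Type _ := Y.toLeftModuleAlgebra.Smash

/-- `x ↦ x ♯ 1` -/
noncomputable abbrev inBase : L →ₗ[k] Y.Smash := Y.toLeftModuleAlgebra.inBase

/-- `f ↦ 1 ♯ f` -/
noncomputable abbrev inHopf : H →ₗ[k] Y.Smash := Y.toLeftModuleAlgebra.inHopf

/-- The linear map `L ♯ H → M` with `x ♯ f ↦ B x f`. -/
noncomputable def liftSmash {M : Type*} [AddCommGroup M] [Module k M] (B : L →ₗ[k] H →ₗ[k] M) :
    Y.Smash →ₗ[k] M :=
  TensorProduct.lift B ∘ₗ Y.of.symm.toLinearMap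

/-- `x ⊗ h ↦ (1 ♯ h) (x ♯ 1)`, the product `h · x` in `L ♯ H` -/
noncomputable def hopfMulBase : L ⊗[k] H →ₗ[k] Y.Smash :=
  TensorProduct.lift ((LinearMap.mul k Y.Smash).flip.compl₁₂ Y.inBase Y.inHopf)

/-- `x ♯ f ↦ (x ♯ f₁) ⊗ (1 ♯ f₂)` in `(L ♯ H) ⊗ (L ♯ H)` -/
noncomputable def comulLift : Y.Smash →ₗ[k] Y.Smash ⊗[k] Y.Smash :=
  TensorProduct.map Y.of.toLinearMap Y.inHopf ∘ₗ
    (TensorProduct.assoc k L H H).symm.toLinearMap ∘ₗ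
      (Coalgebra.comul (R := k) (A := H)).lTensor L ∘ₗ Y.of.symm.toLinearMap

/-- The left scalar extension bialgebroid `L ♯ H` over `L`:
`α_L(x) = x ♯ 1`, `β_L(x) = x₀ ♯ x₁`, `Δ_L(x ♯ f) = x ♯ f₁ ⊗_L 1 ♯ f₂`, `ε_L(x ♯ f) = ε(f) x`. -/
noncomputable def leftData : LeftBialgebroidData k L Y.Smash where
  source := Y.inBase
  target := Y.of.toLinearMap ∘ₗ Y.coact
  comul := Submodule.mkQ _ ∘ₗ Y.comulLift
  counit := Y.liftSmash ((LinearMap.lsmul k L).flip.compl₂ (Coalgebra.counit (R := k) (A := H)))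

/-- The right bialgebroid structure on `L ♯ H` over `R`, for an antiisomorphism `φ : L → R`:
`α_R(y) = S²(φ⁻¹(y)₁) · φ⁻¹(y)₀`, `β_R(y) = φ⁻¹(y) ♯ 1`, `Δ_R(x ♯ f) = x ♯ f₁ ⊗_R 1 ♯ f₂`,
`ε_R(x ♯ f) = φ(S⁻¹ f ▷ x)`. -/
noncomputable def rightData (hS : Function.Bijective (S k H)) (φ : L ≃ₐ[k] Rᵐᵒᵖ) :
    RightBialgebroidData k R Y.Smash where
  source := Y.hopfMulBase ∘ₗ (S k H ∘ₗ S k H).lTensor L ∘ₗ Y.coact ∘ₗ (anti φ).symm.toLinearMap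
  target := Y.inBase ∘ₗ (anti φ).symm.toLinearMap
  comul := Submodule.mkQ _ ∘ₗ Y.comulLift
  counit := (anti φ).toLinearMap ∘ₗ Y.liftSmash (Y.act.flip.compl₂ (SInv hS))

/-- The antipode `τ(x ♯ f) = S f S²(x₁) · x₀` of `L ♯ H`. -/
noncomputable def antipode : Y.Smash →ₗ[k] Y.Smash :=
  Y.liftSmash ((LinearMap.mul k Y.Smash).flip.compl₁₂
    (Y.hopfMulBase ∘ₗ (S k H ∘ₗ S k H).lTensor L ∘ₗ Y.coact) (Y.inHopf ∘ₗ S k H))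

end LeftRightYD

namespace RightLeftYD

variable (Y : RightLeftYD k H R)

/-- The smash product algebra `H ♯ R`. -/
abbrev Smash : Type _ := Y.toRightModuleAlgebra.Smash

/-- `y ↦ 1 ♯ y` -/
noncomputable abbrev inBase : R →ₗ[k] Y.Smash := Y.toRightModuleAlgebra.inBase

/-- `f ↦ f ♯ 1` -/
noncomputable abbrev inHopf : H →ₗ[k] Y.Smash := Y.toRightModuleAlgebra.inHopf

/-- The linear map `H ♯ R → M` with `f ♯ y ↦ B f y`. -/
noncomputable def liftSmash {M : Type*} [AddCommGroup M] [Module k M] (B : H →ₗ[k] R →ₗ[k] M) :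
    Y.Smash →ₗ[k] M :=
  TensorProduct.lift B ∘ₗ Y.of.symm.toLinearMap

/-- `h ⊗ y ↦ (1 ♯ y) (h ♯ 1)`, the product `y · h` in `H ♯ R` -/
noncomputable def baseMulHopf : H ⊗[k] R →ₗ[k] Y.Smash :=
  TensorProduct.lift ((LinearMap.mul k Y.Smash).flip.compl₁₂ Y.inHopf Y.inBase)

/-- `h ⊗ y ↦ y ◁ h` -/
noncomputable def actFlip : H ⊗[k] R →ₗ[k] R := TensorProduct.lift Y.act.flip

/-- `f ♯ y ↦ (f₁ ♯ 1) ⊗ (f₂ ♯ y)` in `(H ♯ R) ⊗ (H ♯ R)` -/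
noncomputable def comulLift : Y.Smash →ₗ[k] Y.Smash ⊗[k] Y.Smash :=
  TensorProduct.map Y.inHopf Y.of.toLinearMap ∘ₗ
    (TensorProduct.assoc k H H R).toLinearMap ∘ₗ
      (Coalgebra.comul (R := k) (A := H)).rTensor R ∘ₗ Y.of.symm.toLinearMap

/-- The right scalar extension bialgebroid `H ♯ R` over `R`:
`α_R(y) = 1 ♯ y`, `β_R(y) = y₋₁ ♯ y₀`, `Δ_R(f ♯ y) = f₁ ♯ 1 ⊗_R f₂ ♯ y`, `ε_R(f ♯ y) = ε(f) y`. -/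
noncomputable def rightData : RightBialgebroidData k R Y.Smash where
  source := Y.inBase
  target := Y.of.toLinearMap ∘ₗ Y.coact
  comul := Submodule.mkQ _ ∘ₗ Y.comulLift
  counit := Y.liftSmash (LinearMap.lsmul k R ∘ₗ Coalgebra.counit (R := k) (A := H))

/-- The left bialgebroid structure on `H ♯ R` over `L`, for an antiisomorphism `φ : L → R`:
`α_L(x) = φ(x)₋₁ ♯ φ(x)₀`, `β_L(x) = 1 ♯ (φ(x)₀ ◁ S⁻¹(φ(x)₋₁))`,
`Δ_L(f ♯ y) = f₁ ♯ 1 ⊗_L f₂ ♯ y`, `ε_L(f ♯ y) = φ⁻¹(y₀ ◁ (S²(y₋₁) S f))`. -/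
noncomputable def leftData (hS : Function.Bijective (S k H)) (φ : L ≃ₐ[k] Rᵐᵒᵖ) :
    LeftBialgebroidData k L Y.Smash where
  source := Y.of.toLinearMap ∘ₗ Y.coact ∘ₗ (anti φ).toLinearMap
  target := Y.inBase ∘ₗ Y.actFlip ∘ₗ (SInv hS).rTensor R ∘ₗ Y.coact ∘ₗ (anti φ).toLinearMap
  comul := Submodule.mkQ _ ∘ₗ Y.comulLift
  counit := (anti φ).symm.toLinearMap ∘ₗ Y.actFlip ∘ₗ Y.liftSmash
    ((LinearMap.rTensorHom R ∘ₗ (LinearMap.mul k H).flip ∘ₗ S k H).compl₂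
      ((S k H ∘ₗ S k H).rTensor R ∘ₗ Y.coact))

/-- The antipode `τ(f ♯ y) = y₀ · S²(y₋₁) S f` of `H ♯ R`. -/
noncomputable def antipode : Y.Smash →ₗ[k] Y.Smash :=
  Y.liftSmash ((LinearMap.mul k Y.Smash).flip.compl₁₂ (Y.inHopf ∘ₗ S k H)
    (Y.baseMulHopf ∘ₗ (S k H ∘ₗ S k H).rTensor R ∘ₗ Y.coact))

end RightLeftYD

/-- The structure maps of `R` are determined by those of `L`:
`y ◁ f = φ(S⁻¹ f ▷ φ⁻¹(y))` and `y₋₁ ⊗ y₀ = S(φ⁻¹(y)₁) ⊗ φ(φ⁻¹(y)₀)`. -/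
def RightDeterminedByLeft (hS : Function.Bijective (S k H)) (φ : L ≃ₐ[k] Rᵐᵒᵖ)
    (YL : LeftRightYD k H L) (YR : RightLeftYD k H R) : Prop :=
  (∀ y f, YR.act y f = anti φ (YL.act (SInv hS f) ((anti φ).symm y))) ∧
  ∀ y, YR.coact y = TensorProduct.comm k R H
    (TensorProduct.map (anti φ).toLinearMap (S k H) (YL.coact ((anti φ).symm y)))

/-- The structure maps of `L` are determined by those of `R`:
`f ▷ x = φ⁻¹(φ(x) ◁ S f)` and `x₀ ⊗ x₁ = φ⁻¹(φ(x)₀) ⊗ S⁻¹(φ(x)₋₁)`. -/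
def LeftDeterminedByRight (hS : Function.Bijective (S k H)) (φ : L ≃ₐ[k] Rᵐᵒᵖ)
    (YR : RightLeftYD k H R) (YL : LeftRightYD k H L) : Prop :=
  (∀ f x, YL.act f x = (anti φ).symm (YR.act (anti φ x) (S k H f))) ∧
  ∀ x, YL.coact x = TensorProduct.comm k H L
    (TensorProduct.map (SInv hS) (anti φ).symm.toLinearMap (YR.coact (anti φ x)))

/-- The map `Ψ : L ♯ H → H ♯ R`, `Ψ(x ♯ f) = (φ(x)₋₁ ♯ φ(x)₀) · f`. -/
noncomputable def Psi (φ : L ≃ₐ[k] Rᵐᵒᵖ) (YL : LeftRightYD k H L) (YR : RightLeftYD k H R) :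
    YL.Smash →ₗ[k] YR.Smash :=
  YL.liftSmash ((LinearMap.mul k YR.Smash).compl₁₂
    (YR.of.toLinearMap ∘ₗ YR.coact ∘ₗ (anti φ).toLinearMap) YR.inHopf)

/-- `L ♯ H` and `H ♯ R` are presentations of the same symmetric Hopf algebroid, connected by the
isomorphism `Ψ`. -/
def SameHopfAlgebroid (hS : Function.Bijective (S k H)) (φ : L ≃ₐ[k] Rᵐᵒᵖ)
    (YL : LeftRightYD k H L) (YR : RightLeftYD k H R) : Prop :=
  IsHopfAlgebroidIso YL.leftData (YL.rightData hS φ) YL.antipode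
    (YR.leftData hS φ) YR.rightData YR.antipode (Psi φ YL YR)

end ScalarExtensions

end ScalarExt

open ScalarExt

open scoped TensorProduct
open ScalarExt

set_option linter.unusedSectionVars false
set_option linter.unusedSimpArgs false

/-! Both smash products are instances of one situation, `IsScalarExt`: an algebra K with images ι of
H, α of L and γ of R, in which f x = (f₁ ▷ x) f₂, x = S(x₁) φ(x₀) and φ(x) = S²(x₁) x₀, and which is
spanned by the products x f. In L ♯ H the image of R is defined by the last formula, in H ♯ R the
image of L by the one before it. So the Hopf algebroid axioms are verified once, for K. Linear
identities are tested on the normal forms x f or, since S is bijective, on f y with y ∈ R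
(`ext_left`, `ext_right`).

Three facts carry the verification. Write β(x) = x₀ x₁. First, braided commutativity says that α(L)
commutes with β(L) and with γ(R) (`target_left_comm`, `left_right_comm`). Second, moving H past β(L)
and past γ(R) gives φ(x) = β(S²(x₁) ▷ x₀) and β(x) = φ(S⁻¹(x₁) ▷ x₀) (`right_eq_target`,
`target_eq_right`), so the target of L and the source of R have the same image; this is where the
mixed source and target axioms come from. Third, both comultiplications are the one of H with L kept
on the first factor and R on the second: x f ↦ x f₁ ⊗ f₂ and f y ↦ f₁ ⊗ f₂ y (`IsExtComul`). Hence
the two ordinary and the two mixed coassociativity laws are all that of H (`IsExtComul.coassoc`).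
The antipode is x f ↦ S(f) φ(x).

The definition of each comultiplication supplies only one of these two formulas. The other uses the
balancing relation over L or R, and is proved by the four lemmas `isExtComul_left_of_left`,
`isExtComul_right_of_left`, `isExtComul_left_of_right` and `isExtComul_right_of_right`.

The two kinds of Yetter-Drinfeld data are compared through `Linked`, which mentions S but not S⁻¹
and follows from either set of transport formulas. Thus the statement about H ♯ R reduces to data on
L, and Ψ is the map between two scalar extensions of the same L that matches normal forms; it is
multiplicative because the same commutation relation governs both. -/

namespace ScalarExt

/-! ### Sweedler sums -/

section Sweedler

variable {k A B C D M N : Type*} [Field k]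
  [AddCommGroup A] [Module k A] [AddCommGroup B] [Module k B] [AddCommGroup C] [Module k C]
  [AddCommGroup D] [Module k D] [AddCommGroup M] [Module k M] [AddCommGroup N] [Module k N]

/-- Linearity of a bare function, as a class, so that it is found by instance search. -/
class Lin (k : Type*) {A M : Type*} [Field k] [AddCommGroup A] [Module k A]
    [AddCommGroup M] [Module k M] (f : A → M) : Prop where
  add : ∀ a b, f (a + b) = f a + f b
  smul : ∀ (c : k) a, f (c • a) = c • f a

/-- The sum `∑ F a b` over a representation `t = ∑ a ⊗ b`. -/
noncomputable def sw (t : A ⊗[k] B) (F : A → B → M) : M :=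
  ∑ p ∈ (TensorProduct.exists_finset t).choose, F p.1 p.2

/-- Read backwards, this writes a tensor as an explicit sum, so that linear maps can be pushed onto
pure tensors. This is how abstract axioms are turned into Sweedler notation. -/
lemma sw_self (t : A ⊗[k] B) : sw t (fun a b => a ⊗ₜ[k] b) = t :=
  (TensorProduct.exists_finset t).choose_spec.symm

instance Lin.id : Lin k (no_index (fun a : A => a)) := ⟨fun _ _ => rfl, fun _ _ => rfl⟩

instance Lin.map (T : M →ₗ[k] N) (f : A → M) [Lin k f] : Lin k (no_index (fun a => T (f a))) :=
  ⟨fun a b => by simp [Lin.add k], fun a b => by simp [Lin.smul]⟩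

instance Lin.equiv (T : M ≃ₗ[k] N) (f : A → M) [Lin k f] : Lin k (no_index (fun a => T (f a))) :=
  ⟨fun a b => by simp [Lin.add k], fun a b => by simp [Lin.smul]⟩

instance Lin.map₂ (T : M →ₗ[k] N →ₗ[k] C) (f : A → M) [Lin k f] (c : N) :
    Lin k (no_index (fun a => T (f a) c)) :=
  ⟨fun a b => by simp [Lin.add k], fun a b => by simp [Lin.smul]⟩

instance Lin.tmul_left (f : A → M) [Lin k f] (c : N) : Lin k (no_index (fun a => f a ⊗ₜ[k] c)) :=
  ⟨fun a b => by simp [Lin.add k, TensorProduct.add_tmul],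
    fun a b => by simp [Lin.smul, TensorProduct.smul_tmul']⟩

instance Lin.tmul_right (f : A → M) [Lin k f] (c : N) : Lin k (no_index (fun a => c ⊗ₜ[k] f a)) :=
  ⟨fun a b => by simp [Lin.add k, TensorProduct.tmul_add], fun a b => by simp [Lin.smul]⟩

instance Lin.smul_left (f : A → k) [Lin k f] (c : N) : Lin k (no_index (fun a => f a • c)) :=
  ⟨fun a b => by simp [Lin.add k, add_smul], fun a b => by simp [Lin.smul, mul_smul]⟩

instance Lin.smul_right (f : A → N) [Lin k f] (c : k) : Lin k (no_index (fun a => c • f a)) :=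
  ⟨fun a b => by simp [Lin.add k], fun a b => by rw [Lin.smul (f := f), smul_comm]⟩

section Mul

variable {K : Type*} [Ring K] [Algebra k K]

instance Lin.mul_left (f : A → K) [Lin k f] (c : K) : Lin k (no_index (fun a => f a * c)) :=
  ⟨fun a b => by simp [Lin.add k, add_mul], fun a b => by simp [Lin.smul]⟩

instance Lin.mul_right (f : A → K) [Lin k f] (c : K) : Lin k (no_index (fun a => c * f a)) :=
  ⟨fun a b => by simp [Lin.add k, mul_add], fun a b => by simp [Lin.smul]⟩

lemma mul_sw (t : A ⊗[k] B) (F : A → B → K) (c : K) :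
    c * sw t F = sw t (fun a b => c * F a b) := Finset.mul_sum _ _ _

lemma sw_mul (t : A ⊗[k] B) (F : A → B → K) (c : K) :
    sw t F * c = sw t (fun a b => F a b * c) := Finset.sum_mul _ _ _

end Mul

instance Lin.sw_right (t : B ⊗[k] C) (F : A → B → C → M) [hF : ∀ p q, Lin k (fun a => F a p q)] :
    Lin k (no_index (fun a => sw t (fun p q => F a p q))) :=
  ⟨fun a b => (Finset.sum_congr rfl fun p _ => (hF p.1 p.2).add a b).trans
      Finset.sum_add_distrib,
    fun c a => (Finset.sum_congr rfl fun p _ => (hF p.1 p.2).smul c a).trans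
      Finset.smul_sum.symm⟩

lemma map_sw (T : M →ₗ[k] N) (t : A ⊗[k] B) (F : A → B → M) :
    T (sw t F) = sw t (fun a b => T (F a b)) := map_sum _ _ _

lemma equiv_sw (T : M ≃ₗ[k] N) (t : A ⊗[k] B) (F : A → B → M) :
    T (sw t F) = sw t (fun a b => T (F a b)) := map_sum _ _ _

lemma sw_apply (t : A ⊗[k] B) (F : A → B → M →ₗ[k] N) (c : M) :
    sw t F c = sw t (fun a b => F a b c) := LinearMap.sum_apply _ _ _

lemma tmul_sw (c : N) (t : A ⊗[k] B) (F : A → B → M) :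
    c ⊗ₜ[k] sw t F = sw t (fun a b => c ⊗ₜ[k] F a b) := TensorProduct.tmul_sum _ _ _

lemma sw_tmul (c : N) (t : A ⊗[k] B) (F : A → B → M) :
    sw t F ⊗ₜ[k] c = sw t (fun a b => F a b ⊗ₜ[k] c) := TensorProduct.sum_tmul _ _ _

lemma smul_sw (c : k) (t : A ⊗[k] B) (F : A → B → M) :
    c • sw t F = sw t (fun a b => c • F a b) := Finset.smul_sum

lemma sw_comm (t : A ⊗[k] B) (u : C ⊗[k] D) (F : A → B → C → D → M) :
    sw t (fun a b => sw u (fun c d => F a b c d)) =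
      sw u (fun c d => sw t (fun a b => F a b c d)) := Finset.sum_comm

/-- The linear map on `A ⊗ B` given by a bilinear function. -/
noncomputable def lin₂ (F : A → B → M) [∀ b, Lin k (fun a => F a b)] [∀ a, Lin k (fun b => F a b)] :
    A ⊗[k] B →ₗ[k] M :=
  TensorProduct.lift (LinearMap.mk₂ k F (fun a a' b => Lin.add k (f := fun a => F a b) a a')
    (fun c a b => Lin.smul (f := fun a => F a b) c a) (fun a b b' => Lin.add k (f := F a) b b')
    (fun c a b => Lin.smul (f := F a) c b))

section Bilinear

variable (F : A → B → M) [∀ b, Lin k (fun a => F a b)] [∀ a, Lin k (fun b => F a b)]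

lemma lin₂_tmul (a : A) (b : B) : lin₂ (k := k) F (a ⊗ₜ b) = F a b := by simp [lin₂]

/-- For bilinear summands the sum does not depend on the chosen representation of the tensor. -/
lemma sw_eq_lin₂ (t : A ⊗[k] B) : sw t F = lin₂ F t := by
  conv_rhs => rw [← sw_self t, map_sw]
  simp only [lin₂_tmul]

@[simp] lemma sw_pure (a : A) (b : B) : sw (a ⊗ₜ[k] b) F = F a b := by
  rw [sw_eq_lin₂, lin₂_tmul]

lemma sw_sw (t : C ⊗[k] D) (G : C → D → A ⊗[k] B) :
    sw (sw t G) F = sw t (fun c d => sw (G c d) F) := by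
  simp only [sw_eq_lin₂ F, map_sw]

instance Lin.sw_left (f : C → A ⊗[k] B) [Lin k f] : Lin k (no_index (fun c => sw (f c) F)) :=
  ⟨fun a b => by simp [sw_eq_lin₂ F, Lin.add k], fun a b => by simp [sw_eq_lin₂ F, Lin.smul]⟩

/-- Replacing a bilinear function by a bundled map makes the linearity of all its composites visible
to instance search. -/
lemma exists_bilin : ∃ T : A →ₗ[k] B →ₗ[k] M, (fun a b => T a b) = F :=
  ⟨TensorProduct.curry (lin₂ F), by funext a b; simp [lin₂_tmul]⟩

end Bilinear

lemma exists_lin (F : A → M) [Lin k F] : ∃ T : A →ₗ[k] M, (fun a => T a) = F :=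
  ⟨{ toFun := F, map_add' := Lin.add k, map_smul' := Lin.smul }, rfl⟩

end Sweedler

/-! ### Coalgebra, bialgebra and antipode axioms in Sweedler form. -/

section Coalgebra

variable {k H M : Type*} [Field k] [AddCommGroup M] [Module k M]

local notation "δ" => Coalgebra.comul (R := k)
local notation "ε" => Coalgebra.counit (R := k)

section

variable [AddCommGroup H] [Module k H] [Coalgebra k H]

lemma sw_coassoc (f : H) (F : H → H → H → M) [∀ b c, Lin k (fun a => F a b c)]
    [∀ a c, Lin k (fun b => F a b c)] [∀ a b, Lin k (fun c => F a b c)] :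
    sw (δ f) (fun a b => sw (δ a) (fun p q => F p q b)) =
      sw (δ f) (fun a b => sw (δ b) (fun p q => F a p q)) := by
  -- The trilinear summand is a linear map on H ⊗ (H ⊗ H); it is applied to both sides of the tensor
  -- identity.
  have h := congrArg (lin₂ (k := k) (fun (p : H) (t : H ⊗[k] H) => sw t (fun q r => F p q r)))
    (Coalgebra.coassoc_apply (R := k) f)
  rw [← sw_self (δ f)] at h
  simp only [map_sw, equiv_sw, LinearMap.rTensor_tmul, LinearMap.lTensor_tmul, lin₂_tmul] at h
  rw [← h]
  congr 1
  funext a b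
  conv_rhs => rw [← sw_self (δ a)]
  simp only [sw_tmul, equiv_sw, map_sw, TensorProduct.assoc_tmul, lin₂_tmul, sw_pure]

lemma sw_counit_left (f : H) (F : H → M) [Lin k F] :
    sw (δ f) (fun a b => ε a • F b) = F f := by
  have h := congrArg (lin₂ (k := k) (fun (c : k) (b : H) => c • F b))
    (Coalgebra.rTensor_counit_comul (R := k) f)
  rw [← sw_self (δ f)] at h
  simpa only [map_sw, LinearMap.rTensor_tmul, lin₂_tmul, one_smul] using h

lemma sw_counit_right (f : H) (F : H → M) [Lin k F] :
    sw (δ f) (fun a b => ε b • F a) = F f := by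
  have h := congrArg (lin₂ (k := k) (fun (b : H) (c : k) => c • F b))
    (Coalgebra.lTensor_counit_comul (R := k) f)
  rw [← sw_self (δ f)] at h
  simpa only [map_sw, LinearMap.lTensor_tmul, lin₂_tmul, one_smul] using h

end

section

variable [Ring H] [Bialgebra k H]

lemma sw_comul_mul (f g : H) (F : H → H → M) [∀ b, Lin k (fun a => F a b)]
    [∀ a, Lin k (fun b => F a b)] :
    sw (δ (f * g)) F = sw (δ f) (fun a b => sw (δ g) (fun p q => F (a * p) (b * q))) := by
  rw [Bialgebra.comul_mul]
  conv_lhs => rw [← sw_self (δ f), ← sw_self (δ g)]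
  simp only [sw_mul, mul_sw, Algebra.TensorProduct.tmul_mul_tmul, sw_sw, sw_pure]
  exact sw_comm _ _ _

lemma sw_comul_one (F : H → H → M) [∀ b, Lin k (fun a => F a b)]
    [∀ a, Lin k (fun b => F a b)] : sw (δ (1 : H)) F = F 1 1 := by
  rw [Bialgebra.comul_one, Algebra.TensorProduct.one_def, sw_pure]

end

section

variable [Ring H] [HopfAlgebra k H]

lemma sw_antipode_mul (f : H) (F : H → M) [Lin k F] :
    sw (δ f) (fun a b => F (S k H a * b)) = ε f • F 1 := by
  have h := HopfAlgebra.mul_antipode_rTensor_comul_apply (R := k) f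
  rw [← sw_self (δ f), Algebra.algebraMap_eq_smul_one] at h
  rw [← Lin.smul, ← h]
  simp only [map_sw, LinearMap.rTensor_tmul, LinearMap.mul'_apply]
  obtain ⟨T, rfl⟩ := exists_lin (k := k) F
  exact (map_sw T _ _).symm

lemma sw_mul_antipode (f : H) (F : H → M) [Lin k F] :
    sw (δ f) (fun a b => F (a * S k H b)) = ε f • F 1 := by
  have h := HopfAlgebra.mul_antipode_lTensor_comul_apply (R := k) f
  rw [← sw_self (δ f), Algebra.algebraMap_eq_smul_one] at h
  rw [← Lin.smul, ← h]
  simp only [map_sw, LinearMap.lTensor_tmul, LinearMap.mul'_apply]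
  obtain ⟨T, rfl⟩ := exists_lin (k := k) F
  exact (map_sw T _ _).symm

end

end Coalgebra

/-! ### Cancellations with the antipode, and its anticomultiplicativity. -/

section HopfSweedler

variable {k H M : Type*} [Field k] [AddCommGroup M] [Module k M] [Ring H] [HopfAlgebra k H]

local notation "δ" => Coalgebra.comul (R := k)
local notation "ε" => Coalgebra.counit (R := k)

lemma S_mul (f g : H) : S k H (f * g) = S k H g * S k H f :=
  HopfAlgebra.antipode_mul_antidistrib f g

lemma S_one : S k H 1 = 1 := HopfAlgebra.antipode_one

lemma counit_S (f : H) : ε (S k H f) = ε f := HopfAlgebra.counit_antipode f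

/-- In a threefold coproduct, coassociativity brings the first two legs together, the antipode axiom
turns them into a counit, and the counit absorbs the third. The variants below treat the other order
of S and the last two legs, where the pair is already nested. -/
lemma sw_antipode_mul_left (f : H) (F : H → H → M) [∀ b, Lin k (fun a => F a b)]
    [∀ a, Lin k (fun b => F a b)] :
    sw (δ f) (fun a b => sw (δ b) (fun p q => F (S k H a * p) q)) = F 1 f := by
  obtain ⟨T, rfl⟩ := exists_bilin (k := k) F
  rw [← sw_coassoc f (fun a p q => T (S k H a * p) q)]
  have h : ∀ a b : H, sw (δ a) (fun p q => T (S k H p * q) b) = ε a • T 1 b :=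
    fun a b => sw_antipode_mul a (fun u => T u b)
  simp only [h, sw_counit_left]

lemma sw_mul_antipode_left (f : H) (F : H → H → M) [∀ b, Lin k (fun a => F a b)]
    [∀ a, Lin k (fun b => F a b)] :
    sw (δ f) (fun a b => sw (δ b) (fun p q => F (a * S k H p) q)) = F 1 f := by
  obtain ⟨T, rfl⟩ := exists_bilin (k := k) F
  rw [← sw_coassoc f (fun a p q => T (a * S k H p) q)]
  have h : ∀ a b : H, sw (δ a) (fun p q => T (p * S k H q) b) = ε a • T 1 b :=
    fun a b => sw_mul_antipode a (fun u => T u b)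
  simp only [h, sw_counit_left]

lemma sw_antipode_mul_right (f : H) (F : H → H → M) [∀ b, Lin k (fun a => F a b)]
    [∀ a, Lin k (fun b => F a b)] :
    sw (δ f) (fun a b => sw (δ b) (fun p q => F a (S k H p * q))) = F f 1 := by
  obtain ⟨T, rfl⟩ := exists_bilin (k := k) F
  have h : ∀ a b : H, sw (δ b) (fun p q => T a (S k H p * q)) = ε b • T a 1 :=
    fun a b => sw_antipode_mul b (fun u => T a u)
  simp only [h]
  exact sw_counit_right f (fun u => T u 1)

lemma sw_mul_antipode_right (f : H) (F : H → H → M) [∀ b, Lin k (fun a => F a b)]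
    [∀ a, Lin k (fun b => F a b)] :
    sw (δ f) (fun a b => sw (δ b) (fun p q => F a (p * S k H q))) = F f 1 := by
  obtain ⟨T, rfl⟩ := exists_bilin (k := k) F
  have h : ∀ a b : H, sw (δ b) (fun p q => T a (p * S k H q)) = ε b • T a 1 :=
    fun a b => sw_mul_antipode b (fun u => T a u)
  simp only [h]
  exact sw_counit_right f (fun u => T u 1)

/-- The map f ↦ S(f₂) ⊗ S(f₁) is a right convolution inverse of Δ: the inner pair f₂ S(f₃) cancels,
then the outer one. -/
lemma comul_mul_antipode (f : H) :
    sw (δ f) (fun p q => δ p * sw (δ q) (fun a b => S k H b ⊗ₜ[k] S k H a)) =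
      ε f • (1 : H ⊗[k] H) := by
  have h : ∀ p q : H, δ p * sw (δ q) (fun a b => S k H b ⊗ₜ[k] S k H a) =
      sw (δ p) (fun c d => sw (δ q) (fun a b => (c * S k H b) ⊗ₜ[k] (d * S k H a))) := by
    intro p q
    conv_lhs => rw [← sw_self (δ p)]
    simp only [sw_mul, mul_sw, Algebra.TensorProduct.tmul_mul_tmul]
    exact sw_comm _ _ _
  simp only [h]
  rw [sw_coassoc f (fun c d q => sw (δ q) (fun a b => (c * S k H b) ⊗ₜ[k] (d * S k H a)))]
  have h2 : ∀ c r : H, sw (δ r) (fun d q => sw (δ q) (fun a b =>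
      (c * S k H b) ⊗ₜ[k] (d * S k H a))) = (c * S k H r) ⊗ₜ[k] (1 : H) := fun c r =>
    sw_mul_antipode_left r (fun u b => (c * S k H b) ⊗ₜ[k] u)
  simp only [h2]
  rw [sw_mul_antipode f (fun u => u ⊗ₜ[k] (1 : H)), Algebra.TensorProduct.one_def]

/-- Δ ∘ S is a left convolution inverse of Δ because Δ is multiplicative, so it equals the right
inverse found in `comul_mul_antipode`. -/
lemma comul_antipode (f : H) :
    δ (S k H f) = sw (δ f) (fun a b => S k H b ⊗ₜ[k] S k H a) := by
  have h1 : sw (δ f) (fun a b => sw (δ b) (fun p q => δ (S k H a) *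
      (δ p * sw (δ q) (fun a b => S k H b ⊗ₜ[k] S k H a)))) = δ (S k H f) := by
    simp only [← mul_sw, comul_mul_antipode]
    simp only [mul_smul_comm, mul_one]
    exact sw_counit_right f (fun u => δ (S k H u))
  rw [← h1]
  simp only [← mul_assoc, ← Bialgebra.comul_mul]
  rw [sw_antipode_mul_left f (fun u q => δ u * sw (δ q) (fun a b => S k H b ⊗ₜ[k] S k H a)),
    Bialgebra.comul_one, one_mul]

lemma sw_comul_antipode (f : H) (F : H → H → M) [∀ b, Lin k (fun a => F a b)]
    [∀ a, Lin k (fun b => F a b)] :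
    sw (δ (S k H f)) F = sw (δ f) (fun a b => F (S k H b) (S k H a)) := by
  rw [comul_antipode, sw_sw]
  simp only [sw_pure]

end HopfSweedler

/-! ### The axioms of Yetter-Drinfeld module algebras in Sweedler form -/

section YetterDrinfeld

variable {k H L R M : Type*} [Field k] [AddCommGroup M] [Module k M] [Ring L] [Algebra k L]
  [Ring R] [Algebra k R]

local notation "δ" => Coalgebra.comul (R := k)
local notation "ε" => Coalgebra.counit (R := k)

namespace LeftRightYD

variable [Ring H] [Bialgebra k H] (Y : LeftRightYD k H L)

lemma act_mul_sw (f : H) (x y : L) :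
    Y.act f (x * y) = sw (δ f) (fun a b => Y.act a x * Y.act b y) := by
  rw [Y.act_mul]
  conv_lhs => rw [← sw_self (δ f)]
  simp only [map_sw, TensorProduct.map_tmul, LinearMap.mul'_apply, LinearMap.flip_apply]

lemma sw_coact_coassoc (x : L) (F : L → H → H → M) [∀ b c, Lin k (fun a => F a b c)]
    [∀ a c, Lin k (fun b => F a b c)] [∀ a b, Lin k (fun c => F a b c)] :
    sw (Y.coact x) (fun a h => sw (Y.coact a) (fun b g => F b g h)) =
      sw (Y.coact x) (fun a h => sw (δ h) (fun p q => F a p q)) := by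
  have h := congrArg (lin₂ (k := k) (fun (p : L) (t : H ⊗[k] H) => sw t (fun q r => F p q r)))
    (Y.coact_coassoc x)
  rw [← sw_self (Y.coact x)] at h
  simp only [map_sw, equiv_sw, LinearMap.rTensor_tmul, LinearMap.lTensor_tmul, lin₂_tmul] at h
  rw [← h]
  congr 1
  funext a b
  conv_rhs => rw [← sw_self (Y.coact a)]
  simp only [sw_tmul, equiv_sw, map_sw, TensorProduct.assoc_tmul, lin₂_tmul, sw_pure]

lemma sw_coact_counit (x : L) (F : L → M) [Lin k F] :
    sw (Y.coact x) (fun a h => ε h • F a) = F x := by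
  have h := Y.coact_counit x
  rw [← sw_self (Y.coact x)] at h
  simp only [map_sw, equiv_sw, LinearMap.lTensor_tmul, TensorProduct.rid_tmul] at h
  conv_rhs => rw [← h]
  obtain ⟨T, rfl⟩ := exists_lin (k := k) F
  simp only [map_sw, map_smul]

lemma sw_yetterDrinfeld (f : H) (x : L) (F : L → H → M) [∀ b, Lin k (fun a => F a b)]
    [∀ a, Lin k (fun b => F a b)] :
    sw (δ f) (fun p q => sw (Y.coact x) (fun a h => F (Y.act p a) (q * h))) =
      sw (δ f) (fun p q => sw (Y.coact (Y.act q x)) (fun a h => F a (h * p))) := by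
  have h := congrArg (lin₂ (k := k) F) (Y.yetterDrinfeld f x)
  rw [← sw_self (δ f), ← sw_self (Y.coact x)] at h
  simp only [map_sw, sw_apply, TensorProduct.map₂_apply_tmul, TensorProduct.map_tmul,
    TensorProduct.lift.tmul, lin₂_tmul, LinearMap.mul_apply', LinearMap.compl₂_apply,
    LinearMap.comp_apply, LinearMap.flip_apply] at h
  rw [sw_comm]
  refine (Eq.trans ?_ h).trans ?_
  · rw [sw_comm]
  · congr 1
    funext p q
    conv_lhs => rw [← sw_self (Y.coact (Y.act q x))]
    simp [map_sw, lin₂_tmul]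

lemma sw_coact_mul (x y : L) (F : L → H → M) [∀ b, Lin k (fun a => F a b)]
    [∀ a, Lin k (fun b => F a b)] :
    sw (Y.coact (x * y)) F =
      sw (Y.coact x) (fun a h => sw (Y.coact y) (fun b g => F (a * b) (g * h))) := by
  rw [Y.coact_mul]
  conv_lhs => rw [← sw_self (Y.coact x), ← sw_self (Y.coact y)]
  simp only [map_sw, sw_apply, TensorProduct.map₂_apply_tmul, TensorProduct.map_tmul,
    LinearMap.mul_apply', LinearMap.flip_apply, sw_sw, sw_pure]
  exact sw_comm _ _ _

lemma sw_coact_one (F : L → H → M) [∀ b, Lin k (fun a => F a b)]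
    [∀ a, Lin k (fun b => F a b)] : sw (Y.coact 1) F = F 1 1 := by
  rw [Y.coact_one, sw_pure]

lemma braidedCommutative_iff : Y.BraidedCommutative ↔
    ∀ a x, sw (Y.coact x) (fun c h => c * Y.act h a) = a * x := by
  refine forall₂_congr fun a x => ?_
  conv_lhs => rw [← sw_self (Y.coact x)]
  simp only [map_sw, LinearMap.lTensor_tmul, LinearMap.mul'_apply, LinearMap.flip_apply]

end LeftRightYD

namespace RightLeftYD

variable [Ring H] [Bialgebra k H] (Y : RightLeftYD k H R)

lemma mul_act_sw (x y : R) (f : H) :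
    Y.act (x * y) f = sw (δ f) (fun a b => Y.act x a * Y.act y b) := by
  rw [Y.mul_act]
  conv_lhs => rw [← sw_self (δ f)]
  simp only [map_sw, TensorProduct.map_tmul, LinearMap.mul'_apply]

lemma sw_coact_coassoc (y : R) (F : H → H → R → M) [∀ b c, Lin k (fun a => F a b c)]
    [∀ a c, Lin k (fun b => F a b c)] [∀ a b, Lin k (fun c => F a b c)] :
    sw (Y.coact y) (fun h a => sw (δ h) (fun p q => F p q a)) =
      sw (Y.coact y) (fun h a => sw (Y.coact a) (fun g b => F h g b)) := by
  have h := congrArg (lin₂ (k := k) (fun (p : H) (t : H ⊗[k] R) => sw t (fun q r => F p q r)))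
    (Y.coact_coassoc y)
  rw [← sw_self (Y.coact y)] at h
  simp only [map_sw, equiv_sw, LinearMap.rTensor_tmul, LinearMap.lTensor_tmul, lin₂_tmul] at h
  rw [← h]
  congr 1
  funext a b
  conv_rhs => rw [← sw_self (δ a)]
  simp only [sw_tmul, equiv_sw, map_sw, TensorProduct.assoc_tmul, lin₂_tmul, sw_pure]

lemma sw_coact_counit (y : R) (F : R → M) [Lin k F] :
    sw (Y.coact y) (fun h a => ε h • F a) = F y := by
  have h := Y.coact_counit y
  rw [← sw_self (Y.coact y)] at h
  simp only [map_sw, equiv_sw, LinearMap.rTensor_tmul, TensorProduct.lid_tmul] at h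
  conv_rhs => rw [← h]
  obtain ⟨T, rfl⟩ := exists_lin (k := k) F
  simp only [map_sw, map_smul]

lemma sw_yetterDrinfeld (y : R) (f : H) (F : H → R → M) [∀ b, Lin k (fun a => F a b)]
    [∀ a, Lin k (fun b => F a b)] :
    sw (Y.coact y) (fun h a => sw (δ f) (fun p q => F (h * p) (Y.act a q))) =
      sw (δ f) (fun p q => sw (Y.coact (Y.act y p)) (fun h a => F (q * h) a)) := by
  have h := congrArg (lin₂ (k := k) F) (Y.yetterDrinfeld y f)
  rw [← sw_self (δ f), ← sw_self (Y.coact y)] at h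
  simp only [map_sw, sw_apply, TensorProduct.map₂_apply_tmul, TensorProduct.map_tmul,
    TensorProduct.lift.tmul, lin₂_tmul, LinearMap.mul_apply', LinearMap.compl₂_apply,
    LinearMap.comp_apply, LinearMap.flip_apply] at h
  refine (Eq.trans ?_ h).trans ?_
  · rw [sw_comm]
  · congr 1
    funext p q
    conv_lhs => rw [← sw_self (Y.coact (Y.act y p))]
    simp [map_sw, lin₂_tmul]

lemma sw_coact_mul (x y : R) (F : H → R → M) [∀ b, Lin k (fun a => F a b)]
    [∀ a, Lin k (fun b => F a b)] :
    sw (Y.coact (x * y)) F =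
      sw (Y.coact x) (fun h a => sw (Y.coact y) (fun g b => F (g * h) (a * b))) := by
  rw [Y.coact_mul]
  conv_lhs => rw [← sw_self (Y.coact x), ← sw_self (Y.coact y)]
  simp only [map_sw, sw_apply, TensorProduct.map₂_apply_tmul, TensorProduct.map_tmul,
    LinearMap.mul_apply', LinearMap.flip_apply, sw_sw, sw_pure]
  exact sw_comm _ _ _

lemma braidedCommutative_iff : Y.BraidedCommutative ↔
    ∀ a y, sw (Y.coact y) (fun h c => Y.act a h * c) = y * a := by
  refine forall₂_congr fun a y => ?_
  conv_lhs => rw [← sw_self (Y.coact y)]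
  simp only [map_sw, LinearMap.rTensor_tmul, LinearMap.mul'_apply]

end RightLeftYD

end YetterDrinfeld

/-! ### The correspondence of Yetter-Drinfeld module algebras -/

section Correspondence

variable {k H L R M : Type*} [Field k] [AddCommGroup M] [Module k M] [Ring L] [Algebra k L]
  [Ring R] [Algebra k R] [Ring H] [HopfAlgebra k H]

local notation "δ" => Coalgebra.comul (R := k)
local notation "ε" => Coalgebra.counit (R := k)

section Antipode

variable (hS : Function.Bijective (S k H))

lemma SInv_S (f : H) : SInv hS (S k H f) = f :=
  (LinearEquiv.ofBijective (S k H) hS).symm_apply_apply f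

lemma S_SInv (f : H) : S k H (SInv hS f) = f :=
  (LinearEquiv.ofBijective (S k H) hS).apply_symm_apply f

lemma SInv_one : SInv hS 1 = 1 := hS.1 (by rw [S_SInv, S_one])

lemma SInv_mul (f g : H) : SInv hS (f * g) = SInv hS g * SInv hS f := by
  apply hS.1
  rw [S_mul, S_SInv, S_SInv, S_SInv]

lemma counit_SInv (f : H) : ε (SInv hS f) = ε f := by
  rw [← counit_S, S_SInv]

lemma sw_comul_SInv (f : H) (F : H → H → M) [∀ b, Lin k (fun a => F a b)]
    [∀ a, Lin k (fun b => F a b)] :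
    sw (δ (SInv hS f)) F = sw (δ f) (fun a b => F (SInv hS b) (SInv hS a)) := by
  obtain ⟨T, rfl⟩ := exists_bilin (k := k) F
  obtain ⟨g, rfl⟩ := hS.2 f
  rw [SInv_S, sw_comul_antipode g (fun a b => T (SInv hS b) (SInv hS a))]
  simp only [SInv_S]

lemma comul_SInv (f : H) :
    δ (SInv hS f) = sw (δ f) (fun a b => SInv hS b ⊗ₜ[k] SInv hS a) := by
  rw [← sw_comul_SInv hS f (fun a b => a ⊗ₜ[k] b), sw_self]

end Antipode

section Anti

variable (φ : L ≃ₐ[k] Rᵐᵒᵖ)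

lemma anti_mul (x y : L) : anti φ (x * y) = anti φ y * anti φ x := by
  simp [anti]

lemma anti_one : anti φ 1 = 1 := by simp [anti]

lemma anti_symm_mul (x y : R) :
    (anti φ).symm (x * y) = (anti φ).symm y * (anti φ).symm x := by
  apply (anti φ).injective
  simp [anti_mul]

lemma anti_symm_one : (anti φ).symm 1 = 1 := by
  rw [LinearEquiv.symm_apply_eq, anti_one]

end Anti

/-- The relation between the structure maps of `L` and of `R` under `φ`, without the inverse of
the antipode: `φ(x) ◁ S f = φ(f ▷ x)` and `λ(φ(x)) = S(x₁) ⊗ φ(x₀)`. -/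
structure Linked (φ : L ≃ₐ[k] Rᵐᵒᵖ) (YL : LeftRightYD k H L) (YR : RightLeftYD k H R) : Prop where
  act : ∀ x f, YR.act (anti φ x) (S k H f) = anti φ (YL.act f x)
  coact : ∀ x, YR.coact (anti φ x) = sw (YL.coact x) (fun a h => S k H h ⊗ₜ[k] anti φ a)

variable {hS : Function.Bijective (S k H)} {φ : L ≃ₐ[k] Rᵐᵒᵖ}
  {YL : LeftRightYD k H L} {YR : RightLeftYD k H R}

lemma RightDeterminedByLeft.linked (h : RightDeterminedByLeft hS φ YL YR) : Linked φ YL YR where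
  act x f := by rw [h.1, SInv_S, LinearEquiv.symm_apply_apply]
  coact x := by
    rw [h.2, LinearEquiv.symm_apply_apply]
    conv_lhs => rw [← sw_self (YL.coact x)]
    simp only [map_sw, equiv_sw, TensorProduct.map_tmul, TensorProduct.comm_tmul]
    rfl

lemma LeftDeterminedByRight.linked (h : LeftDeterminedByRight hS φ YR YL) : Linked φ YL YR where
  act x f := by rw [h.1, LinearEquiv.apply_symm_apply]
  coact x := by
    rw [h.2]
    conv_rhs => rw [← sw_self (YR.coact (anti φ x))]
    simp only [map_sw, equiv_sw, TensorProduct.map_tmul, TensorProduct.comm_tmul, sw_sw, sw_pure]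
    simp only [S_SInv, LinearEquiv.coe_coe, LinearEquiv.apply_symm_apply, sw_self]

lemma Linked.sw_coact (h : Linked φ YL YR) (x : L) (F : H → R → M) [∀ b, Lin k (fun a => F a b)]
    [∀ a, Lin k (fun b => F a b)] :
    sw (YR.coact (anti φ x)) F = sw (YL.coact x) (fun a h => F (S k H h) (anti φ a)) := by
  rw [h.coact, sw_sw]
  simp only [sw_pure]

/-- Applying φ to x₀ (x₁ ▷ a) = a x reverses the products and gives (φ(a) ◁ S(x₁)) φ(x₀) = φ(x)
φ(a), which is the condition on R because λ(φ(x)) = S(x₁) ⊗ φ(x₀). -/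
lemma Linked.braidedCommutative_iff (h : Linked φ YL YR) :
    YL.BraidedCommutative ↔ YR.BraidedCommutative := by
  rw [YL.braidedCommutative_iff, YR.braidedCommutative_iff, (anti φ).surjective.forall]
  refine forall_congr' fun a => ?_
  rw [(anti φ).surjective.forall]
  refine forall_congr' fun x => ?_
  rw [h.sw_coact x (fun p c => YR.act (anti φ a) p * c), ← (anti φ).injective.eq_iff]
  simp only [equiv_sw, anti_mul, h.act]

variable (hS φ)

/-- `y ◁ f = φ(S⁻¹ f ▷ φ⁻¹(y))`, `λ(y) = S(φ⁻¹(y)₁) ⊗ φ(φ⁻¹(y)₀)`. -/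
noncomputable def LeftRightYD.toRightLeft (YL : LeftRightYD k H L) : RightLeftYD k H R where
  act := ((YL.act ∘ₗ SInv hS).flip ∘ₗ (anti φ).symm.toLinearMap).compr₂ (anti φ).toLinearMap
  act_one_right y := by simp [SInv_one, YL.one_act]
  act_mul_right y f g := by simp [SInv_mul, YL.mul_act]
  mul_act x y f := by
    conv_rhs => rw [← sw_self (δ f)]
    simp only [map_sw, TensorProduct.map_tmul, LinearMap.mul'_apply, LinearMap.compr₂_apply,
      LinearMap.comp_apply, LinearMap.flip_apply, LinearEquiv.coe_coe, anti_symm_mul,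
      YL.act_mul_sw, equiv_sw, anti_mul]
    exact sw_comul_SInv hS f (fun a b => anti φ (YL.act b ((anti φ).symm x)) *
      anti φ (YL.act a ((anti φ).symm y)))
  one_act f := by simp [anti_symm_one, YL.act_one, counit_SInv, anti_one]
  coact := (TensorProduct.comm k R H).toLinearMap ∘ₗ
    TensorProduct.map (anti φ).toLinearMap (S k H) ∘ₗ YL.coact ∘ₗ (anti φ).symm.toLinearMap
  coact_coassoc y := by
    obtain ⟨x, rfl⟩ := (anti φ).surjective y
    simp only [LinearMap.comp_apply, LinearEquiv.coe_coe, LinearEquiv.symm_apply_apply]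
    rw [← sw_self (YL.coact x)]
    simp only [map_sw, equiv_sw, TensorProduct.map_tmul, TensorProduct.comm_tmul,
      LinearMap.rTensor_tmul, LinearMap.lTensor_tmul, comul_antipode, sw_tmul,
      TensorProduct.assoc_tmul, LinearEquiv.coe_coe, LinearMap.comp_apply,
      LinearEquiv.symm_apply_apply]
    -- S reverses the comultiplication, which matches the passage from a right to a left coaction.
    rw [← YL.sw_coact_coassoc x (fun a p q => S k H q ⊗ₜ[k] (S k H p ⊗ₜ[k] anti φ a))]
    congr 1
    funext a h
    conv_rhs => rw [← sw_self (YL.coact a)]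
    simp only [map_sw, equiv_sw, TensorProduct.map_tmul, TensorProduct.comm_tmul, tmul_sw,
      LinearEquiv.coe_coe]
  coact_counit y := by
    obtain ⟨x, rfl⟩ := (anti φ).surjective y
    simp only [LinearMap.comp_apply, LinearEquiv.coe_coe, LinearEquiv.symm_apply_apply]
    rw [← sw_self (YL.coact x)]
    simp only [map_sw, equiv_sw, TensorProduct.map_tmul, TensorProduct.comm_tmul,
      LinearMap.rTensor_tmul, TensorProduct.lid_tmul, counit_S]
    exact YL.sw_coact_counit x (fun a => anti φ a)
  yetterDrinfeld y f := by
    obtain ⟨x, rfl⟩ := (anti φ).surjective y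
    -- With f = S(g) no S⁻¹ remains, and both sides are images of the condition for g and x under a
    -- ⊗ h ↦ S(h) ⊗ φ(a).
    obtain ⟨g, rfl⟩ := hS.2 f
    rw [comul_antipode]
    simp only [LinearMap.comp_apply, LinearEquiv.coe_coe, LinearEquiv.symm_apply_apply]
    conv_lhs => rw [← sw_self (YL.coact x)]
    simp only [map_sw, equiv_sw, sw_apply, TensorProduct.map_tmul, TensorProduct.comm_tmul,
      TensorProduct.map₂_apply_tmul, TensorProduct.lift.tmul, LinearMap.flip_apply,
      LinearMap.compl₂_apply, LinearMap.comp_apply, LinearMap.compr₂_apply, LinearEquiv.coe_coe,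
      LinearEquiv.symm_apply_apply, SInv_S, LinearMap.mul_apply', ← S_mul]
    have h := YL.sw_yetterDrinfeld g x (fun a h => S k H h ⊗ₜ[k] anti φ a)
    refine h.trans ?_
    congr 1
    funext p q
    conv_rhs => rw [← sw_self (YL.coact (YL.act q x))]
    simp only [map_sw, equiv_sw, TensorProduct.map_tmul, TensorProduct.comm_tmul,
      LinearEquiv.coe_coe, LinearMap.coe_rTensorHom, LinearMap.rTensor_tmul,
      LinearMap.mul_apply', S_mul]
  coact_mul y z := by
    obtain ⟨x, rfl⟩ := (anti φ).surjective y
    obtain ⟨w, rfl⟩ := (anti φ).surjective z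
    simp only [← anti_mul, LinearMap.comp_apply, LinearEquiv.coe_coe,
      LinearEquiv.symm_apply_apply]
    conv_lhs => rw [← sw_self (YL.coact (w * x))]
    conv_rhs => rw [← sw_self (YL.coact x), ← sw_self (YL.coact w)]
    simp only [map_sw, equiv_sw, sw_apply, TensorProduct.map_tmul, TensorProduct.comm_tmul,
      TensorProduct.map₂_apply_tmul, LinearMap.mul_apply', LinearMap.flip_apply,
      LinearEquiv.coe_coe]
    rw [YL.sw_coact_mul w x (fun a h => S k H h ⊗ₜ[k] anti φ a)]
    simp only [S_mul, anti_mul]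
  coact_one := by
    simp [anti_symm_one, YL.coact_one, anti_one]

lemma LeftRightYD.rightDetermined_toRightLeft (YL : LeftRightYD k H L) :
    RightDeterminedByLeft hS φ YL (YL.toRightLeft hS φ) :=
  ⟨fun _ _ => rfl, fun _ => rfl⟩

/-- `f ▷ x = φ⁻¹(φ(x) ◁ S f)`, `ρ(x) = φ⁻¹(φ(x)₀) ⊗ S⁻¹(φ(x)₋₁)`. -/
noncomputable def RightLeftYD.toLeftRight (YR : RightLeftYD k H R) : LeftRightYD k H L where
  act := ((YR.act ∘ₗ (anti φ).toLinearMap).flip ∘ₗ S k H).compr₂ (anti φ).symm.toLinearMap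
  one_act x := by simp [YR.act_one_right]
  mul_act f g x := by simp [S_mul, YR.act_mul_right]
  act_mul f x y := by
    conv_rhs => rw [← sw_self (δ f)]
    simp only [map_sw, TensorProduct.map_tmul, LinearMap.mul'_apply, LinearMap.compr₂_apply,
      LinearMap.comp_apply, LinearMap.flip_apply, LinearEquiv.coe_coe, anti_mul,
      YR.mul_act_sw, equiv_sw, anti_symm_mul]
    exact sw_comul_antipode f (fun a b => (anti φ).symm (YR.act (anti φ x) b) *
      (anti φ).symm (YR.act (anti φ y) a))
  act_one f := by simp [anti_one, YR.one_act, counit_S, anti_symm_one]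
  coact := (TensorProduct.comm k H L).toLinearMap ∘ₗ
    TensorProduct.map (SInv hS) (anti φ).symm.toLinearMap ∘ₗ YR.coact ∘ₗ (anti φ).toLinearMap
  coact_coassoc x := by
    simp only [LinearMap.comp_apply, LinearEquiv.coe_coe]
    rw [← sw_self (YR.coact (anti φ x))]
    simp only [map_sw, equiv_sw, TensorProduct.map_tmul, TensorProduct.comm_tmul,
      LinearMap.rTensor_tmul, LinearMap.lTensor_tmul, comul_SInv, tmul_sw,
      LinearEquiv.coe_coe, LinearMap.comp_apply, LinearEquiv.apply_symm_apply]
    rw [YR.sw_coact_coassoc (anti φ x)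
      (fun p q a => (anti φ).symm a ⊗ₜ[k] (SInv hS q ⊗ₜ[k] SInv hS p))]
    congr 1
    funext h a
    conv_lhs => rw [← sw_self (YR.coact a)]
    simp only [map_sw, equiv_sw, TensorProduct.map_tmul, TensorProduct.comm_tmul, sw_tmul,
      LinearEquiv.coe_coe, TensorProduct.assoc_tmul]
  coact_counit x := by
    simp only [LinearMap.comp_apply, LinearEquiv.coe_coe]
    rw [← sw_self (YR.coact (anti φ x))]
    simp only [map_sw, equiv_sw, TensorProduct.map_tmul, TensorProduct.comm_tmul,
      LinearMap.lTensor_tmul, TensorProduct.rid_tmul, counit_SInv]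
    rw [← (anti φ).injective.eq_iff, equiv_sw]
    simp only [map_smul, LinearEquiv.coe_coe, LinearEquiv.apply_symm_apply]
    exact YR.sw_coact_counit (anti φ x) (fun a => a)
  yetterDrinfeld f x := by
    -- The condition on R is used at S(f), because f acts on L through S(f), and is carried over by
    -- φ⁻¹ and S⁻¹.
    have h := YR.sw_yetterDrinfeld (anti φ x) (S k H f)
      (fun a h => (anti φ).symm h ⊗ₜ[k] SInv hS a)
    rw [sw_comul_antipode f (fun p q => sw (YR.coact (YR.act (anti φ x) p))
      (fun h a => (anti φ).symm a ⊗ₜ[k] SInv hS (q * h)))] at h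
    have h2 : ∀ (g : H) (a : R), sw (δ (S k H f)) (fun p q =>
        (anti φ).symm (YR.act a q) ⊗ₜ[k] SInv hS (g * p)) = sw (δ f) (fun p q =>
        (anti φ).symm (YR.act a (S k H p)) ⊗ₜ[k] SInv hS (g * S k H q)) := fun g a =>
      sw_comul_antipode f (fun p q => (anti φ).symm (YR.act a q) ⊗ₜ[k] SInv hS (g * p))
    simp only [h2] at h
    simp only [SInv_mul, SInv_S] at h
    simp only [LinearMap.comp_apply, LinearEquiv.coe_coe]
    conv_lhs => rw [← sw_self (YR.coact (anti φ x)), ← sw_self (δ f)]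
    conv_rhs => rw [← sw_self (δ f)]
    simp only [map_sw, equiv_sw, sw_apply, TensorProduct.map_tmul, TensorProduct.comm_tmul,
      TensorProduct.map₂_apply_tmul, TensorProduct.lift.tmul, LinearMap.flip_apply,
      LinearMap.compl₂_apply, LinearMap.comp_apply, LinearMap.compr₂_apply, LinearEquiv.coe_coe,
      LinearEquiv.apply_symm_apply, LinearMap.mul_apply']
    refine h.trans ?_
    congr 1
    funext p q
    conv_rhs => rw [← sw_self (YR.coact (YR.act (anti φ x) (S k H q)))]
    simp only [map_sw, equiv_sw, TensorProduct.map_tmul, TensorProduct.comm_tmul,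
      LinearEquiv.coe_coe, LinearMap.coe_lTensorHom, LinearMap.lTensor_tmul, LinearMap.flip_apply,
      LinearMap.mul_apply']
  coact_mul x y := by
    simp only [LinearMap.comp_apply, LinearEquiv.coe_coe, anti_mul]
    conv_lhs => rw [← sw_self (YR.coact _)]
    conv_rhs => rw [← sw_self (YR.coact (anti φ x)), ← sw_self (YR.coact (anti φ y))]
    simp only [map_sw, equiv_sw, sw_apply, TensorProduct.map_tmul, TensorProduct.comm_tmul,
      TensorProduct.map₂_apply_tmul, LinearMap.mul_apply', LinearMap.flip_apply,
      LinearEquiv.coe_coe]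
    rw [YR.sw_coact_mul _ _ (fun h a => (anti φ).symm a ⊗ₜ[k] SInv hS h)]
    simp only [SInv_mul, anti_symm_mul]
  coact_one := by
    simp [anti_one, YR.coact_one, anti_symm_one, SInv_one]

lemma RightLeftYD.leftDetermined_toLeftRight (YR : RightLeftYD k H R) :
    LeftDeterminedByRight hS φ YR (YR.toLeftRight hS φ) :=
  ⟨fun _ _ => rfl, fun _ => rfl⟩

end Correspondence

/-! ### Algebras generated by `L`, `R` and `H` -/

section SweedlerSubmodule

variable {k A B M : Type*} [Field k] [AddCommGroup A] [Module k A] [AddCommGroup B] [Module k B]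
  [AddCommGroup M] [Module k M]

lemma sw_mem {p : Submodule k M} (t : A ⊗[k] B) {F : A → B → M} (h : ∀ a b, F a b ∈ p) :
    sw t F ∈ p := Submodule.sum_mem _ fun _ _ => h _ _

end SweedlerSubmodule

section ScalarExtensionAlgebras

variable {k H L R K M : Type*} [Field k] [AddCommGroup M] [Module k M] [Ring L] [Algebra k L]
  [Ring R] [Algebra k R] [Ring H] [HopfAlgebra k H] [Ring K] [Algebra k K]

local notation "δ" => Coalgebra.comul (R := k)
local notation "ε" => Coalgebra.counit (R := k)

namespace LeftRightYD

variable (YL : LeftRightYD k H L)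

/-- `x ↦ x₀ x₁` for given images of `L` and `H` in `K`. -/
noncomputable def targetMap (ι : H →ₗ[k] K) (α : L →ₗ[k] K) : L →ₗ[k] K :=
  lin₂ (fun a h => α a * ι h) ∘ₗ YL.coact

lemma targetMap_apply (ι : H →ₗ[k] K) (α : L →ₗ[k] K) (x : L) :
    YL.targetMap ι α x = sw (YL.coact x) (fun a h => α a * ι h) :=
  (sw_eq_lin₂ _ _).symm

/-- `x ↦ S²(x₁) ▷ x₀` -/
noncomputable def twist : L →ₗ[k] L :=
  lin₂ (fun a h => YL.act (S k H (S k H h)) a) ∘ₗ YL.coact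

lemma twist_apply (x : L) :
    YL.twist x = sw (YL.coact x) (fun a h => YL.act (S k H (S k H h)) a) :=
  (sw_eq_lin₂ _ _).symm

/-- `x ↦ S⁻¹(x₁) ▷ x₀` -/
noncomputable def untwist (hS : Function.Bijective (S k H)) : L →ₗ[k] L :=
  lin₂ (fun a h => YL.act (SInv hS h) a) ∘ₗ YL.coact

lemma untwist_apply (hS : Function.Bijective (S k H)) (x : L) :
    YL.untwist hS x = sw (YL.coact x) (fun a h => YL.act (SInv hS h) a) :=
  (sw_eq_lin₂ _ _).symm

variable {YL}

lemma BraidedCommutative.sw_mul_act (hb : YL.BraidedCommutative) (a x : L) (F : L → M) [Lin k F] :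
    sw (YL.coact x) (fun c h => F (c * YL.act h a)) = F (a * x) := by
  obtain ⟨T, rfl⟩ := exists_lin (k := k) F
  simp only [← YL.braidedCommutative_iff.1 hb a x, map_sw]

/-- `(S(y₁) ▷ a) y₀ = y a` -/
lemma BraidedCommutative.sw_act_mul (hb : YL.BraidedCommutative) (a y : L) (F : L → M) [Lin k F] :
    sw (YL.coact y) (fun c h => F (YL.act (S k H h) a * c)) = F (y * a) := by
  obtain ⟨T, rfl⟩ := exists_lin (k := k) F
  -- Braided commutativity for c brings c to the left at the cost of acting by c₁; by
  -- coassociativity this meets S(h) in the form h₁ S(h₂).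
  have h1 : ∀ (c : L) (h : H), T (YL.act (S k H h) a * c) =
      sw (YL.coact c) (fun d g => T (d * YL.act (g * S k H h) a)) := fun c h => by
    simp only [YL.mul_act]
    exact (hb.sw_mul_act _ _ (fun u => T u)).symm
  simp only [h1]
  rw [YL.sw_coact_coassoc y (fun d g h => T (d * YL.act (g * S k H h) a))]
  have h2 : ∀ (d : L) (h : H), sw (δ h) (fun g q => T (d * YL.act (g * S k H q) a)) =
      ε h • T (d * YL.act 1 a) := fun d h => sw_mul_antipode h (fun u => T (d * YL.act u a))
  simp only [h2, YL.one_act]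
  exact YL.sw_coact_counit y (fun d => T (d * a))

end LeftRightYD

/-- An algebra `K` with compatible images `ι`, `α`, `γ` of `H`, `L` and `R`, such that
`K = α(L) ι(H)`, `f x = (f₁ ▷ x) f₂`, `x = S(x₁) φ(x₀)` and `φ(x) = S²(x₁) x₀`. Both smash products
`L ♯ H` and `H ♯ R` are of this kind. -/
structure IsScalarExt (φ : L ≃ₐ[k] Rᵐᵒᵖ) (YL : LeftRightYD k H L) (ι : H →ₗ[k] K)
    (α : L →ₗ[k] K) (γ : R →ₗ[k] K) : Prop where
  hopf_one : ι 1 = 1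
  hopf_mul : ∀ f g, ι (f * g) = ι f * ι g
  left_one : α 1 = 1
  left_mul : ∀ x y, α (x * y) = α x * α y
  right_one : γ 1 = 1
  right_mul : ∀ x y, γ (x * y) = γ x * γ y
  hopf_left : ∀ f x, ι f * α x = sw (δ f) (fun p q => α (YL.act p x) * ι q)
  right_hopf : ∀ x f, γ (anti φ x) * ι (S k H f) =
    sw (δ f) (fun p q => ι (S k H q) * γ (anti φ (YL.act p x)))
  left_eq : ∀ x, α x = sw (YL.coact x) (fun a h => ι (S k H h) * γ (anti φ a))
  right_eq : ∀ x, γ (anti φ x) = sw (YL.coact x) (fun a h => ι (S k H (S k H h)) * α a)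
  span_left : ∀ z, ∃ t : L ⊗[k] H, sw t (fun x f => α x * ι f) = z

namespace IsScalarExt

section General

variable {φ : L ≃ₐ[k] Rᵐᵒᵖ} {YL : LeftRightYD k H L} {ι : H →ₗ[k] K} {α : L →ₗ[k] K}
  {γ : R →ₗ[k] K}

/-- `x S(f) = S(f₁) (f₂ ▷ x)` -/
lemma left_antipode_of (hopf_one : ι 1 = 1) (hopf_mul : ∀ f g, ι (f * g) = ι f * ι g)
    (hopf_left : ∀ f x, ι f * α x = sw (δ f) (fun p q => α (YL.act p x) * ι q)) (x : L) (f : H) :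
    α x * ι (S k H f) = sw (δ f) (fun p q => ι (S k H p) * α (YL.act q x)) := by
  -- Only three relations are assumed, since the lemma is also needed while `IsScalarExt` is being
  -- established for L ♯ H. The proof replaces f₂ ▷ x by f₂ x S(f₃), after which S(f₁) f₂ cancels.
  symm
  have h1 : ∀ a b : H, ι (S k H a) * α (YL.act b x) =
      sw (δ b) (fun p q => ι (S k H a) * ((ι p * α x) * ι (S k H q))) := by
    intro a b
    conv_rhs => simp only [hopf_left, sw_mul, mul_sw]
    rw [sw_coassoc b (fun u v q => ι (S k H a) * (α (YL.act u x) * ι v * ι (S k H q)))]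
    simp only [mul_assoc, ← hopf_mul]
    have h2 : ∀ u w : H, sw (δ w) (fun v q => ι (S k H a) * (α (YL.act u x) * ι (v * S k H q))) =
        ε w • (ι (S k H a) * (α (YL.act u x) * ι 1)) := fun u w =>
      sw_mul_antipode w (fun z => ι (S k H a) * (α (YL.act u x) * ι z))
    simp only [h2, hopf_one, mul_one]
    exact (sw_counit_right (k := k) b (fun u => ι (S k H a) * α (YL.act u x))).symm
  simp only [h1]
  simp only [← mul_assoc, ← hopf_mul]
  rw [sw_antipode_mul_left f (fun u q => ι u * α x * ι (S k H q)), hopf_one, one_mul]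

end General

variable {φ : L ≃ₐ[k] Rᵐᵒᵖ} {YL : LeftRightYD k H L} {ι : H →ₗ[k] K} {α : L →ₗ[k] K}
  {γ : R →ₗ[k] K} (C : IsScalarExt φ YL ι α γ)

include C

lemma left_antipode (x : L) (f : H) :
    α x * ι (S k H f) = sw (δ f) (fun p q => ι (S k H p) * α (YL.act q x)) :=
  left_antipode_of C.hopf_one C.hopf_mul C.hopf_left x f

lemma ext_left {T U : K →ₗ[k] M} (h : ∀ x f, T (α x * ι f) = U (α x * ι f)) (z : K) :
    T z = U z := by
  obtain ⟨t, rfl⟩ := C.span_left z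
  simp only [map_sw, h]

/-- Writing f = S(g), one has x S(g) = S(g₁) (g₂ ▷ x), and an element of L expands as S(a₁) φ(a₀);
the two factors from H then multiply together. -/
lemma span_right (hS : Function.Bijective (S k H)) (z : K) :
    ∃ t : H ⊗[k] R, sw t (fun f y => ι f * γ y) = z := by
  suffices h : z ∈ LinearMap.range (lin₂ (k := k) (fun (f : H) (y : R) => ι f * γ y)) by
    obtain ⟨t, rfl⟩ := h
    exact ⟨t, sw_eq_lin₂ _ _⟩
  obtain ⟨t, rfl⟩ := C.span_left z
  refine sw_mem _ fun x f => ?_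
  obtain ⟨g, rfl⟩ := hS.2 f
  rw [C.left_antipode]
  refine sw_mem _ fun p q => ?_
  rw [C.left_eq, mul_sw]
  refine sw_mem _ fun a h => ?_
  rw [← mul_assoc, ← C.hopf_mul]
  exact ⟨_ ⊗ₜ _, lin₂_tmul _ _ _⟩

lemma ext_right (hS : Function.Bijective (S k H)) {T U : K →ₗ[k] M}
    (h : ∀ f y, T (ι f * γ y) = U (ι f * γ y)) (z : K) : T z = U z := by
  obtain ⟨t, rfl⟩ := C.span_right hS z
  simp only [map_sw, h]

lemma target_one : YL.targetMap ι α 1 = 1 := by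
  rw [YL.targetMap_apply, YL.sw_coact_one (fun a h => α a * ι h), C.left_one, C.hopf_one, one_mul]

/-- `f β(x) = β(f₂ ▷ x) f₁` -/
lemma hopf_target (f : H) (x : L) :
    ι f * YL.targetMap ι α x = sw (δ f) (fun p q => YL.targetMap ι α (YL.act q x) * ι p) := by
  simp only [YL.targetMap_apply, mul_sw, sw_mul, ← mul_assoc, C.hopf_left]
  simp only [mul_assoc, ← C.hopf_mul]
  -- What remains is the Yetter-Drinfeld condition, read in K after multiplying the two tensor
  -- factors.
  rw [sw_comm]
  exact YL.sw_yetterDrinfeld f x (fun a h => α a * ι h)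

/-- `S(f₁) β(x) f₂ = β(S(f) ▷ x)` -/
lemma antipode_target_hopf (f : H) (x : L) :
    sw (δ f) (fun p q => ι (S k H p) * (YL.targetMap ι α x * ι q)) =
      YL.targetMap ι α (YL.act (S k H f) x) := by
  -- S(p) is moved to the right past β(x) with `hopf_target`; its remaining leg then meets q and
  -- cancels.
  have h1 : ∀ p q : H, ι (S k H p) * (YL.targetMap ι α x * ι q) = sw (δ p) (fun u v =>
      YL.targetMap ι α (YL.act (S k H u) x) * ι (S k H v * q)) := by
    intro p q
    rw [← mul_assoc, C.hopf_target,
      sw_comul_antipode p (fun p q => YL.targetMap ι α (YL.act q x) * ι p), sw_mul]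
    simp only [mul_assoc, C.hopf_mul]
  simp only [h1]
  rw [sw_coassoc f (fun u v q => YL.targetMap ι α (YL.act (S k H u) x) * ι (S k H v * q)),
    sw_antipode_mul_right f (fun u w => YL.targetMap ι α (YL.act (S k H u) x) * ι w),
    C.hopf_one, mul_one]

/-- `φ(x) = β(S²(x₁) ▷ x₀)` -/
lemma right_eq_target (x : L) : γ (anti φ x) = YL.targetMap ι α (YL.twist x) := by
  rw [C.right_eq, YL.twist_apply, map_sw]
  -- `antipode_target_hopf` at S(h) gives S²(h₂) β(a) S(h₁). Expanding β(a) = a₀ a₁ puts a₁ next to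
  -- S(h₁), and coassociativity of the coaction makes this pair cancel.
  have h1 : ∀ (a : L) (h : H), YL.targetMap ι α (YL.act (S k H (S k H h)) a) =
      sw (YL.coact a) (fun b g => sw (δ h) (fun p q =>
        ι (S k H (S k H q)) * (α b * ι (g * S k H p)))) := by
    intro a h
    rw [← C.antipode_target_hopf,
      sw_comul_antipode h (fun p q => ι (S k H p) * (YL.targetMap ι α a * ι q))]
    simp only [YL.targetMap_apply, mul_sw, sw_mul, mul_assoc, C.hopf_mul]
    exact sw_comm _ _ _
  simp only [h1]
  rw [YL.sw_coact_coassoc x (fun b g h => sw (δ h) (fun p q =>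
    ι (S k H (S k H q)) * (α b * ι (g * S k H p))))]
  have h2 : ∀ (b : L) (w : H), sw (δ w) (fun g h => sw (δ h) (fun p q =>
      ι (S k H (S k H q)) * (α b * ι (g * S k H p)))) = ι (S k H (S k H w)) * (α b * ι 1) :=
    fun b w => sw_mul_antipode_left w (fun u q => ι (S k H (S k H q)) * (α b * ι u))
  simp only [h2, C.hopf_one, mul_one]

/-- `S(f₁) φ(x) f₂ = φ(S⁻¹(f) ▷ x)` -/
lemma antipode_right_hopf (hS : Function.Bijective (S k H)) (f : H) (x : L) :
    sw (δ f) (fun p q => ι (S k H p) * (γ (anti φ x) * ι q)) =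
      γ (anti φ (YL.act (SInv hS f) x)) := by
  obtain ⟨g, rfl⟩ := hS.2 f
  rw [SInv_S, sw_comul_antipode g (fun p q => ι (S k H p) * (γ (anti φ x) * ι q))]
  simp only [C.right_hopf, mul_sw]
  rw [sw_coassoc g (fun u v q => ι (S k H (S k H q)) * (ι (S k H v) * γ (anti φ (YL.act u x))))]
  simp only [← mul_assoc, ← C.hopf_mul, ← S_mul]
  rw [sw_mul_antipode_right g (fun u w => ι (S k H w) * γ (anti φ (YL.act u x))), S_one,
    C.hopf_one, one_mul]

/-- `β(x) = φ(S⁻¹(x₁) ▷ x₀)` -/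
lemma target_eq_right (hS : Function.Bijective (S k H)) (x : L) :
    YL.targetMap ι α x = γ (anti φ (YL.untwist hS x)) := by
  rw [YL.targetMap_apply, YL.untwist_apply, equiv_sw, map_sw]
  -- By `antipode_right_hopf` the left side is S(h₁) φ(a) h₂ with φ(a) = S²(a₁) a₀, so the factor
  -- S(S(a₁) h₁) appears in front and collapses.
  have h1 : ∀ (a : L) (h : H), γ (anti φ (YL.act (SInv hS h) a)) =
      sw (YL.coact a) (fun b g => sw (δ h) (fun p q => ι (S k H (S k H g * p)) * (α b * ι q))) := by
    intro a h
    rw [← C.antipode_right_hopf hS]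
    simp only [C.right_eq, mul_sw, sw_mul, mul_assoc, C.hopf_mul, S_mul]
    exact sw_comm _ _ _
  simp only [h1]
  rw [YL.sw_coact_coassoc x (fun b g h => sw (δ h) (fun p q =>
    ι (S k H (S k H g * p)) * (α b * ι q)))]
  have h2 : ∀ (b : L) (w : H), sw (δ w) (fun g h => sw (δ h) (fun p q =>
      ι (S k H (S k H g * p)) * (α b * ι q))) = ι (S k H 1) * (α b * ι w) :=
    fun b w => sw_antipode_mul_left w (fun u q => ι (S k H u) * (α b * ι q))
  simp only [h2, S_one, C.hopf_one, one_mul]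

section Braided

variable (hb : YL.BraidedCommutative)

include hb

/-- One has y₀ y₁ x = y₀ (y₁ ▷ x) y₂, and y₀ (y₁ ▷ x) = x y₀ is braided commutativity. -/
lemma target_left_comm (x y : L) : YL.targetMap ι α y * α x = α x * YL.targetMap ι α y := by
  simp only [YL.targetMap_apply, mul_sw, sw_mul, mul_assoc, C.hopf_left]
  rw [← YL.sw_coact_coassoc y (fun b p q => α b * (α (YL.act p x) * ι q))]
  simp only [← mul_assoc, ← C.left_mul]
  have h : ∀ (a : L) (h : H), sw (YL.coact a) (fun b g => α (b * YL.act g x) * ι h) =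
    α (x * a) * ι h := fun a h => hb.sw_mul_act x a (fun u => α u * ι h)
  simp only [h]

/-- β(y) x₀ x₁ = x₀ β(y) x₁ = x₀ y₀ y₁ x₁, and the last order is that of the coaction on a product,
which reverses the factors in H. -/
lemma target_mul (x y : L) :
    YL.targetMap ι α (x * y) = YL.targetMap ι α y * YL.targetMap ι α x := by
  conv_rhs => rw [YL.targetMap_apply _ _ x, mul_sw]
  simp only [← mul_assoc, C.target_left_comm hb]
  simp only [YL.targetMap_apply, mul_sw, sw_mul]
  rw [YL.sw_coact_mul x y (fun a h => α a * ι h)]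
  simp only [C.left_mul, C.hopf_mul, mul_assoc]

end Braided

end IsScalarExt

/-- `φ(x)` commutes with `L`, where `φ(x) = S²(x₁) x₀`. -/
lemma sw_right_left_comm {YL : LeftRightYD k H L} {ι : H →ₗ[k] K} {α : L →ₗ[k] K}
    (left_mul : ∀ x y, α (x * y) = α x * α y)
    (left_antipode : ∀ x f, α x * ι (S k H f) =
      sw (δ f) (fun p q => ι (S k H p) * α (YL.act q x)))
    (hb : YL.BraidedCommutative) (a x : L) :
    α a * sw (YL.coact x) (fun b g => ι (S k H (S k H g)) * α b) =
      sw (YL.coact x) (fun b g => ι (S k H (S k H g)) * α b) * α a := by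
  -- Passing S²(g) turns a into S(g₁) ▷ a, which is exactly the form needed for `sw_act_mul`. The
  -- lemma makes no mention of γ because it enters the proof that γ is multiplicative on L ♯ H.
  have h1 : ∀ g : H, α a * ι (S k H (S k H g)) = sw (δ g) (fun p q =>
      ι (S k H (S k H q)) * α (YL.act (S k H p) a)) := fun g => by
    rw [left_antipode, sw_comul_antipode g (fun p q => ι (S k H p) * α (YL.act q a))]
  simp only [mul_sw, ← mul_assoc, h1, sw_mul]
  rw [← YL.sw_coact_coassoc x (fun b p q => ι (S k H (S k H q)) * α (YL.act (S k H p) a) * α b)]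
  simp only [mul_assoc, ← left_mul]
  have h : ∀ (c : L) (h : H), sw (YL.coact c) (fun b g =>
      ι (S k H (S k H h)) * α (YL.act (S k H g) a * b)) = ι (S k H (S k H h)) * α (c * a) :=
    fun c h => hb.sw_act_mul a c (fun u => ι (S k H (S k H h)) * α u)
  simp only [h]

lemma IsScalarExt.left_right_comm {φ : L ≃ₐ[k] Rᵐᵒᵖ} {YL : LeftRightYD k H L} {ι : H →ₗ[k] K}
    {α : L →ₗ[k] K} {γ : R →ₗ[k] K} (C : IsScalarExt φ YL ι α γ) (hb : YL.BraidedCommutative)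
    (a x : L) : α a * γ (anti φ x) = γ (anti φ x) * α a := by
  rw [C.right_eq]
  exact sw_right_left_comm C.left_mul C.left_antipode hb a x

end ScalarExtensionAlgebras

/-! ### Comultiplications on balanced tensor squares -/

section BalancedLemmas

variable {k K A B : Type*} [Field k] [Ring K] [Algebra k K] [AddCommGroup A] [Module k A]
  [AddCommGroup B] [Module k B]

lemma balRel_le_ker {M : Type*} [AddCommGroup M] [Module k M] {r l : A →ₗ[k] Module.End k K}
    {T : K ⊗[k] K →ₗ[k] M} (h : ∀ a x y, T (r a x ⊗ₜ y) = T (x ⊗ₜ l a y)) :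
    balRel r l ≤ LinearMap.ker T := by
  refine Submodule.span_le.2 ?_
  rintro _ ⟨a, x, y, rfl⟩
  rw [SetLike.mem_coe, LinearMap.mem_ker, map_sub, sub_eq_zero, h]

lemma balRel_le_comap {K' A' : Type*} [Ring K'] [Algebra k K'] [AddCommGroup A'] [Module k A']
    {r l : A →ₗ[k] Module.End k K} {r' l' : A' →ₗ[k] Module.End k K'}
    {T : K ⊗[k] K →ₗ[k] K' ⊗[k] K'}
    (h : ∀ a x y, (balRel r' l').mkQ (T (r a x ⊗ₜ y)) = (balRel r' l').mkQ (T (x ⊗ₜ l a y))) :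
    balRel r l ≤ (balRel r' l').comap T := by
  have := balRel_le_ker (r := r) (l := l) (T := (balRel r' l').mkQ ∘ₗ T) h
  rwa [LinearMap.ker_comp, Submodule.ker_mkQ] at this

lemma mkQ_balRel (r l : A →ₗ[k] Module.End k K) (a : A) (x y : K) :
    (balRel r l).mkQ (r a x ⊗ₜ y) = (balRel r l).mkQ (x ⊗ₜ l a y) := by
  rw [← sub_eq_zero, ← map_sub, Submodule.mkQ_apply, Submodule.Quotient.mk_eq_zero]
  exact Submodule.subset_span ⟨a, x, y, rfl⟩

variable (r l : A →ₗ[k] Module.End k K) (r' l' : B →ₗ[k] Module.End k K)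

lemma mkQ_balRel₃_left (a : A) (x y z : K) :
    (balRel₃ r l r' l').mkQ (r a x ⊗ₜ (y ⊗ₜ z)) =
      (balRel₃ r l r' l').mkQ (x ⊗ₜ (l a y ⊗ₜ z)) := by
  rw [← sub_eq_zero, ← map_sub, Submodule.mkQ_apply, Submodule.Quotient.mk_eq_zero]
  exact Submodule.subset_span (Or.inl ⟨a, x, y, z, rfl⟩)

lemma mkQ_balRel₃_right (b : B) (x y z : K) :
    (balRel₃ r l r' l').mkQ (x ⊗ₜ (r' b y ⊗ₜ z)) =
      (balRel₃ r l r' l').mkQ (x ⊗ₜ (y ⊗ₜ l' b z)) := by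
  rw [← sub_eq_zero, ← map_sub, Submodule.mkQ_apply, Submodule.Quotient.mk_eq_zero]
  exact Submodule.subset_span (Or.inr ⟨b, x, y, z, rfl⟩)

lemma appendRight_mkQ (x y z : K) :
    appendRight r l r' l' ((balRel r l).mkQ (x ⊗ₜ y)) z =
      (balRel₃ r l r' l').mkQ (x ⊗ₜ (y ⊗ₜ z)) := rfl

lemma appendLeft_mkQ (x y z : K) :
    appendLeft r l r' l' ((balRel r' l').mkQ (y ⊗ₜ z)) x =
      (balRel₃ r l r' l').mkQ (x ⊗ₜ (y ⊗ₜ z)) := rfl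

lemma liftQ_mkQ_apply {M : Type*} [AddCommGroup M] [Module k M] (p : Submodule k (K ⊗[k] K))
    (T : K ⊗[k] K →ₗ[k] M) (h : p ≤ LinearMap.ker T) (t : K ⊗[k] K) :
    p.liftQ T h (p.mkQ t) = T t := rfl

lemma tensorId_tmul (D : K →ₗ[k] BalTensor r l) (x z : K) :
    tensorId D r' l' (x ⊗ₜ z) = appendRight r l r' l' (D x) z := rfl

lemma idTensor_tmul (D : K →ₗ[k] BalTensor r' l') (x z : K) :
    idTensor r l D (x ⊗ₜ z) = appendLeft r l r' l' (D z) x := rfl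

end BalancedLemmas

/-! ### Maps from K to a balanced tensor square that are induced by the comultiplication of H. -/

section ExtComul

variable {k H L R K A B M : Type*} [Field k] [AddCommGroup M] [Module k M] [Ring L] [Algebra k L]
  [Ring R] [Algebra k R] [Ring H] [HopfAlgebra k H] [Ring K] [Algebra k K]
  [AddCommGroup A] [Module k A] [AddCommGroup B] [Module k B]

local notation "δ" => Coalgebra.comul (R := k)
local notation "ε" => Coalgebra.counit (R := k)

/-- A map `D : K → K ⊗_A K` with `D(x f) = x f₁ ⊗ f₂` and `D(f y) = f₁ ⊗ f₂ y` for `x ∈ L`,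
`f ∈ H`, `y ∈ R`. -/
structure IsExtComul (ι : H →ₗ[k] K) (α : L →ₗ[k] K) (γ : R →ₗ[k] K)
    {r l : A →ₗ[k] Module.End k K} (D : K →ₗ[k] BalTensor r l) : Prop where
  left : ∀ x f, D (α x * ι f) = sw (δ f) (fun p q => (balRel r l).mkQ ((α x * ι p) ⊗ₜ ι q))
  right : ∀ f y, D (ι f * γ y) = sw (δ f) (fun p q => (balRel r l).mkQ (ι p ⊗ₜ (ι q * γ y)))

variable {φ : L ≃ₐ[k] Rᵐᵒᵖ} {YL : LeftRightYD k H L} {ι : H →ₗ[k] K} {α : L →ₗ[k] K}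
  {γ : R →ₗ[k] K} (C : IsScalarExt φ YL ι α γ)
  {r l : A →ₗ[k] Module.End k K} {r' l' : B →ₗ[k] Module.End k K}
  {D : K →ₗ[k] BalTensor r l} {D' : K →ₗ[k] BalTensor r' l'}

namespace IsExtComul

include C

/-- `D` commutes with the multiplications by elements of `L` on the first factor. -/
lemma exists_lift_left (hD : IsExtComul ι α γ D) (z : K) : ∃ t : K ⊗[k] K,
    D z = sw t (fun u v => (balRel r l).mkQ (u ⊗ₜ v)) ∧
    (∀ x, D (α x * z) = sw t (fun u v => (balRel r l).mkQ ((α x * u) ⊗ₜ v))) ∧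
    ∀ x, D (z * α x) = sw t (fun u v => (balRel r l).mkQ ((u * α x) ⊗ₜ v)) := by
  obtain ⟨t, rfl⟩ := C.span_left z
  -- The same representative in K ⊗ K serves all three formulas, so nothing has to be known about
  -- multiplication on one factor being well defined on the balanced quotient.
  refine ⟨sw t (fun x f => sw (δ f) (fun p q => (α x * ι p) ⊗ₜ ι q)), ?_, fun x => ?_,
    fun x => ?_⟩
  · simp only [map_sw, hD.left, sw_sw, sw_pure]
  · simp only [map_sw, mul_sw, ← mul_assoc, ← C.left_mul, hD.left, sw_sw, sw_pure]
  · have h1 : ∀ (a : L) (f : H), D (α a * ι f * α x) = sw (δ f) (fun p q =>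
        (balRel r l).mkQ ((α a * ι p * α x) ⊗ₜ ι q)) := by
      intro a f
      simp only [mul_assoc, C.hopf_left, mul_sw, map_sw, sw_tmul]
      simp only [← mul_assoc, ← C.left_mul, hD.left]
      exact (sw_coassoc f (fun p u v =>
        (balRel r l).mkQ ((α (a * YL.act p x) * ι u) ⊗ₜ ι v))).symm
    simp only [map_sw, sw_mul, h1, sw_sw, sw_pure]

/-- `D` commutes with the multiplications by elements of `R` on the second factor. -/
lemma exists_lift_right (hS : Function.Bijective (S k H)) (hD : IsExtComul ι α γ D) (z : K) :
    ∃ t : K ⊗[k] K, D z = sw t (fun u v => (balRel r l).mkQ (u ⊗ₜ v)) ∧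
    (∀ y, D (γ y * z) = sw t (fun u v => (balRel r l).mkQ (u ⊗ₜ (γ y * v)))) ∧
    ∀ y, D (z * γ y) = sw t (fun u v => (balRel r l).mkQ (u ⊗ₜ (v * γ y))) := by
  obtain ⟨t, rfl⟩ := C.span_right hS z
  refine ⟨sw t (fun f y => sw (δ f) (fun p q => ι p ⊗ₜ (ι q * γ y))), ?_, fun y => ?_,
    fun y => ?_⟩
  · simp only [map_sw, hD.right, sw_sw, sw_pure]
  · obtain ⟨x, rfl⟩ := (anti φ).surjective y
    have h1 : ∀ (f : H) (y : R), D (γ (anti φ x) * (ι f * γ y)) = sw (δ f) (fun p q =>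
        (balRel r l).mkQ (ι p ⊗ₜ (γ (anti φ x) * (ι q * γ y)))) := by
      intro f y
      obtain ⟨g, rfl⟩ := hS.2 f
      rw [sw_comul_antipode g (fun p q =>
        (balRel r l).mkQ (ι p ⊗ₜ (γ (anti φ x) * (ι q * γ y))))]
      simp only [← mul_assoc, C.right_hopf, sw_mul, map_sw, tmul_sw]
      simp only [mul_assoc, ← C.right_mul, hD.right]
      rw [sw_coassoc g (fun u v q =>
        (balRel r l).mkQ (ι (S k H q) ⊗ₜ (ι (S k H v) * γ (anti φ (YL.act u x) * y))))]
      congr 1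
      funext p q
      exact sw_comul_antipode q (fun u v =>
        (balRel r l).mkQ (ι u ⊗ₜ (ι v * γ (anti φ (YL.act p x) * y))))
    simp only [map_sw, mul_sw, h1, sw_sw, sw_pure]
  · simp only [map_sw, sw_mul, mul_assoc, ← C.right_mul, hD.right, sw_sw, sw_pure]

lemma map_one (hD : IsExtComul ι α γ D) : D 1 = (balRel r l).mkQ (1 ⊗ₜ 1) := by
  have h := hD.left 1 1
  rwa [sw_comul_one (fun p q => (balRel r l).mkQ ((α 1 * ι p) ⊗ₜ ι q)), C.hopf_one, C.left_one,
    one_mul] at h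

/-- On x f both sides are the class of x f₁ ⊗ f₂ ⊗ f₃. The two balancings are arbitrary, so this
covers the ordinary and the mixed laws at once. -/
lemma coassoc (hD : IsExtComul ι α γ D) (hD' : IsExtComul ι α γ D')
    (h : balRel r' l' ≤ LinearMap.ker (tensorId D r' l'))
    (h' : balRel r l ≤ LinearMap.ker (idTensor r l D')) (z : K) :
    (balRel r' l').liftQ _ h (D' z) = (balRel r l).liftQ _ h' (D z) := by
  refine C.ext_left (T := (balRel r' l').liftQ _ h ∘ₗ D') (U := (balRel r l).liftQ _ h' ∘ₗ D)
    (fun x f => ?_) z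
  have h1 : ∀ f, D' (ι f) = sw (δ f) (fun p q => (balRel r' l').mkQ (ι p ⊗ₜ ι q)) := fun f => by
    simpa only [C.left_one, one_mul] using hD'.left 1 f
  simp only [LinearMap.comp_apply, hD.left, hD'.left, map_sw, liftQ_mkQ_apply, tensorId_tmul,
    idTensor_tmul, sw_apply, appendRight_mkQ, h1, appendLeft_mkQ]
  simpa only [map_sw] using congrArg (balRel₃ r l r' l').mkQ
    (sw_coassoc (k := k) f (fun p u v => (α x * ι p) ⊗ₜ[k] (ι u ⊗ₜ[k] ι v)))

variable {DL : LeftBialgebroidData k L K} {DR : RightBialgebroidData k R K}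

/-- Left multiplication by β(a) is left multiplication by an element of R (`target_eq_right`), so
under D it acts on the second factor, next to the outer tensor sign, where it can be balanced. In
the three lemmas below the multiplication is by L, which acts on the first factor, or by R, which
acts on the second. -/
lemma leftRel_le_ker_tensorId (hS : Function.Bijective (S k H)) (hD : IsExtComul ι α γ D)
    (ht : ∀ x, DL.target x = YL.targetMap ι α x) :
    DL.rel ≤ LinearMap.ker (tensorId D (leftMulBy DL.target) (leftMulBy DL.source)) := by
  refine balRel_le_ker fun a x y => ?_
  obtain ⟨t, h1, h2, -⟩ := hD.exists_lift_right C hS x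
  simp only [tensorId_tmul]
  have h3 : leftMulBy DL.target a x = γ (anti φ (YL.untwist hS a)) * x := by
    rw [← C.target_eq_right, ← ht]
    rfl
  rw [h1, h3, h2]
  simp only [map_sw, sw_apply, appendRight_mkQ]
  congr 1
  funext u v
  rw [← mkQ_balRel₃_right, ← C.target_eq_right, ← ht]
  rfl

lemma leftRel_le_ker_idTensor (hD : IsExtComul ι α γ D)
    (hs : ∀ x, DL.source x = α x) :
    DL.rel ≤ LinearMap.ker (idTensor (leftMulBy DL.target) (leftMulBy DL.source) D) := by
  refine balRel_le_ker fun a x y => ?_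
  obtain ⟨t, h1, h2, -⟩ := hD.exists_lift_left C y
  simp only [idTensor_tmul]
  have h3 : leftMulBy DL.source a y = α a * y := by
    rw [← hs]
    rfl
  rw [h1, h3, h2]
  simp only [map_sw, sw_apply, appendLeft_mkQ]
  congr 1
  funext u v
  rw [mkQ_balRel₃_left, ← hs]
  rfl

lemma rightRel_le_ker_tensorId (hS : Function.Bijective (S k H)) (hD : IsExtComul ι α γ D)
    (hs : ∀ y, DR.source y = γ y) :
    DR.rel ≤ LinearMap.ker (tensorId D (rightMulBy DR.source) (rightMulBy DR.target)) := by
  refine balRel_le_ker fun a x y => ?_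
  obtain ⟨t, h1, -, h2⟩ := hD.exists_lift_right C hS x
  simp only [tensorId_tmul]
  have h3 : rightMulBy DR.source a x = x * γ a := by
    rw [← hs]
    rfl
  rw [h1, h3, h2]
  simp only [map_sw, sw_apply, appendRight_mkQ]
  congr 1
  funext u v
  rw [← mkQ_balRel₃_right, ← hs]
  rfl

lemma rightRel_le_ker_idTensor (hD : IsExtComul ι α γ D)
    (ht : ∀ x, DR.target (anti φ x) = α x) :
    DR.rel ≤ LinearMap.ker (idTensor (rightMulBy DR.source) (rightMulBy DR.target) D) := by
  refine balRel_le_ker fun a x y => ?_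
  obtain ⟨b, rfl⟩ := (anti φ).surjective a
  obtain ⟨t, h1, -, h2⟩ := hD.exists_lift_left C y
  simp only [idTensor_tmul]
  have h3 : rightMulBy DR.target (anti φ b) y = y * α b := by
    rw [← ht]
    rfl
  rw [h1, h3, h2]
  simp only [map_sw, sw_apply, appendLeft_mkQ]
  congr 1
  funext u v
  rw [mkQ_balRel₃_left, ← ht]
  rfl

end IsExtComul

end ExtComul

/-! ### The left bialgebroid -/

section LeftBialgebroid

variable {k H L R K : Type*} [Field k] [Ring L] [Algebra k L]
  [Ring R] [Algebra k R] [Ring H] [HopfAlgebra k H] [Ring K] [Algebra k K]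

local notation "δ" => Coalgebra.comul (R := k)
local notation "ε" => Coalgebra.counit (R := k)

lemma leftTensorMul_mkQ (s t : L →ₗ[k] K) (x y u v : K) :
    leftTensorMul s t ((leftRel s t).mkQ (x ⊗ₜ y)) (u ⊗ₜ v) =
      (leftRel s t).mkQ ((x * u) ⊗ₜ (y * v)) := by
  change (leftRel s t).mkQ ((x ⊗ₜ y) * (u ⊗ₜ v)) = _
  rw [Algebra.TensorProduct.tmul_mul_tmul]

lemma mkQ_leftRel (s t : L →ₗ[k] K) (a : L) (x y : K) :
    (leftRel s t).mkQ ((t a * x) ⊗ₜ y) = (leftRel s t).mkQ (x ⊗ₜ (s a * y)) :=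
  mkQ_balRel (leftMulBy t) (leftMulBy s) a x y

/-- The structure maps of the left scalar extension bialgebroid: `α_L = α`, `β_L(x) = x₀ x₁`,
`Δ_L(x f) = x f₁ ⊗ f₂` and `ε_L(x f) = ε(f) x`. -/
structure IsLeftExt (YL : LeftRightYD k H L) (ι : H →ₗ[k] K) (α : L →ₗ[k] K) (γ : R →ₗ[k] K)
    (D : LeftBialgebroidData k L K) : Prop where
  source : ∀ x, D.source x = α x
  target : ∀ x, D.target x = YL.targetMap ι α x
  comul : IsExtComul ι α γ D.comul
  counit : ∀ x f, D.counit (α x * ι f) = ε f • x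

namespace IsLeftExt

variable {φ : L ≃ₐ[k] Rᵐᵒᵖ} {YL : LeftRightYD k H L} {ι : H →ₗ[k] K} {α : L →ₗ[k] K}
  {γ : R →ₗ[k] K} {D : LeftBialgebroidData k L K} (E : IsLeftExt YL ι α γ D)
  (C : IsScalarExt φ YL ι α γ)

include E C

lemma counit_left (x : L) : D.counit (α x) = x := by
  simpa [C.hopf_one] using E.counit x 1

lemma counit_hopf (f : H) : D.counit (ι f) = ε f • 1 := by
  simpa [C.left_one] using E.counit 1 f

lemma counit_mul_hopf (z : K) (f : H) : D.counit (z * ι f) = ε f • D.counit z := by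
  refine C.ext_left (T := D.counit ∘ₗ LinearMap.mulRight k (ι f)) (U := ε f • D.counit)
    (fun x g => ?_) z
  simp only [LinearMap.comp_apply, LinearMap.mulRight_apply, LinearMap.smul_apply, mul_assoc,
    ← C.hopf_mul, E.counit, Bialgebra.counit_mul, smul_smul, mul_comm]

/-- `ε(f x) = f ▷ x` -/
lemma counit_hopf_left (f : H) (x : L) : D.counit (ι f * α x) = YL.act f x := by
  simp only [C.hopf_left, map_sw, E.counit]
  exact sw_counit_right f (fun p => YL.act p x)

/-- For w = x f both sides equal ε(f) ε(z x). -/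
lemma counit_mul (z w : K) : D.counit (z * w) = D.counit (z * α (D.counit w)) := by
  refine C.ext_left (T := D.counit ∘ₗ LinearMap.mulLeft k z)
    (U := D.counit ∘ₗ LinearMap.mulLeft k z ∘ₗ α ∘ₗ D.counit) (fun x g => ?_) w
  simp only [LinearMap.comp_apply, LinearMap.mulLeft_apply, E.counit, ← mul_assoc,
    E.counit_mul_hopf C, map_smul, mul_smul_comm]

variable (hb : YL.BraidedCommutative)

include hb

lemma source_target_comm (a b : L) : D.source a * D.target b = D.target b * D.source a := by
  rw [E.source, E.target, C.target_left_comm hb]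

/-- Since β(b) commutes with x, the product a β(b) x f is a x b₀ b₁ f, and the counit removes b₁. -/
lemma counit_bimodule (a b : L) (z : K) :
    D.counit (D.source a * D.target b * z) = a * D.counit z * b := by
  refine C.ext_left (T := D.counit ∘ₗ LinearMap.mulLeft k (D.source a * D.target b))
    (U := LinearMap.mulRight k b ∘ₗ LinearMap.mulLeft k a ∘ₗ D.counit) (fun x f => ?_) z
  simp only [LinearMap.comp_apply, LinearMap.mulLeft_apply, LinearMap.mulRight_apply, E.counit]
  rw [E.source, E.target, mul_assoc, ← mul_assoc (YL.targetMap ι α b), C.target_left_comm hb,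
    YL.targetMap_apply]
  simp only [mul_sw, sw_mul, mul_assoc, ← C.hopf_mul]
  simp only [← mul_assoc, ← C.left_mul, map_sw, E.counit, Bialgebra.counit_mul, mul_smul]
  rw [YL.sw_coact_counit b (fun c => ε f • (a * x * c))]
  simp

lemma comul_bimodule_wd (a b : L) : D.rel ≤ D.rel.comap
    (TensorProduct.map (LinearMap.mulLeft k (D.source a)) (LinearMap.mulLeft k (D.target b))) := by
  refine balRel_le_comap fun c x y => ?_
  simp only [TensorProduct.map_tmul, LinearMap.mulLeft_apply, leftMulBy, LinearMap.comp_apply,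
    LinearMap.mul_apply']
  rw [← mul_assoc, E.source_target_comm C hb, mul_assoc, ← mul_assoc (D.target b),
    ← E.source_target_comm C hb, mul_assoc]
  exact mkQ_leftRel D.source D.target c _ _

/-- This is the Takeuchi condition: β(a) is pulled to the left through f₁ as β(f₂ ▷ a), crosses the
tensor sign as f₂ ▷ a, and is absorbed again by (f₂ ▷ a) f₃ = f₂ a. -/
lemma comulMul_wd (z : K) : D.rel ≤ LinearMap.ker (D.comulMul z) := by
  refine balRel_le_ker fun a u v => ?_
  refine C.ext_left (T := (leftTensorMul D.source D.target).flip _ ∘ₗ D.comul)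
    (U := (leftTensorMul D.source D.target).flip _ ∘ₗ D.comul) (fun x f => ?_) z
  simp only [LinearMap.comp_apply, LinearMap.flip_apply, E.comul.left, map_sw, sw_apply,
    leftTensorMul_mkQ]
  simp only [leftMulBy, LinearMap.comp_apply, LinearMap.mul_apply']
  have h1 : ∀ p q : H, (leftRel D.source D.target).mkQ
      ((α x * ι p * (D.target a * u)) ⊗ₜ (ι q * v)) = sw (δ p) (fun r s =>
        (leftRel D.source D.target).mkQ ((α x * ι r * u) ⊗ₜ (α (YL.act s a) * ι q * v))) := by
    intro p q
    have h2 : α x * ι p * (D.target a * u) =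
        sw (δ p) (fun r s => D.target (YL.act s a) * (α x * ι r * u)) := by
      rw [E.target, mul_assoc, ← mul_assoc (ι p), C.hopf_target]
      simp only [sw_mul, mul_sw]
      congr 1
      funext r s
      rw [E.target, mul_assoc (YL.targetMap ι α _), ← mul_assoc (α x),
        ← C.target_left_comm hb]
      simp only [mul_assoc]
    rw [h2]
    simp only [sw_tmul, map_sw, mkQ_leftRel, E.source, mul_assoc]
  simp only [h1]
  rw [sw_coassoc f (fun r s q => (leftRel D.source D.target).mkQ
    ((α x * ι r * u) ⊗ₜ (α (YL.act s a) * ι q * v)))]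
  congr 1
  funext p q
  rw [E.source, ← mul_assoc (ι q), C.hopf_left]
  simp only [sw_mul, tmul_sw, map_sw]

lemma counit_id_wd : D.rel ≤ LinearMap.ker D.counitTensorId :=
  balRel_le_ker fun a x y => by
  have h := E.counit_bimodule C hb 1 a x
  rw [E.source, C.left_one, one_mul, one_mul] at h
  change D.source (D.counit (D.target a * x)) * y = D.source (D.counit x) * (D.source a * y)
  rw [h, E.source, E.source, E.source, C.left_mul, mul_assoc]

lemma id_counit_wd : D.rel ≤ LinearMap.ker D.idTensorCounit :=
  balRel_le_ker fun a x y => by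
  have h := E.counit_bimodule C hb a 1 y
  rw [E.target, C.target_one, mul_one, mul_one] at h
  change D.target (D.counit y) * (D.target a * x) = D.target (D.counit (D.source a * y)) * x
  rw [h, E.target, E.target, E.target, C.target_mul hb, mul_assoc]

/-- On generators, (a f)(b g) = a (f₁ ▷ b) f₂ g. After Δ(f₂ g) is expanded, coassociativity puts f₁
▷ b and the next leg of f on the first factor, where they recombine to a product with b. -/
lemma comulMul_mul (x y u v : K) : D.comulMul (x * y) (u ⊗ₜ v) =
    D.rel.liftQ (D.comulMul x) (E.comulMul_wd C hb x) (D.comulMul y (u ⊗ₜ v)) := by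
  obtain ⟨t, rfl⟩ := C.span_left x
  -- The descended operator is linear in the element acting, which is seen on representatives.
  have hx : ∀ w, D.rel.liftQ _ (E.comulMul_wd C hb (sw t (fun x f => α x * ι f))) w =
      sw t (fun x f => D.rel.liftQ _ (E.comulMul_wd C hb (α x * ι f)) w) := fun w => by
    obtain ⟨w, rfl⟩ := Submodule.mkQ_surjective _ w
    simp only [liftQ_mkQ_apply, LeftBialgebroidData.comulMul, map_sw, sw_apply]
  rw [hx, sw_mul]
  simp only [LeftBialgebroidData.comulMul, map_sw, sw_apply]
  congr 1
  funext a f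
  obtain ⟨t, rfl⟩ := C.span_left y
  simp only [map_sw, mul_sw, sw_apply]
  congr 1
  funext b g
  have h1 : α a * ι f * (α b * ι g) = sw (δ f) (fun p q => α (a * YL.act p b) * ι (q * g)) := by
    rw [mul_assoc, ← mul_assoc (ι f), C.hopf_left, sw_mul, mul_sw]
    simp only [C.left_mul, C.hopf_mul, mul_assoc]
  have h2 : ∀ (c : L) (q : H), leftTensorMul D.source D.target (D.comul (α c * ι (q * g)))
      (u ⊗ₜ v) = sw (δ q) (fun q₁ q₂ => sw (δ g) (fun g₁ g₂ => (leftRel D.source D.target).mkQ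
        ((α c * ι q₁ * ι g₁ * u) ⊗ₜ (ι q₂ * ι g₂ * v)))) := by
    intro c q
    rw [E.comul.left, sw_comul_mul q g (fun p q =>
      (balRel (leftMulBy D.target) (leftMulBy D.source)).mkQ ((α c * ι p) ⊗ₜ ι q))]
    simp only [map_sw, sw_apply, leftTensorMul_mkQ, C.hopf_mul, mul_assoc]
  rw [h1]
  simp only [map_sw, sw_apply, h2]
  simp only [E.comul.left, map_sw, sw_apply, leftTensorMul_mkQ, liftQ_mkQ_apply]
  rw [← sw_coassoc f (fun p q₁ q₂ => sw (δ g) (fun g₁ g₂ => (leftRel D.source D.target).mkQ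
    ((α (a * YL.act p b) * ι q₁ * ι g₁ * u) ⊗ₜ (ι q₂ * ι g₂ * v))))]
  rw [sw_comm (δ g) (δ f)]
  congr 1
  funext p q
  rw [sw_comm]
  congr 1
  funext g₁ g₂
  have h3 : α a * ι p * (α b * ι g₁ * u) = sw (δ p) (fun p₁ p₂ =>
      α (a * YL.act p₁ b) * ι p₂ * ι g₁ * u) := by
    rw [mul_assoc, ← mul_assoc (ι p), ← mul_assoc (ι p), C.hopf_left]
    simp only [sw_mul, mul_sw, C.left_mul, mul_assoc]
  rw [h3]
  simp only [sw_tmul, map_sw, mul_assoc]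

theorem isLeftBialgebroid (hS : Function.Bijective (S k H)) : D.IsLeftBialgebroid where
  source_one := by rw [E.source, C.left_one]
  source_mul a b := by simp only [E.source, C.left_mul]
  target_one := by rw [E.target, C.target_one]
  target_mul a b := by simp only [E.target, C.target_mul hb]
  source_target_comm := E.source_target_comm C hb
  comul_bimodule_wd := E.comul_bimodule_wd C hb
  comul_bimodule a b z := by
    -- The source acts on the first factor as an element of L; the target is treated afterwards as
    -- an element of R, acting on the second.
    have h1 : ∀ w, D.comul (D.source a * w) = Submodule.mapQ D.rel D.rel _
        (E.comul_bimodule_wd C hb a 1) (D.comul w) := fun w => by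
      obtain ⟨t, h1, h2, -⟩ := E.comul.exists_lift_left C w
      have hs : D.source a * w = α a * w := by rw [E.source]
      rw [hs, h1, h2]
      simp only [map_sw]
      congr 1
      funext u v
      change _ = (leftRel D.source D.target).mkQ ((D.source a * u) ⊗ₜ (D.target 1 * v))
      rw [E.source, E.target, C.target_one, one_mul]
    obtain ⟨t, h2, h3, -⟩ := E.comul.exists_lift_right C hS z
    have ht : D.target b * z = γ (anti φ (YL.untwist hS b)) * z := by
      rw [E.target b, C.target_eq_right hS]
    rw [mul_assoc, h1, ht, h3, h2]
    simp only [map_sw]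
    congr 1
    funext u v
    rw [← C.target_eq_right, ← E.target]
    change (leftRel D.source D.target).mkQ
        ((D.source a * u) ⊗ₜ (D.target 1 * (D.target b * v))) =
      (leftRel D.source D.target).mkQ ((D.source a * u) ⊗ₜ (D.target b * v))
    rw [E.target 1, C.target_one, one_mul]
  counit_bimodule := E.counit_bimodule C hb
  comul_id_wd := E.comul.leftRel_le_ker_tensorId C hS E.target
  id_comul_wd := E.comul.leftRel_le_ker_idTensor C E.source
  coassoc := E.comul.coassoc C E.comul _ _
  counit_id_wd := E.counit_id_wd C hb
  counit_id z := by
    refine C.ext_left (T := D.rel.liftQ D.counitTensorId (E.counit_id_wd C hb) ∘ₗ D.comul) (U := LinearMap.id)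
      (fun x f => ?_) z
    simp only [LinearMap.comp_apply, E.comul.left, map_sw, liftQ_mkQ_apply, LinearMap.id_apply]
    change sw (δ f) (fun p q => D.source (D.counit (α x * ι p)) * ι q) = _
    simp only [E.counit, E.source, map_smul, smul_mul_assoc]
    exact sw_counit_left f (fun q => α x * ι q)
  id_counit_wd := E.id_counit_wd C hb
  id_counit z := by
    refine C.ext_left (T := D.rel.liftQ D.idTensorCounit (E.id_counit_wd C hb) ∘ₗ D.comul) (U := LinearMap.id)
      (fun x f => ?_) z
    simp only [LinearMap.comp_apply, E.comul.left, map_sw, liftQ_mkQ_apply, LinearMap.id_apply]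
    change sw (δ f) (fun p q => D.target (D.counit (ι q)) * (α x * ι p)) = _
    simp only [E.counit_hopf C, E.target, map_smul, smul_mul_assoc, C.target_one, one_mul]
    exact sw_counit_right f (fun q => α x * ι q)
  comulMul_wd := E.comulMul_wd C hb
  comulMul_one t := by
    obtain ⟨t, rfl⟩ := Submodule.mkQ_surjective _ t
    rw [liftQ_mkQ_apply, ← sw_self t, map_sw, map_sw]
    congr 1
    funext u v
    rw [LeftBialgebroidData.comulMul, E.comul.map_one C]
    exact (leftTensorMul_mkQ _ _ _ _ _ _).trans (by rw [one_mul, one_mul])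
  comulMul_mul x y t := by
    obtain ⟨t, rfl⟩ := Submodule.mkQ_surjective _ t
    rw [liftQ_mkQ_apply, liftQ_mkQ_apply, ← sw_self t, map_sw, map_sw, map_sw]
    congr 1
    funext u v
    exact E.comulMul_mul C hb x y u v
  counit_action_one a := by rw [one_mul, E.source, E.counit_left C]
  counit_action_mul x y a := by simp only [E.source, mul_assoc, E.counit_mul C x (y * α a)]

end IsLeftExt

end LeftBialgebroid

/-! ### The right bialgebroid -/

section RightBialgebroid

variable {k H L R K : Type*} [Field k] [Ring L] [Algebra k L]
  [Ring R] [Algebra k R] [Ring H] [HopfAlgebra k H] [Ring K] [Algebra k K]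

local notation "δ" => Coalgebra.comul (R := k)
local notation "ε" => Coalgebra.counit (R := k)

lemma rightTensorMul_mkQ (s t : R →ₗ[k] K) (x y u v : K) :
    rightTensorMul s t ((rightRel s t).mkQ (x ⊗ₜ y)) (u ⊗ₜ v) =
      (rightRel s t).mkQ ((u * x) ⊗ₜ (v * y)) := by
  change (rightRel s t).mkQ ((u ⊗ₜ v) * (x ⊗ₜ y)) = _
  rw [Algebra.TensorProduct.tmul_mul_tmul]

lemma mkQ_rightRel (s t : R →ₗ[k] K) (a : R) (x y : K) :
    (rightRel s t).mkQ ((x * s a) ⊗ₜ y) = (rightRel s t).mkQ (x ⊗ₜ (y * t a)) :=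
  mkQ_balRel (rightMulBy s) (rightMulBy t) a x y

/-- The structure maps of the right scalar extension bialgebroid: `α_R = γ`, `β_R(φ(x)) = x`,
`Δ_R(f y) = f₁ ⊗ f₂ y` and `ε_R(f y) = ε(f) y`. -/
structure IsRightExt (φ : L ≃ₐ[k] Rᵐᵒᵖ) (ι : H →ₗ[k] K) (α : L →ₗ[k] K) (γ : R →ₗ[k] K)
    (D : RightBialgebroidData k R K) : Prop where
  source : ∀ y, D.source y = γ y
  target : ∀ x, D.target (anti φ x) = α x
  comul : IsExtComul ι α γ D.comul
  counit : ∀ f y, D.counit (ι f * γ y) = ε f • y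

namespace IsRightExt

variable {φ : L ≃ₐ[k] Rᵐᵒᵖ} {YL : LeftRightYD k H L} {ι : H →ₗ[k] K} {α : L →ₗ[k] K}
  {γ : R →ₗ[k] K} {D : RightBialgebroidData k R K} (E : IsRightExt φ ι α γ D)
  (C : IsScalarExt φ YL ι α γ)

include E C

lemma counit_right (y : R) : D.counit (γ y) = y := by
  simpa [C.hopf_one] using E.counit 1 y

lemma counit_hopf (f : H) : D.counit (ι f) = ε f • 1 := by
  simpa [C.right_one] using E.counit f 1

lemma target_one : D.target 1 = 1 := by
  rw [← anti_one φ, E.target, C.left_one]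

lemma target_mul (a b : R) : D.target (a * b) = D.target b * D.target a := by
  obtain ⟨x, rfl⟩ := (anti φ).surjective a
  obtain ⟨y, rfl⟩ := (anti φ).surjective b
  rw [← anti_mul]
  simp only [E.target, C.left_mul]

/-- `ε(f x) = ε(f) φ(x)` -/
lemma counit_hopf_left (f : H) (x : L) : D.counit (ι f * α x) = ε f • anti φ x := by
  rw [C.left_eq]
  simp only [mul_sw, ← mul_assoc, ← C.hopf_mul, map_sw, E.counit, Bialgebra.counit_mul, counit_S,
    mul_smul, ← smul_sw]
  rw [YL.sw_coact_counit x (fun a => anti φ a)]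

variable (hS : Function.Bijective (S k H))

include hS

lemma counit_hopf_mul (f : H) (z : K) : D.counit (ι f * z) = ε f • D.counit z := by
  refine C.ext_right hS (T := D.counit ∘ₗ LinearMap.mulLeft k (ι f)) (U := ε f • D.counit)
    (fun g y => ?_) z
  simp only [LinearMap.comp_apply, LinearMap.mulLeft_apply, LinearMap.smul_apply, ← mul_assoc,
    ← C.hopf_mul, E.counit, Bialgebra.counit_mul, smul_smul]

lemma counit_mul (z w : K) : D.counit (z * w) = D.counit (γ (D.counit z) * w) := by
  refine C.ext_right hS (T := D.counit ∘ₗ LinearMap.mulRight k w)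
    (U := D.counit ∘ₗ LinearMap.mulRight k w ∘ₗ γ ∘ₗ D.counit) (fun g y => ?_) z
  simp only [LinearMap.comp_apply, LinearMap.mulRight_apply, E.counit, mul_assoc,
    E.counit_hopf_mul C hS, map_smul, smul_mul_assoc]

variable (hb : YL.BraidedCommutative)

include hb

omit hS in
lemma source_target_comm (a b : R) : D.source a * D.target b = D.target b * D.source a := by
  obtain ⟨x, rfl⟩ := (anti φ).surjective a
  obtain ⟨y, rfl⟩ := (anti φ).surjective b
  rw [E.source, E.target, C.left_right_comm hb]

/-- In f y a x the factor x commutes with y a in R and moves next to f. The counit then drops f to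
ε(f) and sees x only through ε_R(x) = φ(x). -/
lemma counit_bimodule (a b : R) (z : K) :
    D.counit (z * D.source a * D.target b) = b * D.counit z * a := by
  obtain ⟨x, rfl⟩ := (anti φ).surjective b
  refine C.ext_right hS
    (T := D.counit ∘ₗ LinearMap.mulRight k (D.target (anti φ x)) ∘ₗ LinearMap.mulRight k (D.source a))
    (U := LinearMap.mulRight k a ∘ₗ LinearMap.mulLeft k (anti φ x) ∘ₗ D.counit) (fun f y => ?_) z
  -- The commutation of L with R is stated for elements φ(c).
  obtain ⟨c, hc⟩ := (anti φ).surjective (y * a)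
  simp only [LinearMap.comp_apply, LinearMap.mulLeft_apply, LinearMap.mulRight_apply, E.counit]
  rw [E.source, E.target, mul_assoc (ι f), ← C.right_mul, mul_assoc, ← hc,
    ← C.left_right_comm hb, hc, E.counit_hopf_mul C hS, E.counit_mul C hS,
    ← one_mul (α x), ← C.hopf_one, E.counit_hopf_left C, Bialgebra.counit_one, one_smul,
    ← C.right_mul, E.counit_right C]
  simp [mul_assoc]

omit hS in
lemma comul_bimodule_wd (a b : R) : D.rel ≤ D.rel.comap
    (TensorProduct.map (LinearMap.mulRight k (D.target b)) (LinearMap.mulRight k (D.source a))) := by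
  refine balRel_le_comap fun c x y => ?_
  simp only [TensorProduct.map_tmul, LinearMap.mulRight_apply, rightMulBy, LinearMap.comp_apply,
    LinearMap.flip_apply, LinearMap.mul_apply']
  rw [mul_assoc x, E.source_target_comm C hb, ← mul_assoc, mul_assoc y,
    ← E.source_target_comm C hb, ← mul_assoc]
  exact mkQ_rightRel D.source D.target c _ _

/-- With f = S(g), the element φ(x) is moved to the right past its leg S(g₂) and becomes φ(g₂ ▷ x)
after S(g₃). It crosses the tensor sign as g₂ ▷ x ∈ L, commutes with R, and S(g₁) (g₂ ▷ x)
recombines to x S(g₁). -/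
lemma mulComul_wd (z : K) : D.rel ≤ LinearMap.ker (D.mulComul z) := by
  refine balRel_le_ker fun a u v => ?_
  obtain ⟨x, rfl⟩ := (anti φ).surjective a
  refine C.ext_right hS (T := (rightTensorMul D.source D.target).flip _ ∘ₗ D.comul)
    (U := (rightTensorMul D.source D.target).flip _ ∘ₗ D.comul) (fun f y => ?_) z
  obtain ⟨g, rfl⟩ := hS.2 f
  obtain ⟨c, rfl⟩ := (anti φ).surjective y
  simp only [LinearMap.comp_apply, LinearMap.flip_apply, E.comul.right, map_sw, sw_apply,
    rightTensorMul_mkQ]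
  simp only [rightMulBy, LinearMap.comp_apply, LinearMap.flip_apply, LinearMap.mul_apply']
  rw [sw_comul_antipode g (fun p q => (rightRel D.source D.target).mkQ
      ((u * D.source (anti φ x) * ι p) ⊗ₜ (v * (ι q * γ (anti φ c))))),
    sw_comul_antipode g (fun p q => (rightRel D.source D.target).mkQ
      ((u * ι p) ⊗ₜ (v * D.target (anti φ x) * (ι q * γ (anti φ c)))))]
  have h1 : ∀ p q : H, (rightRel D.source D.target).mkQ
      ((u * D.source (anti φ x) * ι (S k H q)) ⊗ₜ (v * (ι (S k H p) * γ (anti φ c)))) =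
      sw (δ q) (fun r s => (rightRel D.source D.target).mkQ
        ((u * ι (S k H s)) ⊗ₜ (v * (ι (S k H p) * α (YL.act r x) * γ (anti φ c))))) := by
    intro p q
    rw [E.source, mul_assoc u, C.right_hopf]
    simp only [mul_sw, sw_tmul, map_sw]
    congr 1
    funext r s
    rw [← mul_assoc u, ← E.source, mkQ_rightRel, E.target, mul_assoc (ι _),
      C.left_right_comm hb]
    simp only [mul_assoc]
  simp only [h1]
  rw [← sw_coassoc g (fun p r s => (rightRel D.source D.target).mkQ
    ((u * ι (S k H s)) ⊗ₜ (v * (ι (S k H p) * α (YL.act r x) * γ (anti φ c)))))]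
  congr 1
  funext p q
  rw [E.target, mul_assoc v, ← mul_assoc (α x), C.left_antipode]
  simp only [sw_mul, mul_sw, tmul_sw, map_sw]

lemma counit_id_wd : D.rel ≤ LinearMap.ker D.counitTensorId :=
  balRel_le_ker fun a x y => by
  have h := E.counit_bimodule C hS hb a 1 x
  rw [E.target_one C, mul_one, one_mul] at h
  change y * D.target (D.counit (x * D.source a)) = y * D.target a * D.target (D.counit x)
  rw [h, E.target_mul C, mul_assoc]

lemma id_counit_wd : D.rel ≤ LinearMap.ker D.idTensorCounit :=
  balRel_le_ker fun a x y => by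
  have h := E.counit_bimodule C hS hb 1 a y
  rw [E.source, C.right_one, mul_one, mul_one] at h
  change x * D.source a * D.source (D.counit y) = x * D.source (D.counit (y * D.target a))
  rw [h, E.source, E.source, E.source, C.right_mul, mul_assoc]

/-- Mirror image of the argument on the left: φ(c) S(g) = S(g₂) φ(g₁ ▷ c) puts the product in normal
form, and coassociativity recombines the legs on the second factor. -/
lemma mulComul_mul (x y u v : K) : D.mulComul (x * y) (u ⊗ₜ v) =
    D.rel.liftQ (D.mulComul y) (E.mulComul_wd C hS hb y) (D.mulComul x (u ⊗ₜ v)) := by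
  obtain ⟨t, rfl⟩ := C.span_right hS y
  have hx : ∀ w, D.rel.liftQ _ (E.mulComul_wd C hS hb (sw t (fun f y => ι f * γ y))) w =
      sw t (fun f y => D.rel.liftQ _ (E.mulComul_wd C hS hb (ι f * γ y)) w) := fun w => by
    obtain ⟨w, rfl⟩ := Submodule.mkQ_surjective _ w
    simp only [liftQ_mkQ_apply, RightBialgebroidData.mulComul, map_sw, sw_apply]
  rw [hx, mul_sw]
  simp only [RightBialgebroidData.mulComul, map_sw, sw_apply]
  congr 1
  funext g b
  obtain ⟨g, rfl⟩ := hS.2 g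
  obtain ⟨t, rfl⟩ := C.span_right hS x
  simp only [map_sw, sw_mul, sw_apply]
  congr 1
  funext f a
  obtain ⟨c, rfl⟩ := (anti φ).surjective a
  have h1 : ι f * γ (anti φ c) * (ι (S k H g) * γ b) =
      sw (δ g) (fun p q => ι (f * S k H q) * γ (anti φ (YL.act p c) * b)) := by
    rw [mul_assoc, ← mul_assoc (γ _), C.right_hopf, sw_mul, mul_sw]
    simp only [C.right_mul, C.hopf_mul, mul_assoc]
  have h2 : ∀ (d : R) (q : H), rightTensorMul D.source D.target
      (D.comul (ι (f * S k H q) * γ d)) (u ⊗ₜ v) =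
      sw (δ q) (fun q₁ q₂ => sw (δ f) (fun f₁ f₂ => (rightRel D.source D.target).mkQ
        ((u * (ι f₁ * ι (S k H q₂))) ⊗ₜ (v * (ι f₂ * (ι (S k H q₁) * γ d)))))) := by
    intro d q
    rw [E.comul.right, sw_comul_mul f (S k H q) (fun p q =>
      (balRel (rightMulBy D.source) (rightMulBy D.target)).mkQ (ι p ⊗ₜ (ι q * γ d))),
      sw_comm, sw_comul_antipode q (fun c d' => sw (δ f) (fun a b =>
      (balRel (rightMulBy D.source) (rightMulBy D.target)).mkQ (ι (a * c) ⊗ₜ (ι (b * d') * γ d))))]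
    simp only [map_sw, sw_apply, rightTensorMul_mkQ, C.hopf_mul, mul_assoc]
  rw [h1]
  simp only [map_sw, sw_apply, h2]
  simp only [E.comul.right, map_sw, sw_apply, rightTensorMul_mkQ, liftQ_mkQ_apply]
  rw [← sw_coassoc g (fun p q₁ q₂ => sw (δ f) (fun f₁ f₂ => (rightRel D.source D.target).mkQ
    ((u * (ι f₁ * ι (S k H q₂))) ⊗ₜ (v * (ι f₂ * (ι (S k H q₁) * γ (anti φ (YL.act p c) * b)))))))]
  rw [sw_comm (δ f), sw_comul_antipode g (fun p q => sw (δ f) (fun f₁ f₂ =>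
    (rightRel D.source D.target).mkQ
      ((u * ι f₁ * ι p) ⊗ₜ (v * (ι f₂ * γ (anti φ c)) * (ι q * γ b)))))]
  congr 1
  funext p q
  rw [sw_comm]
  congr 1
  funext f₁ f₂
  have h3 : v * (ι f₂ * γ (anti φ c)) * (ι (S k H p) * γ b) = sw (δ p) (fun p₁ p₂ =>
      v * (ι f₂ * (ι (S k H p₂) * γ (anti φ (YL.act p₁ c) * b)))) := by
    rw [mul_assoc, mul_assoc (ι f₂), ← mul_assoc (γ _), C.right_hopf]
    simp only [sw_mul, mul_sw, C.right_mul, mul_assoc]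
  rw [h3]
  simp only [tmul_sw, map_sw, mul_assoc]

theorem isRightBialgebroid : D.IsRightBialgebroid where
  source_one := by rw [E.source, C.right_one]
  source_mul a b := by simp only [E.source, C.right_mul]
  target_one := E.target_one C
  target_mul := E.target_mul C
  source_target_comm := E.source_target_comm C hb
  comul_bimodule_wd := E.comul_bimodule_wd C hb
  comul_bimodule a b z := by
    obtain ⟨x, rfl⟩ := (anti φ).surjective b
    have h1 : ∀ w, D.comul (w * D.target (anti φ x)) = Submodule.mapQ D.rel D.rel _
        (E.comul_bimodule_wd C hb 1 (anti φ x)) (D.comul w) := fun w => by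
      obtain ⟨t, h1, -, h2⟩ := E.comul.exists_lift_left C w
      have hs : w * D.target (anti φ x) = w * α x := by rw [E.target]
      rw [hs, h1, h2]
      simp only [map_sw]
      congr 1
      funext u v
      change _ = (rightRel D.source D.target).mkQ
        ((u * D.target (anti φ x)) ⊗ₜ (v * D.source 1))
      rw [E.target, E.source, C.right_one, mul_one]
    obtain ⟨t, h2, -, h3⟩ := E.comul.exists_lift_right C hS z
    have ht : z * D.source a = z * γ a := by rw [E.source]
    rw [h1, ht, h3, h2]
    simp only [map_sw]
    congr 1
    funext u v
    rw [← E.source]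
    change (rightRel D.source D.target).mkQ
        ((u * D.target (anti φ x)) ⊗ₜ (v * D.source a * D.source 1)) =
      (rightRel D.source D.target).mkQ ((u * D.target (anti φ x)) ⊗ₜ (v * D.source a))
    rw [E.source 1, C.right_one, mul_one]
  counit_bimodule := E.counit_bimodule C hS hb
  comul_id_wd := E.comul.rightRel_le_ker_tensorId C hS E.source
  id_comul_wd := E.comul.rightRel_le_ker_idTensor C E.target
  coassoc := E.comul.coassoc C E.comul _ _
  counit_id_wd := E.counit_id_wd C hS hb
  counit_id z := by
    refine C.ext_right hS (T := D.rel.liftQ D.counitTensorId (E.counit_id_wd C hS hb) ∘ₗ D.comul)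
      (U := LinearMap.id) (fun f y => ?_) z
    simp only [LinearMap.comp_apply, E.comul.right, map_sw, liftQ_mkQ_apply, LinearMap.id_apply]
    change sw (δ f) (fun p q => ι q * γ y * D.target (D.counit (ι p))) = _
    simp only [E.counit_hopf C, map_smul, mul_smul_comm, E.target_one C, mul_one]
    exact sw_counit_left f (fun q => ι q * γ y)
  id_counit_wd := E.id_counit_wd C hS hb
  id_counit z := by
    refine C.ext_right hS (T := D.rel.liftQ D.idTensorCounit (E.id_counit_wd C hS hb) ∘ₗ D.comul)
      (U := LinearMap.id) (fun f y => ?_) z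
    simp only [LinearMap.comp_apply, E.comul.right, map_sw, liftQ_mkQ_apply, LinearMap.id_apply]
    change sw (δ f) (fun p q => ι p * D.source (D.counit (ι q * γ y))) = _
    simp only [E.counit, E.source, map_smul, mul_smul_comm]
    exact sw_counit_right f (fun q => ι q * γ y)
  mulComul_wd := E.mulComul_wd C hS hb
  mulComul_one t := by
    obtain ⟨t, rfl⟩ := Submodule.mkQ_surjective _ t
    rw [liftQ_mkQ_apply, ← sw_self t, map_sw, map_sw]
    congr 1
    funext u v
    rw [RightBialgebroidData.mulComul, E.comul.map_one C]
    exact (rightTensorMul_mkQ _ _ _ _ _ _).trans (by rw [mul_one, mul_one])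
  mulComul_mul x y t := by
    obtain ⟨t, rfl⟩ := Submodule.mkQ_surjective _ t
    rw [liftQ_mkQ_apply, liftQ_mkQ_apply, ← sw_self t, map_sw, map_sw, map_sw]
    congr 1
    funext u v
    exact E.mulComul_mul C hS hb x y u v
  counit_action_one a := by rw [mul_one, E.source, E.counit_right C]
  counit_action_mul a x y := by
    rw [E.source, E.source, ← mul_assoc, E.counit_mul C hS (γ a * x) y]

end IsRightExt

end RightBialgebroid

/-! ### The symmetric Hopf algebroid -/

section SymmetricHopfAlgebroid

variable {k H L R K : Type*} [Field k] [Ring L] [Algebra k L]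
  [Ring R] [Algebra k R] [Ring H] [HopfAlgebra k H] [Ring K] [Algebra k K]

local notation "δ" => Coalgebra.comul (R := k)
local notation "ε" => Coalgebra.counit (R := k)

lemma antipodeMul_tmul (τ : K →ₗ[k] K) (x y : K) : antipodeMul τ (x ⊗ₜ y) = τ x * y := rfl

lemma mulAntipode_tmul (τ : K →ₗ[k] K) (x y : K) : mulAntipode τ (x ⊗ₜ y) = x * τ y := rfl

namespace IsScalarExt

variable {φ : L ≃ₐ[k] Rᵐᵒᵖ} {YL : LeftRightYD k H L} {ι : H →ₗ[k] K} {α : L →ₗ[k] K}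
  {γ : R →ₗ[k] K} {τ : K →ₗ[k] K} (C : IsScalarExt φ YL ι α γ)
  (hτ : ∀ x f, τ (α x * ι f) = ι (S k H f) * γ (anti φ x))

include C hτ

lemma antipode_left (x : L) : τ (α x) = γ (anti φ x) := by
  simpa [C.hopf_one, S_one] using hτ x 1

lemma antipode_one : τ 1 = 1 := by
  have h := C.antipode_left hτ 1
  rwa [C.left_one, anti_one, C.right_one] at h

/-- For z = x f and w = y g the left side is S(g) S(f₂) φ(f₁ ▷ y) φ(x), and S(f₂) φ(f₁ ▷ y) = φ(y)
S(f) is the relation `right_hopf`. -/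
lemma antipode_mul (z w : K) : τ (z * w) = τ w * τ z := by
  refine C.ext_left (T := τ ∘ₗ LinearMap.mulRight k w) (U := LinearMap.mulLeft k (τ w) ∘ₗ τ)
    (fun x f => ?_) z
  refine C.ext_left (T := τ ∘ₗ LinearMap.mulLeft k (α x * ι f))
    (U := LinearMap.mulRight k (τ (α x * ι f)) ∘ₗ τ) (fun y g => ?_) w
  simp only [LinearMap.comp_apply, LinearMap.mulRight_apply, LinearMap.mulLeft_apply, hτ]
  have h1 : α x * ι f * (α y * ι g) =
      sw (δ f) (fun p q => α (x * YL.act p y) * ι (q * g)) := by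
    rw [mul_assoc, ← mul_assoc (ι f), C.hopf_left]
    simp only [sw_mul, mul_sw, C.left_mul, C.hopf_mul, mul_assoc]
  rw [h1]
  simp only [map_sw, hτ]
  simp only [S_mul, C.hopf_mul, anti_mul, C.right_mul]
  rw [mul_assoc, ← mul_assoc (γ _), C.right_hopf]
  simp only [sw_mul, mul_sw, mul_assoc]

lemma antipode_target (x : L) : τ (YL.targetMap ι α x) = α x := by
  rw [YL.targetMap_apply, C.left_eq]
  simp only [map_sw, hτ]

variable {DL : LeftBialgebroidData k L K} {DR : RightBialgebroidData k R K}

lemma leftRel_le_ker_antipodeMul (EL : IsLeftExt YL ι α γ DL) :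
    DL.rel ≤ LinearMap.ker (antipodeMul τ) :=
  balRel_le_ker fun a x y => by
    change τ (DL.target a * x) * y = τ x * (DL.source a * y)
    rw [C.antipode_mul hτ, EL.target, C.antipode_target hτ, EL.source, mul_assoc]

lemma rightRel_le_ker_mulAntipode (ER : IsRightExt φ ι α γ DR) :
    DR.rel ≤ LinearMap.ker (mulAntipode τ) :=
  balRel_le_ker fun a x y => by
    obtain ⟨b, rfl⟩ := (anti φ).surjective a
    change x * DR.source (anti φ b) * τ y = x * τ (y * DR.target (anti φ b))
    rw [C.antipode_mul hτ, ER.target, C.antipode_left hτ, ER.source, mul_assoc]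

theorem isSymmetricHopfAlgebroid (hS : Function.Bijective (S k H)) (hb : YL.BraidedCommutative)
    (EL : IsLeftExt YL ι α γ DL) (ER : IsRightExt φ ι α γ DR) :
    IsSymmetricHopfAlgebroid DL DR τ where
  base_antiiso := ⟨φ⟩
  left := EL.isLeftBialgebroid C hb hS
  right := ER.isRightBialgebroid C hS hb
  antipode_one := C.antipode_one hτ
  antipode_mul := C.antipode_mul hτ
  sourceL_targetR y := by
    obtain ⟨x, rfl⟩ := (anti φ).surjective y
    rw [ER.target, EL.counit_left C, EL.source]
  targetL_sourceR y := by
    obtain ⟨x, rfl⟩ := (anti φ).surjective y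
    -- From φ(x) = S²(x₁) x₀ and ε_L(f a) = f ▷ a; applying β to this element returns φ(x) by
    -- `right_eq_target`.
    have h : DL.counit (γ (anti φ x)) = YL.twist x := by
      simp only [C.right_eq, map_sw, EL.counit_hopf_left C, YL.twist_apply]
    rw [ER.source, h, EL.target, C.right_eq_target]
  sourceR_targetL x := by
    rw [EL.target, C.target_eq_right hS, ER.counit_right C, ER.source]
  targetR_sourceL x := by
    have h : DR.counit (α x) = anti φ x := by
      simpa [C.hopf_one] using ER.counit_hopf_left C 1 x
    rw [EL.source, h, ER.target]
  comulR_id_wd := ER.comul.leftRel_le_ker_tensorId C hS EL.target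
  id_comulL_wd := EL.comul.rightRel_le_ker_idTensor C ER.target
  mixed_coassoc_RL := ER.comul.coassoc C EL.comul _ _
  comulL_id_wd := EL.comul.rightRel_le_ker_tensorId C hS ER.source
  id_comulR_wd := ER.comul.leftRel_le_ker_idTensor C EL.source
  mixed_coassoc_LR := EL.comul.coassoc C ER.comul _ _
  antipode_targetL x := by rw [EL.target, EL.source, C.antipode_target hτ]
  antipode_targetR y := by
    obtain ⟨x, rfl⟩ := (anti φ).surjective y
    rw [ER.target, ER.source, C.antipode_left hτ]
  antipode_id_wd := C.leftRel_le_ker_antipodeMul hτ EL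
  antipode_id z := by
    refine C.ext_left (T := DL.rel.liftQ (antipodeMul τ) (C.leftRel_le_ker_antipodeMul hτ EL) ∘ₗ DL.comul)
      (U := DR.source ∘ₗ DR.counit) (fun x f => ?_) z
    -- With f = S(g), the element becomes S(g₁) (g₂ ▷ x), on which ε_R is known. The axiom is then
    -- S(f₁) φ(x) f₂ = φ(S⁻¹(f) ▷ x).
    have h : DR.counit (α x * ι f) = anti φ (YL.act (SInv hS f) x) := by
      obtain ⟨g, rfl⟩ := hS.2 f
      simp only [C.left_antipode, map_sw, ER.counit_hopf_left C, counit_S, SInv_S]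
      exact sw_counit_left g (fun q => anti φ (YL.act q x))
    simp only [LinearMap.comp_apply, EL.comul.left, map_sw, liftQ_mkQ_apply, antipodeMul_tmul, hτ,
      h, ER.source, mul_assoc]
    exact C.antipode_right_hopf hS f x
  id_antipode_wd := C.rightRel_le_ker_mulAntipode hτ ER
  id_antipode z := by
    refine C.ext_left (T := DR.rel.liftQ (mulAntipode τ) (C.rightRel_le_ker_mulAntipode hτ ER) ∘ₗ DR.comul)
      (U := DL.source ∘ₗ DL.counit) (fun x f => ?_) z
    have h : ∀ q, τ (ι q) = ι (S k H q) := fun q => by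
      simpa [C.left_one, anti_one, C.right_one] using hτ 1 q
    simp only [LinearMap.comp_apply, ER.comul.left, map_sw, liftQ_mkQ_apply, mulAntipode_tmul, h,
      EL.counit, EL.source, mul_assoc, ← C.hopf_mul]
    rw [sw_mul_antipode f (fun u => α x * ι u), C.hopf_one, mul_one, map_smul]

end IsScalarExt

end SymmetricHopfAlgebroid

/-! ### Recognizing the structure maps -/

section Recognition

variable {k H L R K A : Type*} [Field k] [Ring L] [Algebra k L]
  [Ring R] [Algebra k R] [Ring H] [HopfAlgebra k H] [Ring K] [Algebra k K]
  [AddCommGroup A] [Module k A]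

local notation "δ" => Coalgebra.comul (R := k)
local notation "ε" => Coalgebra.counit (R := k)

namespace IsScalarExt

variable {φ : L ≃ₐ[k] Rᵐᵒᵖ} {YL : LeftRightYD k H L} {ι : H →ₗ[k] K} {α : L →ₗ[k] K}
  {γ : R →ₗ[k] K} (C : IsScalarExt φ YL ι α γ) {r l : A →ₗ[k] Module.End k K}
  {D : K →ₗ[k] BalTensor r l}
  {DL : LeftBialgebroidData k L K} {DR : RightBialgebroidData k R K}

include C

lemma comul_hopf_left
    (hD : ∀ x f, D (α x * ι f) = sw (δ f) (fun p q => (balRel r l).mkQ ((α x * ι p) ⊗ₜ ι q)))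
    (f : H) (x : L) :
    D (ι f * α x) = sw (δ f) (fun p q => (balRel r l).mkQ ((ι p * α x) ⊗ₜ ι q)) := by
  simp only [C.hopf_left, map_sw, sw_tmul, hD]
  exact (sw_coassoc f (fun p u v => (balRel r l).mkQ ((α (YL.act p x) * ι u) ⊗ₜ ι v))).symm

/-- Expand φ(x) = S²(x₁) x₀ and use that S² preserves the order of the coproduct: the first leg
S²(x₁) x₀ reassembles to φ(x₀) and the second leg S²(x₂) is left over. No balancing is used yet. -/
lemma comul_hopf_right_of_left
    (hD : ∀ x f, D (α x * ι f) = sw (δ f) (fun p q => (balRel r l).mkQ ((α x * ι p) ⊗ₜ ι q)))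
    (f : H) (x : L) :
    D (ι f * γ (anti φ x)) = sw (YL.coact x) (fun a h => sw (δ f) (fun p q =>
      (balRel r l).mkQ ((ι p * γ (anti φ a)) ⊗ₜ (ι q * ι (S k H (S k H h)))))) := by
  have h1 : ∀ (a : L) (h : H), D (ι f * (ι (S k H (S k H h)) * α a)) =
      sw (δ h) (fun u v => sw (δ f) (fun p q => (balRel r l).mkQ
        ((ι p * (ι (S k H (S k H u)) * α a)) ⊗ₜ (ι q * ι (S k H (S k H v)))))) := by
    intro a h
    rw [← mul_assoc, ← C.hopf_mul, C.comul_hopf_left hD,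
      sw_comul_mul f _ (fun p q => (balRel r l).mkQ ((ι p * α a) ⊗ₜ ι q)), sw_comm,
      sw_comul_antipode (S k H h) (fun u v => sw (δ f) (fun p q =>
        (balRel r l).mkQ ((ι (p * u) * α a) ⊗ₜ ι (q * v)))),
      sw_comul_antipode h (fun u v => sw (δ f) (fun p q =>
        (balRel r l).mkQ ((ι (p * S k H v) * α a) ⊗ₜ ι (q * S k H u))))]
    simp only [C.hopf_mul, mul_assoc]
  rw [C.right_eq, mul_sw]
  simp only [map_sw, h1]
  rw [← YL.sw_coact_coassoc x (fun a u v => sw (δ f) (fun p q => (balRel r l).mkQ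
        ((ι p * (ι (S k H (S k H u)) * α a)) ⊗ₜ (ι q * ι (S k H (S k H v))))))]
  congr 1
  funext a h
  rw [sw_comm]
  simp only [C.right_eq, mul_sw, sw_tmul, map_sw]

/-- Over R the factor φ(x₀) crosses as right multiplication by x₀, producing S²(x₁) x₀ = φ(x) on the
second factor. -/
lemma isExtComul_right_of_left (hs : ∀ y, DR.source y = γ y) (ht : ∀ x, DR.target (anti φ x) = α x)
    (hD : ∀ x f, DR.comul (α x * ι f) =
      sw (δ f) (fun p q => DR.rel.mkQ ((α x * ι p) ⊗ₜ ι q))) : IsExtComul ι α γ DR.comul where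
  left := hD
  right f y := by
    obtain ⟨x, rfl⟩ := (anti φ).surjective y
    rw [C.comul_hopf_right_of_left hD, sw_comm]
    congr 1
    funext p q
    rw [C.right_eq, mul_sw]
    simp only [tmul_sw, map_sw]
    congr 1
    funext a h
    rw [← hs]
    refine (mkQ_rightRel DR.source DR.target _ _ _).trans ?_
    rw [ht, mul_assoc]

/-- `f₁ β(c) ⊗ f₂ v = f₁ ⊗ f₂ c v` -/
lemma mkQ_hopf_target (hs : ∀ x, DL.source x = α x) (ht : ∀ x, DL.target x = YL.targetMap ι α x)
    (f : H) (c : L) (v : K) :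
    sw (δ f) (fun p q => DL.rel.mkQ ((ι p * YL.targetMap ι α c) ⊗ₜ (ι q * v))) =
      sw (δ f) (fun p q => DL.rel.mkQ (ι p ⊗ₜ (ι q * (α c * v)))) := by
  have h1 : ∀ p q : H, DL.rel.mkQ ((ι p * YL.targetMap ι α c) ⊗ₜ (ι q * v)) =
      sw (δ p) (fun r s => DL.rel.mkQ (ι r ⊗ₜ (α (YL.act s c) * (ι q * v)))) := by
    intro p q
    rw [C.hopf_target]
    simp only [sw_tmul, map_sw]
    congr 1
    funext r s
    rw [← ht, ← hs]
    exact mkQ_leftRel DL.source DL.target _ _ _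
  simp only [h1]
  rw [sw_coassoc f (fun r s q => DL.rel.mkQ (ι r ⊗ₜ (α (YL.act s c) * (ι q * v))))]
  congr 1
  funext p q
  rw [← mul_assoc (ι q), C.hopf_left]
  simp only [sw_mul, tmul_sw, map_sw, mul_assoc]

/-- `x₀` twisted by `S²(x₁)`, times `S²(x₂)`, is `φ(x)`. -/
lemma sw_twist_hopf (x : L) :
    sw (YL.coact x) (fun a h => α (YL.twist a) * ι (S k H (S k H h))) = γ (anti φ x) := by
  simp only [YL.twist_apply, map_sw, sw_mul]
  rw [YL.sw_coact_coassoc x (fun b g h => α (YL.act (S k H (S k H g)) b) * ι (S k H (S k H h))),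
    C.right_eq]
  congr 1
  funext b w
  rw [C.hopf_left, sw_comul_antipode (S k H w) (fun p q => α (YL.act p b) * ι q),
    sw_comul_antipode w (fun p q => α (YL.act (S k H q) b) * ι (S k H p))]

/-- Over L one writes φ(x₀) = β(S²(x₁) ▷ x₀), which crosses as an element of L behind f₂ by
`mkQ_hopf_target`. Together with the leftover S² it is φ(x) by `sw_twist_hopf`. -/
lemma isExtComul_left_of_left (hs : ∀ x, DL.source x = α x)
    (ht : ∀ x, DL.target x = YL.targetMap ι α x)
    (hD : ∀ x f, DL.comul (α x * ι f) =
      sw (δ f) (fun p q => DL.rel.mkQ ((α x * ι p) ⊗ₜ ι q))) : IsExtComul ι α γ DL.comul where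
  left := hD
  right f y := by
    obtain ⟨x, rfl⟩ := (anti φ).surjective y
    rw [C.comul_hopf_right_of_left hD]
    simp only [C.right_eq_target]
    have h := fun a h => C.mkQ_hopf_target hs ht f (YL.twist a) (ι (S k H (S k H h)))
    refine (congrArg (sw (YL.coact x)) (funext fun a => funext fun g => h a g)).trans ?_
    rw [sw_comm]
    congr 1
    funext p q
    rw [← C.right_eq_target, ← C.sw_twist_hopf, mul_sw]
    simp only [tmul_sw, map_sw]

/-- Counterpart of `comul_hopf_right_of_left`, starting from x = S(x₁) φ(x₀): since S reverses the
coproduct, S(x₁) φ(x₀) reassembles to x₀ on the second factor and the leftover S(x₁) stands on the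
first. -/
lemma comul_left_hopf_of_right
    (hD : ∀ f y, D (ι f * γ y) = sw (δ f) (fun p q => (balRel r l).mkQ (ι p ⊗ₜ (ι q * γ y))))
    (x : L) (g : H) :
    D (α x * ι (S k H g)) = sw (YL.coact x) (fun a h => sw (δ g) (fun p q =>
      (balRel r l).mkQ ((ι (S k H h) * ι (S k H q)) ⊗ₜ (α a * ι (S k H p))))) := by
  have h1 : ∀ (a : L) (h : H), D (ι (S k H h) * γ (anti φ a) * ι (S k H g)) =
      sw (δ h) (fun u v => sw (δ g) (fun p q => (balRel r l).mkQ
        ((ι (S k H v) * ι (S k H q)) ⊗ₜ (ι (S k H u) * γ (anti φ a) * ι (S k H p))))) := by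
    intro a h
    rw [mul_assoc, C.right_hopf]
    simp only [mul_sw, ← mul_assoc, ← C.hopf_mul, map_sw, hD]
    have h2 : ∀ p q : H, sw (δ (S k H h * S k H q)) (fun u v => (balRel r l).mkQ
        (ι u ⊗ₜ (ι v * γ (anti φ (YL.act p a))))) = sw (δ q) (fun q₁ q₂ => sw (δ h) (fun u v =>
          (balRel r l).mkQ (ι (S k H v * S k H q₂) ⊗ₜ
            (ι (S k H u * S k H q₁) * γ (anti φ (YL.act p a)))))) := by
      intro p q
      rw [sw_comul_mul _ _ (fun u v => (balRel r l).mkQ (ι u ⊗ₜ (ι v * γ (anti φ (YL.act p a))))),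
        sw_comul_antipode h (fun b c => sw (δ (S k H q)) (fun p' q' => (balRel r l).mkQ
          (ι (b * p') ⊗ₜ (ι (c * q') * γ (anti φ (YL.act p a)))))), sw_comm,
        sw_comul_antipode q (fun p' q' => sw (δ h) (fun b c => (balRel r l).mkQ
          (ι (S k H c * p') ⊗ₜ (ι (S k H b * q') * γ (anti φ (YL.act p a))))))]
    simp only [h2]
    rw [← sw_coassoc g (fun p q₁ q₂ => sw (δ h) (fun u v =>
          (balRel r l).mkQ (ι (S k H v * S k H q₂) ⊗ₜ
            (ι (S k H u * S k H q₁) * γ (anti φ (YL.act p a))))))]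
    rw [sw_comm (δ h)]
    congr 1
    funext p q
    rw [sw_comm]
    congr 1
    funext u v
    rw [mul_assoc (ι (S k H u)), C.right_hopf]
    simp only [mul_sw, tmul_sw, map_sw, C.hopf_mul, mul_assoc]
  rw [C.left_eq, sw_mul]
  simp only [map_sw, h1]
  rw [← YL.sw_coact_coassoc x (fun a u v => sw (δ g) (fun p q => (balRel r l).mkQ
        ((ι (S k H v) * ι (S k H q)) ⊗ₜ (ι (S k H u) * γ (anti φ a) * ι (S k H p)))))]
  congr 1
  funext a h
  rw [sw_comm]
  simp only [C.left_eq a, sw_mul, tmul_sw, map_sw]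

/-- `β(x₀) S(x₁) = x` -/
lemma sw_target_antipode (x : L) :
    sw (YL.coact x) (fun a h => YL.targetMap ι α a * ι (S k H h)) = α x := by
  simp only [YL.targetMap_apply, sw_mul, mul_assoc, ← C.hopf_mul]
  rw [YL.sw_coact_coassoc x (fun b g h => α b * ι (g * S k H h))]
  have h : ∀ (b : L) (w : H), sw (δ w) (fun g h => α b * ι (g * S k H h)) =
      ε w • (α b * ι 1) := fun b w => sw_mul_antipode w (fun u => α b * ι u)
  simp only [h, C.hopf_one, mul_one]
  exact YL.sw_coact_counit x (fun b => α b)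

/-- Over L the factor x₀ returns to the first factor as β(x₀), and β(x₀) S(x₁) = x. -/
lemma isExtComul_left_of_right (hS : Function.Bijective (S k H)) (hs : ∀ x, DL.source x = α x)
    (ht : ∀ x, DL.target x = YL.targetMap ι α x)
    (hD : ∀ f y, DL.comul (ι f * γ y) =
      sw (δ f) (fun p q => DL.rel.mkQ (ι p ⊗ₜ (ι q * γ y)))) : IsExtComul ι α γ DL.comul where
  left x f := by
    obtain ⟨g, rfl⟩ := hS.2 f
    rw [C.comul_left_hopf_of_right hD, sw_comm,
      sw_comul_antipode g (fun p q => (balRel (leftMulBy DL.target) (leftMulBy DL.source)).mkQ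
        ((α x * ι p) ⊗ₜ ι q))]
    congr 1
    funext p q
    rw [← C.sw_target_antipode x, sw_mul]
    simp only [sw_tmul, map_sw]
    congr 1
    funext a h
    rw [← hs, ← ht, mul_assoc]
    exact (mkQ_leftRel DL.source DL.target _ _ _).symm
  right := hD

lemma isExtComul_right_of_right (hS : Function.Bijective (S k H)) (hs : ∀ y, DR.source y = γ y)
    (ht : ∀ x, DR.target (anti φ x) = α x)
    (hD : ∀ f y, DR.comul (ι f * γ y) =
      sw (δ f) (fun p q => DR.rel.mkQ (ι p ⊗ₜ (ι q * γ y)))) : IsExtComul ι α γ DR.comul where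
  left x f := by
    obtain ⟨g, rfl⟩ := hS.2 f
    rw [C.comul_left_hopf_of_right hD,
      sw_comul_antipode g (fun p q => (balRel (rightMulBy DR.source) (rightMulBy DR.target)).mkQ
        ((α x * ι p) ⊗ₜ ι q))]
    -- Over R only right multiplications are balanced, so a is first moved behind S(g₁) as g₂ ▷ a.
    -- It crosses as φ(g₂ ▷ a), which recombines with S(g₃) to φ(a) S(g₂); then S(x₁) φ(x₀) = x.
    have h1 : ∀ (a : L) (h : H), sw (δ g) (fun p q => DR.rel.mkQ
        ((ι (S k H h) * ι (S k H q)) ⊗ₜ (α a * ι (S k H p)))) = sw (δ g) (fun p q =>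
          DR.rel.mkQ ((ι (S k H h) * γ (anti φ a) * ι (S k H q)) ⊗ₜ ι (S k H p))) := by
      intro a h
      simp only [C.left_antipode, mul_assoc, C.right_hopf, tmul_sw, mul_sw, sw_tmul, map_sw]
      rw [sw_coassoc g (fun p r q => DR.rel.mkQ
        ((ι (S k H h) * ι (S k H q)) ⊗ₜ (ι (S k H p) * α (YL.act r a))))]
      congr 1
      funext p q
      congr 1
      funext r s
      rw [← ht, ← hs, ← mul_assoc]
      exact (mkQ_rightRel DR.source DR.target _ _ _).symm
    refine (congrArg (sw (YL.coact x)) (funext fun a => funext fun g => h1 a g)).trans ?_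
    rw [sw_comm]
    congr 1
    funext p q
    rw [C.left_eq x]
    simp only [sw_mul, sw_tmul, map_sw]
  right := hD

end IsScalarExt

end Recognition

/-! ### The smash product `L ♯ H` -/

section SmashLeft

variable {k H L R M : Type*} [Field k] [AddCommGroup M] [Module k M] [Ring L] [Algebra k L]
  [Ring R] [Algebra k R] [Ring H]

local notation "δ" => Coalgebra.comul (R := k)
local notation "ε" => Coalgebra.counit (R := k)

namespace LeftModuleAlgebra

variable [Bialgebra k H] (A : LeftModuleAlgebra k H L)

lemma of_mul_of (x y : L) (f g : H) :
    A.of (x ⊗ₜ f) * A.of (y ⊗ₜ g) =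
      sw (δ f) (fun p q => A.of ((x * A.act p y) ⊗ₜ (q * g))) := by
  rw [mul_def, LinearEquiv.symm_apply_apply, LinearEquiv.symm_apply_apply, smashMul_tmul, hMul,
    LinearMap.comp_apply]
  conv_lhs => rw [← sw_self (δ f)]
  simp only [map_sw, sw_apply, equiv_sw, TensorProduct.map₂_apply_tmul, TensorProduct.map_tmul,
    LinearMap.rTensor_tmul,
    LinearMap.mulLeft_apply, LinearMap.mul_apply']

lemma inBase_apply (x : L) : A.inBase x = A.of (x ⊗ₜ 1) := rfl

lemma inHopf_apply (f : H) : A.inHopf f = A.of (1 ⊗ₜ f) := rfl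

lemma inBase_mul_of (x y : L) (g : H) : A.inBase x * A.of (y ⊗ₜ g) = A.of ((x * y) ⊗ₜ g) := by
  rw [inBase_apply, of_mul_of, sw_comul_one (fun p q => A.of ((x * A.act p y) ⊗ₜ (q * g))),
    A.one_act, one_mul]

lemma inBase_mul_inHopf (x : L) (f : H) : A.inBase x * A.inHopf f = A.of (x ⊗ₜ f) := by
  rw [inHopf_apply, inBase_mul_of, mul_one]

lemma inHopf_mul_inBase (f : H) (x : L) :
    A.inHopf f * A.inBase x = sw (δ f) (fun p q => A.inBase (A.act p x) * A.inHopf q) := by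
  simp only [inBase_mul_inHopf]
  simp only [inHopf_apply, inBase_apply, of_mul_of, one_mul, mul_one]

lemma inHopf_mul (f g : H) : A.inHopf (f * g) = A.inHopf f * A.inHopf g := by
  simp only [inHopf_apply, of_mul_of, A.act_one, one_mul, TensorProduct.smul_tmul', map_smul]
  exact (sw_counit_left f (fun q => A.of (1 ⊗ₜ (q * g)))).symm

lemma inBase_mul (x y : L) : A.inBase (x * y) = A.inBase x * A.inBase y :=
  (A.inBase_mul_of x y 1).symm

end LeftModuleAlgebra

variable [HopfAlgebra k H]

/-- `(f₁ ▷ x)₀ ⊗ S((f₁ ▷ x)₁) f₂ = f₂ ▷ x₀ ⊗ f₁ S(x₁)` -/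
lemma LeftRightYD.sw_act_antipode (YL : LeftRightYD k H L) (f : H) (x : L) (F : L → H → M)
    [∀ b, Lin k (fun a => F a b)] [∀ a, Lin k (fun b => F a b)] :
    sw (δ f) (fun p q => sw (YL.coact (YL.act p x)) (fun a h => F a (S k H h * q))) =
      sw (δ f) (fun p q => sw (YL.coact x) (fun a h => F (YL.act q a) (p * S k H h))) := by
  obtain ⟨T, rfl⟩ := exists_bilin (k := k) F
  -- A trivial factor S(q₂) q₃ is inserted, and the Yetter-Drinfeld condition for the first two legs
  -- transfers the action into the coaction. This releases S(q₁) next to p, and p S(q₁) cancels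
  -- afterwards.
  have h1 : ∀ p q : H, sw (YL.coact x) (fun a h => T (YL.act q a) (p * S k H h)) =
      sw (δ q) (fun u w => sw (δ w) (fun r s => sw (YL.coact (YL.act r x)) (fun a h =>
        T a (p * S k H u * S k H h * s)))) := by
    intro p q
    have h2 := sw_antipode_mul_right (k := k) q (fun u w => sw (YL.coact x) (fun a h =>
      T (YL.act u a) (p * S k H h * w)))
    simp only [mul_one] at h2
    rw [← h2, ← sw_coassoc q (fun u r s => sw (YL.coact x) (fun a h =>
      T (YL.act u a) (p * S k H h * (S k H r * s)))), ← sw_coassoc q (fun u r s =>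
        sw (YL.coact (YL.act r x)) (fun a h => T a (p * S k H u * S k H h * s)))]
    congr 1
    funext w s
    have h3 := YL.sw_yetterDrinfeld w x (fun a h => T a (p * S k H h * s))
    simpa only [S_mul, mul_assoc] using h3
  simp only [h1]
  have h4 := sw_mul_antipode_left (k := k) f (fun u q => sw (δ q) (fun r s =>
    sw (YL.coact (YL.act r x)) (fun a h => T a (u * S k H h * s))))
  simp only [one_mul] at h4
  exact h4.symm

namespace LeftRightYD

variable (YL : LeftRightYD k H L) (φ : L ≃ₐ[k] Rᵐᵒᵖ) (hS : Function.Bijective (S k H))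

lemma liftSmash_apply (B : L →ₗ[k] H →ₗ[k] M) (x : L) (f : H) :
    YL.liftSmash B (YL.inBase x * YL.inHopf f) = B x f := by
  rw [YL.inBase_mul_inHopf]
  rfl

lemma comulLift_apply (x : L) (f : H) :
    YL.comulLift (YL.inBase x * YL.inHopf f) =
      sw (δ f) (fun p q => (YL.inBase x * YL.inHopf p) ⊗ₜ YL.inHopf q) := by
  simp only [YL.inBase_mul_inHopf, comulLift, LinearMap.comp_apply, LinearEquiv.coe_coe,
    LinearEquiv.symm_apply_apply, LinearMap.lTensor_tmul]
  conv_lhs => rw [← sw_self (δ f)]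
  simp only [tmul_sw, map_sw, equiv_sw, TensorProduct.assoc_symm_tmul, TensorProduct.map_tmul,
    LinearEquiv.coe_coe]

lemma rightData_source_anti (x : L) : (YL.rightData hS φ).source (anti φ x) =
    sw (YL.coact x) (fun a h => YL.inHopf (S k H (S k H h)) * YL.inBase a) := by
  simp only [rightData, LinearMap.comp_apply, LinearEquiv.coe_coe, LinearEquiv.symm_apply_apply]
  conv_lhs => rw [← sw_self (YL.coact x)]
  simp only [map_sw, LinearMap.lTensor_tmul, LinearMap.comp_apply, hopfMulBase,
    TensorProduct.lift.tmul, LinearMap.compl₁₂_apply, LinearMap.flip_apply, LinearMap.mul_apply']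

variable {YL}

theorem BraidedCommutative.isScalarExt (hb : YL.BraidedCommutative) :
    IsScalarExt φ YL YL.inHopf YL.inBase (YL.rightData hS φ).source where
  hopf_one := rfl
  hopf_mul := YL.inHopf_mul
  left_one := rfl
  left_mul := YL.inBase_mul
  right_one := by
    rw [← anti_one φ, rightData_source_anti,
      YL.sw_coact_one (fun a h => YL.inHopf (S k H (S k H h)) * YL.inBase a), S_one, S_one]
    exact mul_one _
  right_mul := by
    rw [(anti φ).surjective.forall]
    intro x
    rw [(anti φ).surjective.forall]
    intro y
    rw [← anti_mul]
    simp only [rightData_source_anti]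
    rw [YL.sw_coact_mul y x (fun a h => YL.inHopf (S k H (S k H h)) * YL.inBase a), sw_comm,
      sw_mul]
    congr 1
    funext a h
    -- In φ(x) φ(y) = S²(x₁) x₀ φ(y) the factor x₀ commutes with φ(y), giving S²(x₁) S²(y₁) y₀ x₀,
    -- the expansion of φ(y x).
    rw [mul_assoc, sw_right_left_comm YL.inBase_mul (IsScalarExt.left_antipode_of rfl
      YL.inHopf_mul YL.inHopf_mul_inBase) hb]
    simp only [mul_sw, sw_mul, S_mul, YL.inHopf_mul, YL.inBase_mul, mul_assoc]
  hopf_left := YL.inHopf_mul_inBase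
  right_hopf x f := by
    simp only [rightData_source_anti, sw_mul, mul_sw, mul_assoc]
    simp only [IsScalarExt.left_antipode_of rfl YL.inHopf_mul YL.inHopf_mul_inBase, mul_sw,
      ← mul_assoc, ← YL.inHopf_mul, ← S_mul]
    rw [sw_comm]
    exact (YL.sw_act_antipode f x (fun a h => YL.inHopf (S k H h) * YL.inBase a)).symm
  left_eq x := by
    simp only [rightData_source_anti, mul_sw, ← mul_assoc, ← YL.inHopf_mul, ← S_mul]
    -- S(x₂) S²(x₁) = S(S(x₁) x₂) collapses.
    rw [YL.sw_coact_coassoc x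
      (fun b g h => YL.inHopf (S k H (S k H g * h)) * YL.inBase b)]
    have h : ∀ (b : L) (w : H), sw (δ w) (fun g h => YL.inHopf (S k H (S k H g * h)) *
        YL.inBase b) = ε w • (YL.inHopf (S k H 1) * YL.inBase b) := fun b w =>
      sw_antipode_mul w (fun u => YL.inHopf (S k H u) * YL.inBase b)
    simp only [h]
    rw [YL.sw_coact_counit x (fun b => YL.inHopf (S k H 1) * YL.inBase b), S_one]
    exact (one_mul _).symm
  right_eq x := rightData_source_anti YL φ hS x
  span_left z := ⟨YL.of.symm z, by
    simp only [YL.inBase_mul_inHopf]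
    rw [← equiv_sw, sw_self, LinearEquiv.apply_symm_apply]⟩

theorem BraidedCommutative.isLeftExt (hb : YL.BraidedCommutative) :
    IsLeftExt YL YL.inHopf YL.inBase (YL.rightData hS φ).source YL.leftData := by
  have ht : ∀ x, YL.leftData.target x = YL.targetMap YL.inHopf YL.inBase x := fun x => by
    rw [YL.targetMap_apply]
    simp only [YL.inBase_mul_inHopf]
    rw [← equiv_sw, sw_self]
    rfl
  refine ⟨fun _ => rfl, ht, (hb.isScalarExt φ hS).isExtComul_left_of_left (fun _ => rfl) ht
    fun x f => ?_, fun x f => ?_⟩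
  · change Submodule.mkQ _ (YL.comulLift _) = _
    rw [comulLift_apply, map_sw]
    rfl
  · exact (YL.liftSmash_apply _ x f).trans rfl

theorem BraidedCommutative.isRightExt (hb : YL.BraidedCommutative) :
    IsRightExt φ YL.inHopf YL.inBase (YL.rightData hS φ).source (YL.rightData hS φ) := by
  have C := hb.isScalarExt φ hS
  have ht : ∀ x, (YL.rightData hS φ).target (anti φ x) = YL.inBase x := fun x => by
    simp [rightData]
  have h1 : ∀ x f, (YL.rightData hS φ).counit (YL.inBase x * YL.inHopf f) =
      anti φ (YL.act (SInv hS f) x) := fun x f =>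
    congrArg (anti φ) (YL.liftSmash_apply _ x f)
  -- The counit is defined on x f, whereas f φ(x) requires it on f x = (f₁ ▷ x) f₂: the action there
  -- is by S⁻¹(f₂) f₁, which for f = S(g) is g₁ S(g₂).
  have h2 : ∀ x f, (YL.rightData hS φ).counit (YL.inHopf f * YL.inBase x) =
      ε f • anti φ x := fun x f => by
    obtain ⟨g, rfl⟩ := hS.2 f
    simp only [YL.inHopf_mul_inBase, map_sw, h1, ← YL.mul_act]
    rw [sw_comul_antipode g (fun p q => anti φ (YL.act (SInv hS q * p) x))]
    simp only [SInv_S, counit_S]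
    have h := sw_mul_antipode (k := k) g (fun u => anti φ (YL.act u x))
    simpa only [YL.one_act] using h
  refine ⟨fun _ => rfl, ht, C.isExtComul_right_of_left (fun _ => rfl) ht
    fun x f => ?_, fun f y => ?_⟩
  · change Submodule.mkQ _ (YL.comulLift _) = _
    rw [comulLift_apply, map_sw]
    rfl
  · obtain ⟨x, rfl⟩ := (anti φ).surjective y
    rw [C.right_eq]
    simp only [mul_sw, ← mul_assoc, ← YL.inHopf_mul, map_sw, h2, Bialgebra.counit_mul, counit_S,
      mul_smul, ← smul_sw]
    rw [YL.sw_coact_counit x (fun a => anti φ a)]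

lemma antipode_apply (x : L) (f : H) : YL.antipode (YL.inBase x * YL.inHopf f) =
    YL.inHopf (S k H f) * (YL.rightData hS φ).source (anti φ x) := by
  refine (YL.liftSmash_apply _ x f).trans ?_
  simp [rightData]

end LeftRightYD

end SmashLeft

/-! ### The smash product `H ♯ R` -/

section SmashRight

variable {k H L R M : Type*} [Field k] [AddCommGroup M] [Module k M] [Ring L] [Algebra k L]
  [Ring R] [Algebra k R] [Ring H]

local notation "δ" => Coalgebra.comul (R := k)
local notation "ε" => Coalgebra.counit (R := k)

namespace RightModuleAlgebra

variable [Bialgebra k H] (A : RightModuleAlgebra k H R)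

lemma of_mul_of (f g : H) (x y : R) :
    A.of (f ⊗ₜ x) * A.of (g ⊗ₜ y) =
      sw (δ g) (fun p q => A.of ((f * p) ⊗ₜ (A.act x q * y))) := by
  rw [mul_def, LinearEquiv.symm_apply_apply, LinearEquiv.symm_apply_apply, smashMulFlip_tmul, hMul,
    LinearMap.comp_apply]
  conv_lhs => rw [← sw_self (δ g)]
  simp only [map_sw, sw_apply, equiv_sw, TensorProduct.map₂_apply_tmul, TensorProduct.map_tmul,
    LinearMap.lTensor_tmul, LinearMap.mulRight_apply, LinearMap.flip_apply, LinearMap.mul_apply']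

lemma inBase_apply (x : R) : A.inBase x = A.of (1 ⊗ₜ x) := rfl

lemma inHopf_apply (f : H) : A.inHopf f = A.of (f ⊗ₜ 1) := rfl

lemma of_mul_inBase (f : H) (x y : R) : A.of (f ⊗ₜ x) * A.inBase y = A.of (f ⊗ₜ (x * y)) := by
  rw [inBase_apply, of_mul_of, sw_comul_one (fun p q => A.of ((f * p) ⊗ₜ (A.act x q * y))),
    A.act_one_right, mul_one]

lemma inHopf_mul_inBase (f : H) (y : R) : A.inHopf f * A.inBase y = A.of (f ⊗ₜ y) := by
  rw [inHopf_apply, of_mul_inBase, one_mul]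

lemma inBase_mul_inHopf (f : H) (x : R) :
    A.inBase x * A.inHopf f = sw (δ f) (fun p q => A.inHopf p * A.inBase (A.act x q)) := by
  simp only [inHopf_mul_inBase]
  simp only [inHopf_apply, inBase_apply, of_mul_of, one_mul, mul_one]

lemma inHopf_mul (f g : H) : A.inHopf (f * g) = A.inHopf f * A.inHopf g := by
  simp only [inHopf_apply, of_mul_of, A.one_act, mul_one, TensorProduct.tmul_smul, map_smul]
  exact (sw_counit_right g (fun q => A.of ((f * q) ⊗ₜ 1))).symm

lemma inBase_mul (x y : R) : A.inBase (x * y) = A.inBase x * A.inBase y :=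
  (A.of_mul_inBase 1 x y).symm

end RightModuleAlgebra

variable [HopfAlgebra k H]

namespace RightLeftYD

variable (YR : RightLeftYD k H R) (φ : L ≃ₐ[k] Rᵐᵒᵖ) (hS : Function.Bijective (S k H))

lemma liftSmash_apply (B : H →ₗ[k] R →ₗ[k] M) (f : H) (y : R) :
    YR.liftSmash B (YR.inHopf f * YR.inBase y) = B f y := by
  rw [YR.inHopf_mul_inBase]
  rfl

lemma comulLift_apply (f : H) (y : R) :
    YR.comulLift (YR.inHopf f * YR.inBase y) =
      sw (δ f) (fun p q => YR.inHopf p ⊗ₜ (YR.inHopf q * YR.inBase y)) := by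
  simp only [YR.inHopf_mul_inBase, comulLift, LinearMap.comp_apply, LinearEquiv.coe_coe,
    LinearEquiv.symm_apply_apply, LinearMap.rTensor_tmul]
  conv_lhs => rw [← sw_self (δ f)]
  simp only [sw_tmul, map_sw, equiv_sw, TensorProduct.assoc_tmul, TensorProduct.map_tmul,
    LinearEquiv.coe_coe]

end RightLeftYD

namespace Linked

variable {YL : LeftRightYD k H L} {YR : RightLeftYD k H R} {φ : L ≃ₐ[k] Rᵐᵒᵖ}
  (h : Linked φ YL YR) (hS : Function.Bijective (S k H))

include h

lemma leftData_source (x : L) : (YR.leftData hS φ).source x =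
    sw (YL.coact x) (fun a g => YR.inHopf (S k H g) * YR.inBase (anti φ a)) := by
  simp only [YR.inHopf_mul_inBase]
  change YR.of (YR.coact (anti φ x)) = _
  rw [h.coact, equiv_sw]

lemma right_hopf (x : L) (f : H) : YR.inBase (anti φ x) * YR.inHopf (S k H f) =
    sw (δ f) (fun p q => YR.inHopf (S k H q) * YR.inBase (anti φ (YL.act p x))) := by
  rw [YR.inBase_mul_inHopf,
    sw_comul_antipode f (fun p q => YR.inHopf p * YR.inBase (YR.act (anti φ x) q))]
  simp only [h.act]

/-- Here x is S(x₁) φ(x₀) by definition, so S²(x₂) S(x₁) = S(x₁ S(x₂)) collapses. -/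
lemma right_eq (x : L) : YR.inBase (anti φ x) = sw (YL.coact x) (fun a g =>
    YR.inHopf (S k H (S k H g)) * (YR.leftData hS φ).source a) := by
  simp only [h.leftData_source, mul_sw, ← mul_assoc, ← YR.inHopf_mul, ← S_mul]
  rw [YL.sw_coact_coassoc x
    (fun b g h => YR.inHopf (S k H (g * S k H h)) * YR.inBase (anti φ b))]
  have h1 : ∀ (b : L) (w : H), sw (δ w) (fun g h => YR.inHopf (S k H (g * S k H h)) *
      YR.inBase (anti φ b)) = ε w • (YR.inHopf (S k H 1) * YR.inBase (anti φ b)) := fun b w =>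
    sw_mul_antipode w (fun u => YR.inHopf (S k H u) * YR.inBase (anti φ b))
  simp only [h1]
  rw [YL.sw_coact_counit x (fun b => YR.inHopf (S k H 1) * YR.inBase (anti φ b)), S_one]
  exact (one_mul _).symm

lemma hopf_left (f : H) (x : L) : YR.inHopf f * (YR.leftData hS φ).source x =
    sw (δ f) (fun p q => (YR.leftData hS φ).source (YL.act p x) * YR.inHopf q) := by
  obtain ⟨g, rfl⟩ := hS.2 f
  rw [sw_comul_antipode g
    (fun p q => (YR.leftData hS φ).source (YL.act p x) * YR.inHopf q)]
  -- In x = S(x₁) φ(x₀) the factor φ(x₀) is moved past S(p); the Yetter-Drinfeld condition then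
  -- turns this into an action by p₂ S(q), which cancels in the full sum.
  have h1 : ∀ p q : H, (YR.leftData hS φ).source (YL.act (S k H q) x) * YR.inHopf (S k H p) =
      sw (δ p) (fun u v => sw (YL.coact (YL.act (v * S k H q) x)) (fun a g =>
        YR.inHopf (S k H (g * u)) * YR.inBase (anti φ a))) := by
    intro p q
    simp only [h.leftData_source, sw_mul, mul_assoc, h.right_hopf, mul_sw]
    rw [sw_comm]
    simp only [← mul_assoc, ← YR.inHopf_mul, ← S_mul, YL.mul_act]
    exact YL.sw_yetterDrinfeld p _ (fun a h => YR.inHopf (S k H h) * YR.inBase (anti φ a))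
  simp only [h1]
  rw [sw_coassoc g (fun u v q => sw (YL.coact (YL.act (v * S k H q) x)) (fun a g =>
        YR.inHopf (S k H (g * u)) * YR.inBase (anti φ a))),
    sw_mul_antipode_right g (fun u w => sw (YL.coact (YL.act w x)) (fun a g =>
        YR.inHopf (S k H (g * u)) * YR.inBase (anti φ a))), YL.one_act, h.leftData_source, mul_sw]
  simp only [S_mul, YR.inHopf_mul, mul_assoc]

theorem isScalarExt (hb : YL.BraidedCommutative) :
    IsScalarExt φ YL YR.inHopf (YR.leftData hS φ).source YR.inBase where
  hopf_one := rfl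
  hopf_mul := YR.inHopf_mul
  left_one := by
    rw [h.leftData_source,
      YL.sw_coact_one (fun a g => YR.inHopf (S k H g) * YR.inBase (anti φ a)), S_one, anti_one]
    exact mul_one _
  left_mul x y := by
    simp only [h.leftData_source]
    rw [YL.sw_coact_mul x y (fun a g => YR.inHopf (S k H g) * YR.inBase (anti φ a)), sw_mul]
    congr 1
    funext a g
    -- Moving φ(a) past S(u) produces φ(u₁ ▷ a) φ(b) = φ(b (u₁ ▷ a)), and braided commutativity of L
    -- reduces this to φ(a b).
    have h1 : ∀ (b : L) (u : H), YR.inHopf (S k H g) * YR.inBase (anti φ a) *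
        (YR.inHopf (S k H u) * YR.inBase (anti φ b)) = sw (δ u) (fun p q =>
          YR.inHopf (S k H g) * (YR.inHopf (S k H q) *
            YR.inBase (anti φ (b * YL.act p a)))) := by
      intro b u
      rw [mul_assoc, ← mul_assoc (YR.inBase _), h.right_hopf]
      simp only [sw_mul, mul_sw, anti_mul, YR.inBase_mul, mul_assoc]
    rw [mul_sw]
    simp only [h1]
    rw [← YL.sw_coact_coassoc y (fun b p q => YR.inHopf (S k H g) * (YR.inHopf (S k H q) *
            YR.inBase (anti φ (b * YL.act p a))))]
    congr 1
    funext b u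
    rw [hb.sw_mul_act a b (fun c => YR.inHopf (S k H g) * (YR.inHopf (S k H u) *
      YR.inBase (anti φ c))), ← mul_assoc, ← YR.inHopf_mul, S_mul]
  right_one := rfl
  right_mul := YR.inBase_mul
  hopf_left := h.hopf_left hS
  right_hopf := h.right_hopf
  left_eq := h.leftData_source hS
  right_eq := h.right_eq hS
  span_left z := by
    suffices hz : z ∈ LinearMap.range (lin₂ (k := k) (fun (x : L) (f : H) =>
        (YR.leftData hS φ).source x * YR.inHopf f)) by
      obtain ⟨t, rfl⟩ := hz
      exact ⟨t, sw_eq_lin₂ _ _⟩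
    have hz : z = sw (YR.of.symm z) (fun f y => YR.inHopf f * YR.inBase y) := by
      simp only [YR.inHopf_mul_inBase]
      rw [← equiv_sw, sw_self, LinearEquiv.apply_symm_apply]
    rw [hz]
    refine sw_mem _ fun f y => ?_
    obtain ⟨x, rfl⟩ := (anti φ).surjective y
    rw [h.right_eq hS, mul_sw]
    refine sw_mem _ fun a g => ?_
    rw [← mul_assoc, ← YR.inHopf_mul, h.hopf_left]
    exact sw_mem _ fun p q => ⟨_ ⊗ₜ _, lin₂_tmul _ _ _⟩

theorem isRightExt (hb : YL.BraidedCommutative) :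
    IsRightExt φ YR.inHopf (YR.leftData hS φ).source YR.inBase YR.rightData := by
  refine ⟨fun _ => rfl, fun _ => rfl, (h.isScalarExt hS hb).isExtComul_right_of_right hS
    (fun _ => rfl) (fun _ => rfl) fun f y => ?_, fun f y => ?_⟩
  · change Submodule.mkQ _ (YR.comulLift _) = _
    rw [YR.comulLift_apply, map_sw]
    rfl
  · exact YR.liftSmash_apply _ f y

theorem isLeftExt (hb : YL.BraidedCommutative) :
    IsLeftExt YL YR.inHopf (YR.leftData hS φ).source YR.inBase (YR.leftData hS φ) := by
  have C := h.isScalarExt hS hb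
  -- Since λ(φ(x)) = S(x₁) ⊗ φ(x₀), the given target is φ(S⁻¹(x₁) ▷ x₀), which is x₀ x₁ by
  -- `target_eq_right`.
  have ht : ∀ x, (YR.leftData hS φ).target x =
      YL.targetMap YR.inHopf (YR.leftData hS φ).source x := fun x => by
    rw [C.target_eq_right hS, YL.untwist_apply]
    change YR.inBase (YR.actFlip ((SInv hS).rTensor R (YR.coact (anti φ x)))) = _
    rw [h.coact]
    simp only [map_sw, equiv_sw, LinearMap.rTensor_tmul, SInv_S, ← h.act, S_SInv]
    rfl
  have h1 : ∀ f x, (YR.leftData hS φ).counit (YR.inHopf f * YR.inBase (anti φ x)) =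
      sw (YL.coact x) (fun a g => YL.act (f * S k H (S k H g)) a) := fun f x => by
    simp only [RightLeftYD.leftData, LinearMap.comp_apply, RightLeftYD.liftSmash_apply, h.coact,
      LinearMap.compl₂_apply]
    simp only [map_sw, equiv_sw, LinearMap.rTensor_tmul, LinearMap.comp_apply,
      LinearMap.coe_rTensorHom, LinearMap.flip_apply, LinearMap.mul_apply', RightLeftYD.actFlip,
      TensorProduct.lift.tmul, ← S_mul, h.act, LinearEquiv.coe_coe, LinearEquiv.symm_apply_apply]
  -- The definition gives the counit on f φ(x) as f S²(x₁) ▷ x₀. Inserting x = S(x₁) φ(x₀) makes the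
  -- powers of S cancel; the values on x S(g) then follow from x S(g) = S(g₁) (g₂ ▷ x).
  have h2 : ∀ f x, (YR.leftData hS φ).counit (YR.inHopf f * (YR.leftData hS φ).source x) =
      YL.act f x := fun f x => by
    rw [h.leftData_source]
    simp only [mul_sw, ← mul_assoc, ← YR.inHopf_mul, map_sw, h1]
    simp only [mul_assoc, ← S_mul]
    rw [YL.sw_coact_coassoc x (fun b g h => YL.act (f * S k H (S k H g * h)) b)]
    have h3 : ∀ (b : L) (w : H), sw (δ w) (fun g h => YL.act (f * S k H (S k H g * h)) b) =
      ε w • YL.act (f * S k H 1) b := fun b w =>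
        sw_antipode_mul w (fun u => YL.act (f * S k H u) b)
    simp only [h3, S_one, mul_one]
    exact YL.sw_coact_counit x (fun b => YL.act f b)
  refine ⟨fun _ => rfl, ht, C.isExtComul_left_of_right hS (fun _ => rfl) ht
    fun f y => ?_, fun x f => ?_⟩
  · change Submodule.mkQ _ (YR.comulLift _) = _
    rw [YR.comulLift_apply, map_sw]
    rfl
  · obtain ⟨g, rfl⟩ := hS.2 f
    simp only [C.left_antipode, map_sw, h2, ← YL.mul_act]
    have h4 := sw_antipode_mul (k := k) g (fun u => YL.act u x)
    rwa [YL.one_act, ← counit_S] at h4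

lemma antipode_apply (hb : YL.BraidedCommutative) (x : L) (f : H) :
    YR.antipode ((YR.leftData hS φ).source x * YR.inHopf f) =
      YR.inHopf (S k H f) * YR.inBase (anti φ x) := by
  have C := h.isScalarExt hS hb
  have h1 : ∀ f x, YR.antipode (YR.inHopf f * YR.inBase (anti φ x)) =
      sw (YL.coact x) (fun a g =>
        YR.inBase (anti φ a) * YR.inHopf (S k H (f * S k H (S k H g)))) := fun f x => by
    refine (YR.liftSmash_apply _ f (anti φ x)).trans ?_
    simp only [LinearMap.compl₁₂_apply, LinearMap.flip_apply, LinearMap.comp_apply, h.coact,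
      LinearMap.mul_apply']
    simp only [map_sw, sw_mul, LinearMap.rTensor_tmul, LinearMap.comp_apply,
      RightLeftYD.baseMulHopf, TensorProduct.lift.tmul, LinearMap.compl₁₂_apply,
      LinearMap.flip_apply, LinearMap.mul_apply', S_mul, YR.inHopf_mul, mul_assoc]
  -- On f x the antipode is φ(x) S(f), by the same cancellation as for the counit. The normal form x
  -- S(g) = S(g₁) (g₂ ▷ x) is then sent to φ(g₂ ▷ x) S²(g₁), where moving φ past S² leaves S(g₂) g₃
  -- acting trivially.
  have h2 : ∀ f x, YR.antipode (YR.inHopf f * (YR.leftData hS φ).source x) =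
      YR.inBase (anti φ x) * YR.inHopf (S k H f) := fun f x => by
    rw [h.leftData_source]
    simp only [mul_sw, ← mul_assoc, ← YR.inHopf_mul, map_sw, h1]
    simp only [mul_assoc, ← S_mul]
    rw [YL.sw_coact_coassoc x (fun b g h =>
      YR.inBase (anti φ b) * YR.inHopf (S k H (f * S k H (S k H g * h))))]
    have h3 : ∀ (b : L) (w : H), sw (δ w) (fun g h =>
        YR.inBase (anti φ b) * YR.inHopf (S k H (f * S k H (S k H g * h)))) =
      ε w • (YR.inBase (anti φ b) * YR.inHopf (S k H (f * S k H 1))) := fun b w =>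
        sw_antipode_mul w (fun u => YR.inBase (anti φ b) * YR.inHopf (S k H (f * S k H u)))
    simp only [h3, S_one, mul_one]
    exact YL.sw_coact_counit x (fun b => YR.inBase (anti φ b) * YR.inHopf (S k H f))
  obtain ⟨g, rfl⟩ := hS.2 f
  rw [C.left_antipode, map_sw]
  simp only [h2, h.right_hopf]
  have h3 : ∀ p q : H, sw (δ (S k H p)) (fun u v =>
      YR.inHopf (S k H v) * YR.inBase (anti φ (YL.act u (YL.act q x)))) = sw (δ p) (fun u v =>
        YR.inHopf (S k H (S k H u)) * YR.inBase (anti φ (YL.act (S k H v * q) x))) := by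
    intro p q
    rw [sw_comul_antipode p (fun u v =>
      YR.inHopf (S k H v) * YR.inBase (anti φ (YL.act u (YL.act q x))))]
    simp only [YL.mul_act]
  simp only [h3]
  rw [sw_coassoc g (fun u v q =>
        YR.inHopf (S k H (S k H u)) * YR.inBase (anti φ (YL.act (S k H v * q) x))),
    sw_antipode_mul_right g (fun u w =>
      YR.inHopf (S k H (S k H u)) * YR.inBase (anti φ (YL.act w x))), YL.one_act]

end Linked

end SmashRight

/-! ### The isomorphism of the two presentations -/

section Isomorphism

variable {k H L R K K' : Type*} [Field k] [Ring L] [Algebra k L]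
  [Ring R] [Algebra k R] [Ring H] [HopfAlgebra k H] [Ring K] [Algebra k K] [Ring K'] [Algebra k K']

local notation "δ" => Coalgebra.comul (R := k)

namespace IsScalarExt

variable {φ : L ≃ₐ[k] Rᵐᵒᵖ} {YL : LeftRightYD k H L} {ι : H →ₗ[k] K} {α : L →ₗ[k] K}
  {γ : R →ₗ[k] K} {ι' : H →ₗ[k] K'} {α' : L →ₗ[k] K'} {γ' : R →ₗ[k] K'}
  {Ψ : K →ₗ[k] K'} (C : IsScalarExt φ YL ι α γ) (C' : IsScalarExt φ YL ι' α' γ')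
  (hΨ : ∀ x f, Ψ (α x * ι f) = α' x * ι' f)

include C C' hΨ

lemma map_left (x : L) : Ψ (α x) = α' x := by
  simpa [C.hopf_one, C'.hopf_one] using hΨ x 1

lemma map_hopf (f : H) : Ψ (ι f) = ι' f := by
  simpa [C.left_one, C'.left_one] using hΨ 1 f

/-- The product of two normal forms is determined by f y = (f₁ ▷ y) f₂, with the same action of H on
L in K and in K'. -/
lemma map_mul (z w : K) : Ψ (z * w) = Ψ z * Ψ w := by
  refine C.ext_left (T := Ψ ∘ₗ LinearMap.mulRight k w) (U := LinearMap.mulRight k (Ψ w) ∘ₗ Ψ)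
    (fun x f => ?_) z
  refine C.ext_left (T := Ψ ∘ₗ LinearMap.mulLeft k (α x * ι f))
    (U := LinearMap.mulLeft k (Ψ (α x * ι f)) ∘ₗ Ψ) (fun y g => ?_) w
  simp only [LinearMap.comp_apply, LinearMap.mulRight_apply, LinearMap.mulLeft_apply, hΨ]
  have h1 : α x * ι f * (α y * ι g) =
      sw (δ f) (fun p q => α (x * YL.act p y) * ι (q * g)) := by
    rw [mul_assoc, ← mul_assoc (ι f), C.hopf_left]
    simp only [sw_mul, mul_sw, C.left_mul, C.hopf_mul, mul_assoc]
  rw [h1, mul_assoc, ← mul_assoc (ι' f), C'.hopf_left]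
  simp only [map_sw, hΨ]
  simp only [sw_mul, mul_sw, C'.left_mul, C'.hopf_mul, mul_assoc]

lemma map_right (y : R) : Ψ (γ y) = γ' y := by
  obtain ⟨x, rfl⟩ := (anti φ).surjective y
  rw [C.right_eq, C'.right_eq]
  simp only [map_sw, C.map_mul C' hΨ, C.map_hopf C' hΨ, C.map_left C' hΨ]

lemma map_target (x : L) : Ψ (YL.targetMap ι α x) = YL.targetMap ι' α' x := by
  simp only [YL.targetMap_apply, map_sw, hΨ]

variable {DL : LeftBialgebroidData k L K} {DR : RightBialgebroidData k R K} {τ : K →ₗ[k] K}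
  {DL' : LeftBialgebroidData k L K'} {DR' : RightBialgebroidData k R K'} {τ' : K' →ₗ[k] K'}

lemma leftRel_le_comap (EL : IsLeftExt YL ι α γ DL) (EL' : IsLeftExt YL ι' α' γ' DL') :
    DL.rel ≤ DL'.rel.comap (TensorProduct.map Ψ Ψ) :=
  balRel_le_comap fun a x y => by
    change DL'.rel.mkQ (Ψ (DL.target a * x) ⊗ₜ Ψ y) = DL'.rel.mkQ (Ψ x ⊗ₜ Ψ (DL.source a * y))
    rw [C.map_mul C' hΨ, C.map_mul C' hΨ, EL.target, EL.source, C.map_target C' hΨ,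
      C.map_left C' hΨ, ← EL'.target, ← EL'.source]
    exact mkQ_leftRel DL'.source DL'.target _ _ _

lemma rightRel_le_comap (ER : IsRightExt φ ι α γ DR) (ER' : IsRightExt φ ι' α' γ' DR') :
    DR.rel ≤ DR'.rel.comap (TensorProduct.map Ψ Ψ) :=
  balRel_le_comap fun a x y => by
    obtain ⟨b, rfl⟩ := (anti φ).surjective a
    change DR'.rel.mkQ (Ψ (x * DR.source (anti φ b)) ⊗ₜ Ψ y) =
      DR'.rel.mkQ (Ψ x ⊗ₜ Ψ (y * DR.target (anti φ b)))
    rw [C.map_mul C' hΨ, C.map_mul C' hΨ, ER.target, ER.source, C.map_right C' hΨ,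
      C.map_left C' hΨ, ← ER'.target, ← ER'.source]
    exact mkQ_rightRel DR'.source DR'.target _ _ _

theorem isHopfAlgebroidIso (hS : Function.Bijective (S k H))
    (EL : IsLeftExt YL ι α γ DL) (ER : IsRightExt φ ι α γ DR)
    (EL' : IsLeftExt YL ι' α' γ' DL') (ER' : IsRightExt φ ι' α' γ' DR')
    (hτ : ∀ x f, τ (α x * ι f) = ι (S k H f) * γ (anti φ x))
    (hτ' : ∀ x f, τ' (α' x * ι' f) = ι' (S k H f) * γ' (anti φ x))
    {Φ : K' →ₗ[k] K} (hΦ : ∀ f y, Φ (ι' f * γ' y) = ι f * γ y) :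
    IsHopfAlgebroidIso DL DR τ DL' DR' τ' Ψ where
  bijective := by
    -- Ψ matches the normal forms x f, Φ the normal forms f y. Since Ψ also respects γ and products,
    -- the composites are tested on f y.
    refine Function.bijective_iff_has_inverse.2 ⟨Φ, fun z => ?_, fun z => ?_⟩
    · refine C.ext_right hS (T := Φ ∘ₗ Ψ) (U := LinearMap.id) (fun f y => ?_) z
      rw [LinearMap.comp_apply, C.map_mul C' hΨ, C.map_hopf C' hΨ, C.map_right C' hΨ, hΦ]
      rfl
    · refine C'.ext_right hS (T := Ψ ∘ₗ Φ) (U := LinearMap.id) (fun f y => ?_) z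
      rw [LinearMap.comp_apply, hΦ, C.map_mul C' hΨ, C.map_hopf C' hΨ, C.map_right C' hΨ]
      rfl
  map_one := by rw [← C.left_one, C.map_left C' hΨ, C'.left_one]
  map_mul := C.map_mul C' hΨ
  sourceL x := by rw [EL.source, EL'.source, C.map_left C' hΨ]
  targetL x := by rw [EL.target, EL'.target, C.map_target C' hΨ]
  counitL := C.ext_left (T := DL'.counit ∘ₗ Ψ) (U := DL.counit) fun x f => by
    rw [LinearMap.comp_apply, hΨ, EL.counit, EL'.counit]
  mapL_wd := C.leftRel_le_comap C' hΨ EL EL'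
  comulL := C.ext_left (T := Submodule.mapQ DL.rel DL'.rel (TensorProduct.map Ψ Ψ)
      (C.leftRel_le_comap C' hΨ EL EL') ∘ₗ DL.comul) (U := DL'.comul ∘ₗ Ψ) fun x f => by
    simp only [LinearMap.comp_apply, hΨ, EL.comul.left, EL'.comul.left, map_sw]
    congr 1
    funext p q
    rw [← C.map_hopf C' hΨ q, ← hΨ]
    rfl
  sourceR y := by rw [ER.source, ER'.source, C.map_right C' hΨ]
  targetR y := by
    obtain ⟨x, rfl⟩ := (anti φ).surjective y
    rw [ER.target, ER'.target, C.map_left C' hΨ]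
  counitR := C.ext_right hS (T := DR'.counit ∘ₗ Ψ) (U := DR.counit) fun f y => by
    rw [LinearMap.comp_apply, C.map_mul C' hΨ, C.map_hopf C' hΨ, C.map_right C' hΨ, ER.counit,
      ER'.counit]
  mapR_wd := C.rightRel_le_comap C' hΨ ER ER'
  comulR := C.ext_left (T := Submodule.mapQ DR.rel DR'.rel (TensorProduct.map Ψ Ψ)
      (C.rightRel_le_comap C' hΨ ER ER') ∘ₗ DR.comul) (U := DR'.comul ∘ₗ Ψ) fun x f => by
    simp only [LinearMap.comp_apply, hΨ, ER.comul.left, ER'.comul.left, map_sw]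
    congr 1
    funext p q
    rw [← C.map_hopf C' hΨ q, ← hΨ]
    rfl
  antipode := C.ext_left (T := Ψ ∘ₗ τ) (U := τ' ∘ₗ Ψ) fun x f => by
    rw [LinearMap.comp_apply, LinearMap.comp_apply, hΨ, hτ, hτ', C.map_mul C' hΨ,
      C.map_hopf C' hΨ, C.map_right C' hΨ]

end IsScalarExt

variable {YL : LeftRightYD k H L} {YR : RightLeftYD k H R} {φ : L ≃ₐ[k] Rᵐᵒᵖ}

theorem LeftRightYD.BraidedCommutative.isSymmetricHopfAlgebroid (hb : YL.BraidedCommutative)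
    (φ : L ≃ₐ[k] Rᵐᵒᵖ) (hS : Function.Bijective (S k H)) :
    IsSymmetricHopfAlgebroid YL.leftData (YL.rightData hS φ) YL.antipode :=
  (hb.isScalarExt φ hS).isSymmetricHopfAlgebroid (LeftRightYD.antipode_apply φ hS) hS hb
    (hb.isLeftExt φ hS) (hb.isRightExt φ hS)

theorem Linked.isSymmetricHopfAlgebroid (h : Linked φ YL YR) (hS : Function.Bijective (S k H))
    (hb : YL.BraidedCommutative) :
    IsSymmetricHopfAlgebroid (YR.leftData hS φ) YR.rightData YR.antipode :=
  (h.isScalarExt hS hb).isSymmetricHopfAlgebroid (h.antipode_apply hS hb) hS hb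
    (h.isLeftExt hS hb) (h.isRightExt hS hb)

theorem Linked.sameHopfAlgebroid (h : Linked φ YL YR) (hS : Function.Bijective (S k H))
    (hb : YL.BraidedCommutative) : SameHopfAlgebroid hS φ YL YR :=
  (hb.isScalarExt φ hS).isHopfAlgebroidIso (h.isScalarExt hS hb)
    (fun x f => YL.liftSmash_apply _ x f) hS (hb.isLeftExt φ hS) (hb.isRightExt φ hS)
    (h.isLeftExt hS hb) (h.isRightExt hS hb) (LeftRightYD.antipode_apply φ hS)
    (h.antipode_apply hS hb)
    -- The inverse sends f ♯ y to f · α_R(y), computed in L ♯ H.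
    (Φ := YR.liftSmash ((LinearMap.mul k YL.Smash).compl₁₂ YL.inHopf (YL.rightData hS φ).source))
    (fun f y => YR.liftSmash_apply _ f y)

end Isomorphism

end ScalarExt

theorem corollary4p12 {k H L R : Type*} [Field k] [Ring H] [HopfAlgebra k H]
    [Ring L] [Algebra k L] [Ring R] [Algebra k R]
    (hS : Function.Bijective (HopfAlgebra.antipode k : H →ₗ[k] H)) (φ : L ≃ₐ[k] Rᵐᵒᵖ) :
    (∀ YL : LeftRightYD k H L, YL.BraidedCommutative →
      IsSymmetricHopfAlgebroid YL.leftData (YL.rightData hS φ) YL.antipode) ∧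
    (∀ YR : RightLeftYD k H R, YR.BraidedCommutative →
      IsSymmetricHopfAlgebroid (YR.leftData hS φ) YR.rightData YR.antipode) ∧
    (∀ YL : LeftRightYD k H L, YL.BraidedCommutative →
      (∃ YR : RightLeftYD k H R, RightDeterminedByLeft hS φ YL YR) ∧
      ∀ YR : RightLeftYD k H R, RightDeterminedByLeft hS φ YL YR →
        YR.BraidedCommutative ∧ SameHopfAlgebroid hS φ YL YR) ∧
    (∀ YR : RightLeftYD k H R, YR.BraidedCommutative →
      (∃ YL : LeftRightYD k H L, LeftDeterminedByRight hS φ YR YL) ∧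
      ∀ YL : LeftRightYD k H L, LeftDeterminedByRight hS φ YR YL →
        YL.BraidedCommutative ∧ SameHopfAlgebroid hS φ YL YR) := by
  refine ⟨fun YL hb => hb.isSymmetricHopfAlgebroid φ hS, fun YR hb => ?_,
    fun YL hb => ⟨⟨_, YL.rightDetermined_toRightLeft hS φ⟩, fun YR h => ?_⟩,
    fun YR hb => ⟨⟨_, YR.leftDetermined_toLeftRight hS φ⟩, fun YL h => ?_⟩⟩
  · have h := (YR.leftDetermined_toLeftRight hS φ).linked
    exact h.isSymmetricHopfAlgebroid hS (h.braidedCommutative_iff.2 hb)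
  · exact ⟨h.linked.braidedCommutative_iff.1 hb, h.linked.sameHopfAlgebroid hS hb⟩
  · have hb' := h.linked.braidedCommutative_iff.2 hb
    exact ⟨hb', h.linked.sameHopfAlgebroid hS hb'⟩
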